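/- For rational numbers $a,b$ and an integer $m\ge 1$, write $a\equiv b\pmod m$ if $a-b=m\,c$ for some rational number $c$ whose reduced denominator is coprime to $m$. Let $H_n(1)=\sum_{k=1}^{n}\frac1k$, and let $B_n$ denote the $n$-th Bernoulli number. Then for every prime $p>5$, $$\sum_{k=0}^{(p-3)/2}\frac{\binom{2k}{k}}{16^k(2k+1)}\equiv(-1)^{(p-1)/2}\left(\frac{H_{p-1}(1)}{12}+\frac{3}{160}\,p^4B_{p-5}\right)\pmod{p^5}$$ and $$\sum_{k=0}^{(p-3)/2}\frac{\binom{2k}{k}}{(-16)^k(2k+1)^2}\equiv\frac{H_{p-1}(1)}{5p}+\frac{7}{200}\,p^3B_{p-5}\pmod{p^4}.$$ -/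

import Mathlib

/-- The generalized harmonic number `H_n(r) = ∑_{k=1}^n 1 / k^r`, a rational number. -/
def harmonicSum (n r : ℕ) : ℚ :=
  ∑ k ∈ Finset.Icc 1 n, 1 / (k : ℚ) ^ r

/-- Congruence of rational numbers: `a ≡ b (mod m)` means that `a - b` is `m` times a rational
number whose reduced denominator is coprime to `m`. For `m = p ^ e` with `p` prime and `0 < e`
this says that `a - b` lies in `p ^ e ℤ_(p)`. -/
def RatModEq (m : ℕ) (a b : ℚ) : Prop :=
  ∃ c : ℚ, c.den.Coprime m ∧ a - b = (m : ℚ) * c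

set_option linter.unusedSectionVars false
set_option linter.unusedTactic false
set_option linter.unreachableTactic false

/-! Write p = 2n+1, X_j = 2j+1, H = H_{p-1}(1), and O_r for the sum of X_j^{-r} over j < n. Both
congruences come from exact identities for deformed sums, expanded p-adically.

First sum. Let T(x) = ∑_{k<n} w_k ∏_{j<k} (1 - x/X_j²), with w_k the given summand
(`truncatedPoly`). Its coefficients are p-integral and the sum is T(0), so Taylor expansion at p²
gives T(0) ≡ T(p²) - p²T'(p²) + p⁴c₂ mod p⁶, where c₂ is the coefficient of x². For the first two
terms, T is deformed further to a hypergeometric sum in (e, q), with base point (-p, p). Telescoping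
certificates show that the sum vanishes on e = -p when 3 ∤ p (`sum_hyperTerm_neg_eq_zero`) and is a
product on q = p (`sum_hyperTerm_eq_hyperProd`). The extra factors have the same logarithmic
derivative along both lines, so the two derivatives at the base point combine into T(p²) = 0 and an
exact value of p²T'(p²) (`truncatedPoly_derivative_eval`). For c₂ mod p, (2m+1)·T((2m+1)²) equals 2
sin((2m+1)π/6) for m < n. These nodes are the nonzero squares mod p and deg T < n, so orthogonality
of power sums extracts c₂ (`coeff_two_truncatedPoly`). The resulting signed sum is evaluated by
multiplying indices by 3.

Second sum. A bivariate sum with u + v = p has the value 2/(uv) (`sum_quarticTerm`). At u, v = p(1 ±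
i)/2 the parameter p enters its summands only through p⁴, so for k < n they agree mod p⁴ with five
times the wanted ones. The remaining term k = n is a product, expanded in O_2 and O_4.

All harmonic sums reduce to H and O_5, by writing even numbers as p ± X and expanding. Finally O_5 ≡
(3/16) B_{p-5} mod p (`oddRecipSum_five_sub_bernoulli`). -/

/-! ### Two-parameter hypergeometric sums and their parameter shifts. -/

/-- The weight `C(2k,k) / (16^k (2k+1))`. -/
noncomputable def centralWeight (K : Type*) [Field K] (k : ℕ) : K :=
  (Nat.choose (2 * k) k : K) / ((16 : K) ^ k * (2 * (k : K) + 1))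

/-- The two-parameter hypergeometric term deforming `centralWeight`. -/
noncomputable def hyperTerm (e q : ℝ) (k : ℕ) : ℝ :=
  centralWeight ℝ k * (∏ j ∈ Finset.range k, (1 - q ^ 2 / (2 * (j : ℝ) + 1) ^ 2)) *
    ∏ j ∈ Finset.range k, (4 * (2 * (j : ℝ) + 3) * (2 * (j : ℝ) + 3 + e)) /
      ((4 * (j : ℝ) + 6 + e - q) * (4 * (j : ℝ) + 6 + e + q))

theorem choose_two_mul_succ {K : Type*} [Field K] [CharZero K] (k : ℕ) :
    ((Nat.choose (2 * (k + 1)) (k + 1) : ℕ) : K) =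
      (Nat.choose (2 * k) k : K) * (2 * (2 * (k : K) + 1)) / ((k : K) + 1) := by
  have h := Nat.succ_mul_centralBinom_succ k
  simp only [Nat.centralBinom] at h
  have h' : ((k : K) + 1) * (Nat.choose (2 * (k + 1)) (k + 1) : K) =
      2 * (2 * (k : K) + 1) * (Nat.choose (2 * k) k : K) := by exact_mod_cast h
  have hk : (k : K) + 1 ≠ 0 := by exact_mod_cast Nat.succ_ne_zero k
  rw [eq_div_iff hk, mul_comm, h']; ring

theorem two_mul_add_one_ne {K : Type*} [Field K] [CharZero K] (k : ℕ) : 2 * (k : K) + 1 ≠ 0 := by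
  exact_mod_cast Nat.succ_ne_zero (2 * k)

theorem two_mul_add_three_ne {K : Type*} [Field K] [CharZero K] (k : ℕ) :
    2 * (k : K) + 3 ≠ 0 := by
  exact_mod_cast Nat.succ_ne_zero (2 * k + 2)

theorem centralWeight_succ {K : Type*} [Field K] [CharZero K] (k : ℕ) :
    centralWeight K (k + 1) = centralWeight K k *
      ((2 * (k : K) + 1) ^ 2 / (8 * ((k : K) + 1) * (2 * (k : K) + 3))) := by
  have hk : (k : K) + 1 ≠ 0 := by exact_mod_cast Nat.succ_ne_zero k
  have h1 := two_mul_add_one_ne (K := K) k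
  have h3 := two_mul_add_three_ne (K := K) k
  have h16 : (16 : K) ^ k ≠ 0 := pow_ne_zero _ (by norm_num)
  have h3' : 2 * ((k : K) + 1) + 1 ≠ 0 := by convert h3 using 1; ring
  unfold centralWeight
  rw [choose_two_mul_succ]
  push_cast
  rw [pow_succ]
  field_simp
  ring

theorem hyperTerm_zero (e q : ℝ) : hyperTerm e q 0 = 1 := by
  simp [hyperTerm, centralWeight]

theorem hyperTerm_succ (e q : ℝ) (k : ℕ) :
    hyperTerm e q (k + 1) = hyperTerm e q k *
      (((2 * (k : ℝ) + 1) ^ 2 - q ^ 2) * (2 * (k : ℝ) + 3 + e) /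
        (2 * ((k : ℝ) + 1) * ((4 * (k : ℝ) + 6 + e - q) * (4 * (k : ℝ) + 6 + e + q)))) := by
  have hk : (k : ℝ) + 1 ≠ 0 := by exact_mod_cast Nat.succ_ne_zero k
  have h1 := two_mul_add_one_ne (K := ℝ) k
  have h3 := two_mul_add_three_ne (K := ℝ) k
  unfold hyperTerm
  rw [centralWeight_succ, Finset.prod_range_succ, Finset.prod_range_succ]
  generalize (∏ j ∈ Finset.range k, (1 - q ^ 2 / (2 * (j : ℝ) + 1) ^ 2)) = a
  generalize (∏ j ∈ Finset.range k, (4 * (2 * (j : ℝ) + 3) * (2 * (j : ℝ) + 3 + e)) /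
      ((4 * (j : ℝ) + 6 + e - q) * (4 * (j : ℝ) + 6 + e + q))) = b
  generalize (4 * (k : ℝ) + 6 + e - q) * (4 * (k : ℝ) + 6 + e + q) = c
  -- If the new denominator vanishes, both sides are 0 by the convention for division, so the
  -- recurrence needs no genericity.
  rcases eq_or_ne c 0 with rfl | hc
  · simp
  · field_simp
    ring

theorem hyperTerm_eq_zero (e : ℝ) {n k : ℕ} (h : n < k) : hyperTerm e (2 * n + 1) k = 0 := by
  have : (∏ j ∈ Finset.range k, (1 - (2 * (n : ℝ) + 1) ^ 2 / (2 * (j : ℝ) + 1) ^ 2)) = 0 := by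
    apply Finset.prod_eq_zero (Finset.mem_range.2 h)
    rw [div_self (pow_ne_zero _ (two_mul_add_one_ne n)), sub_self]
  simp [hyperTerm, this]

/-- Shifting `q` by four multiplies the terms by a rational function. -/
theorem hyperTerm_shift_four {e q : ℝ} (hq : 0 < q) (hm : ∀ m : ℤ, e - q + m ≠ 0)
    (hp : ∀ m : ℤ, e + q + m ≠ 0) (k : ℕ) :
    hyperTerm e q k = hyperTerm e (q + 4) k *
      ((e + 2 - q) * (2 * k - 1 - q) * (2 * k - 3 - q) * (4 * k + 6 + e + q) /
        ((2 * k + 1 + q) * (2 * k + 3 + q) * (e + 6 + q) * (4 * k + 2 + e - q))) := by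
  have h2 : e + 6 + q ≠ 0 := by convert hp 6 using 1; push_cast; ring
  induction k with
  | zero =>
    have h1 : 2 + e - q ≠ 0 := by convert hm 2 using 1; push_cast; ring
    have h3 : 1 + q ≠ 0 := by positivity
    have h4 : 3 + q ≠ 0 := by positivity
    simp only [hyperTerm_zero, Nat.cast_zero, mul_zero, zero_add, zero_sub]
    field_simp
    ring
  | succ k ih =>
    have k2 : (0 : ℝ) ≤ k := k.cast_nonneg
    have a1 : 4 * (k : ℝ) + 2 + e - q ≠ 0 := by
      convert hm (4 * k + 2) using 1; push_cast; ring
    have a2 : 4 * (k : ℝ) + 6 + e - q ≠ 0 := by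
      convert hm (4 * k + 6) using 1; push_cast; ring
    have a3 : 4 * (k : ℝ) + 6 + e + q ≠ 0 := by
      convert hp (4 * k + 6) using 1; push_cast; ring
    have a4 : 4 * (k : ℝ) + 10 + e + q ≠ 0 := by
      convert hp (4 * k + 10) using 1; push_cast; ring
    have b1 : 2 * (k : ℝ) + 1 + q ≠ 0 := by positivity
    have b2 : 2 * (k : ℝ) + 3 + q ≠ 0 := by positivity
    have b3 : 2 * (k : ℝ) + 5 + q ≠ 0 := by positivity
    have hk : (k : ℝ) + 1 ≠ 0 := by positivity
    have f1 : 4 * (k : ℝ) + 6 + e - (q + 4) = 4 * (k : ℝ) + 2 + e - q := by ring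
    have f2 : 4 * (k : ℝ) + 6 + e + (q + 4) = 4 * (k : ℝ) + 10 + e + q := by ring
    rw [hyperTerm_succ, hyperTerm_succ, ih, f1, f2]
    have g1 : 2 * ((k + 1 : ℕ) : ℝ) + 1 + q = 2 * (k : ℝ) + 3 + q := by push_cast; ring
    have g2 : 2 * ((k + 1 : ℕ) : ℝ) + 3 + q = 2 * (k : ℝ) + 5 + q := by push_cast; ring
    have g3 : 4 * ((k + 1 : ℕ) : ℝ) + 2 + e - q = 4 * (k : ℝ) + 6 + e - q := by push_cast; ring
    have g4 : 4 * ((k + 1 : ℕ) : ℝ) + 6 + e + q = 4 * (k : ℝ) + 10 + e + q := by push_cast; ring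
    rw [g1, g2, g3, g4]
    push_cast
    field_simp
    ring

/-- A telescoping certificate of Wilf–Zeilberger type: the right side is the discrete antiderivative
of the summand. When q + 4 is a positive odd integer it vanishes for large N, leaving a first-order
recurrence in q. -/
theorem sum_hyperTerm_shift_four {e q : ℝ} (hq : 0 < q) (hm : ∀ m : ℤ, e - q + m ≠ 0)
    (hp : ∀ m : ℤ, e + q + m ≠ 0) (N : ℕ) :
    ∑ k ∈ Finset.range N, ((e + 2 - q) * (e + 12 + 3 * q) * hyperTerm e (q + 4) k
      - (e + 6 + q) * (e - 3 * q) * hyperTerm e q k) =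
    hyperTerm e (q + 4) N * (2 * N * (-(8 + 4 * q)) * (e + 2 - q) *
      (4 * N + 6 + e + q) / ((2 * N + 1 + q) * (2 * N + 3 + q))) := by
  have h2 : e + 6 + q ≠ 0 := by convert hp 6 using 1; push_cast; ring
  induction N with
  | zero => simp
  | succ k ih =>
    have k2 : (0 : ℝ) ≤ k := k.cast_nonneg
    have a1 : 4 * (k : ℝ) + 2 + e - q ≠ 0 := by
      convert hm (4 * k + 2) using 1; push_cast; ring
    have a4 : 4 * (k : ℝ) + 10 + e + q ≠ 0 := by
      convert hp (4 * k + 10) using 1; push_cast; ring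
    have b1 : 2 * (k : ℝ) + 1 + q ≠ 0 := by positivity
    have b2 : 2 * (k : ℝ) + 3 + q ≠ 0 := by positivity
    have b3 : 2 * (k : ℝ) + 5 + q ≠ 0 := by positivity
    have hk : (k : ℝ) + 1 ≠ 0 := by positivity
    have f1 : 4 * (k : ℝ) + 6 + e - (q + 4) = 4 * (k : ℝ) + 2 + e - q := by ring
    have f2 : 4 * (k : ℝ) + 6 + e + (q + 4) = 4 * (k : ℝ) + 10 + e + q := by ring
    rw [Finset.sum_range_succ, ih, hyperTerm_succ, f1, f2, hyperTerm_shift_four hq hm hp k]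
    have g1 : 2 * ((k + 1 : ℕ) : ℝ) + 1 + q = 2 * (k : ℝ) + 3 + q := by push_cast; ring
    have g2 : 2 * ((k + 1 : ℕ) : ℝ) + 3 + q = 2 * (k : ℝ) + 5 + q := by push_cast; ring
    have g4 : 4 * ((k + 1 : ℕ) : ℝ) + 6 + e + q = 4 * (k : ℝ) + 10 + e + q := by push_cast; ring
    rw [g1, g2, g4]
    push_cast
    field_simp
    ring

/-- Shifting `(e, q)` by `(6, 2)` multiplies the terms by a rational function. -/
theorem hyperTerm_shift_six_two {e q : ℝ} (hq : ∀ m : ℤ, q + m ≠ 0) (hm : ∀ m : ℤ, e - q + m ≠ 0)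
    (hp : ∀ m : ℤ, e + q + m ≠ 0) (h3 : e + 3 ≠ 0) (h5 : e + 5 ≠ 0) (h7 : e + 7 ≠ 0) (k : ℕ) :
    hyperTerm (e + 6) (q + 2) k = hyperTerm e q k *
      (-(2 * k + 1 + q) * (2 * k + 3 + e) * (2 * k + 5 + e) * (2 * k + 7 + e) * (e + 6 + q) *
        (e + 10 + q) * (e + 6 - q) /
        ((2 * k - 1 - q) * (e + 3) * (e + 5) * (e + 7) * (4 * k + 6 + e + q) *
          (4 * k + 10 + e + q) * (4 * k + 6 + e - q))) := by
  have c1 : e + 6 + q ≠ 0 := by convert hp 6 using 1; push_cast; ring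
  have c2 : e + 10 + q ≠ 0 := by convert hp 10 using 1; push_cast; ring
  have c3 : e + 6 - q ≠ 0 := by convert hm 6 using 1; push_cast; ring
  induction k with
  | zero =>
    have d1 : q + 1 ≠ 0 := by simpa using hq 1
    have d2 : -1 - q ≠ 0 := fun h => d1 (by linarith)
    have e1 : 6 + e + q = e + 6 + q := by ring
    have e2 : 10 + e + q = e + 10 + q := by ring
    have e3 : 6 + e - q = e + 6 - q := by ring
    simp only [hyperTerm_zero, Nat.cast_zero, mul_zero, zero_add, zero_sub, e1, e2, e3]
    field_simp
    ring
  | succ k ih =>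
    have a1 : 4 * (k : ℝ) + 6 + e - q ≠ 0 := by
      convert hm (4 * k + 6) using 1; push_cast; ring
    have a2 : 4 * (k : ℝ) + 10 + e - q ≠ 0 := by
      convert hm (4 * k + 10) using 1; push_cast; ring
    have a3 : 4 * (k : ℝ) + 6 + e + q ≠ 0 := by
      convert hp (4 * k + 6) using 1; push_cast; ring
    have a4 : 4 * (k : ℝ) + 10 + e + q ≠ 0 := by
      convert hp (4 * k + 10) using 1; push_cast; ring
    have a5 : 4 * (k : ℝ) + 14 + e + q ≠ 0 := by
      convert hp (4 * k + 14) using 1; push_cast; ring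
    have b1 : 2 * (k : ℝ) - 1 - q ≠ 0 := fun h => hq (-(2 * k - 1)) (by push_cast; linarith)
    have b2 : 2 * (k : ℝ) + 1 - q ≠ 0 := fun h => hq (-(2 * k + 1)) (by push_cast; linarith)
    have hk : (k : ℝ) + 1 ≠ 0 := by exact_mod_cast Nat.succ_ne_zero k
    have f1 : 4 * (k : ℝ) + 6 + (e + 6) - (q + 2) = 4 * (k : ℝ) + 10 + e - q := by ring
    have f2 : 4 * (k : ℝ) + 6 + (e + 6) + (q + 2) = 4 * (k : ℝ) + 14 + e + q := by ring
    rw [hyperTerm_succ, hyperTerm_succ, ih, f1, f2]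
    have g1 : 2 * ((k + 1 : ℕ) : ℝ) - 1 - q = 2 * (k : ℝ) + 1 - q := by push_cast; ring
    have g3 : 4 * ((k + 1 : ℕ) : ℝ) + 6 + e - q = 4 * (k : ℝ) + 10 + e - q := by push_cast; ring
    have g4 : 4 * ((k + 1 : ℕ) : ℝ) + 6 + e + q = 4 * (k : ℝ) + 10 + e + q := by push_cast; ring
    have g5 : 4 * ((k + 1 : ℕ) : ℝ) + 10 + e + q = 4 * (k : ℝ) + 14 + e + q := by push_cast; ring
    rw [g1, g3, g4, g5]
    push_cast
    field_simp
    ring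

/-- The companion certificate for the shift (6, 2). On e = -(2n+1) its boundary term vanishes once N
≥ n ≥ 2 (given the nonvanishing hypotheses), and e + 6 corresponds to n - 3. -/
theorem sum_hyperTerm_shift_six_two {e q : ℝ} (hq : ∀ m : ℤ, q + m ≠ 0)
    (hm : ∀ m : ℤ, e - q + m ≠ 0) (hp : ∀ m : ℤ, e + q + m ≠ 0) (h3 : e + 3 ≠ 0)
    (h5 : e + 5 ≠ 0) (h7 : e + 7 ≠ 0) (N : ℕ) :
    ∑ k ∈ Finset.range N, ((e + 5) * (e + 7) * (e + 12 + 3 * q) * hyperTerm (e + 6) (q + 2) k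
      - (e + 6 + q) * (e + 10 + q) * (e + 6 - q) * hyperTerm e q k) =
    hyperTerm e q N * ((e + 6 + q) * (e + 10 + q) * (e + 6 - q) * (2 * N) *
      ((3 * e + 12 + q) * (2 * N + 1) + 2 * e ^ 2 + 14 * e + 24 + e * q + 6 * q + q ^ 2) /
        ((2 * N - 1 - q) * (e + 3) * (4 * N + 6 + e + q))) := by
  induction N with
  | zero => simp
  | succ k ih =>
    have a1 : 4 * (k : ℝ) + 6 + e - q ≠ 0 := by
      convert hm (4 * k + 6) using 1; push_cast; ring
    have a3 : 4 * (k : ℝ) + 6 + e + q ≠ 0 := by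
      convert hp (4 * k + 6) using 1; push_cast; ring
    have a4 : 4 * (k : ℝ) + 10 + e + q ≠ 0 := by
      convert hp (4 * k + 10) using 1; push_cast; ring
    have b1 : 2 * (k : ℝ) - 1 - q ≠ 0 := fun h => hq (-(2 * k - 1)) (by push_cast; linarith)
    have b2 : 2 * (k : ℝ) + 1 - q ≠ 0 := fun h => hq (-(2 * k + 1)) (by push_cast; linarith)
    have hk : (k : ℝ) + 1 ≠ 0 := by exact_mod_cast Nat.succ_ne_zero k
    rw [Finset.sum_range_succ, ih, hyperTerm_succ,
      hyperTerm_shift_six_two hq hm hp h3 h5 h7 k]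
    have g1 : 2 * ((k + 1 : ℕ) : ℝ) - 1 - q = 2 * (k : ℝ) + 1 - q := by push_cast; ring
    have g4 : 4 * ((k + 1 : ℕ) : ℝ) + 6 + e + q = 4 * (k : ℝ) + 10 + e + q := by push_cast; ring
    rw [g1, g4]
    push_cast
    generalize hA : 4 * (k : ℝ) + 6 + e - q = A at *
    generalize hB : 4 * (k : ℝ) + 6 + e + q = B at *
    generalize hC : 4 * (k : ℝ) + 10 + e + q = C at *
    generalize hD : 2 * (k : ℝ) - 1 - q = D at *
    generalize hE : 2 * (k : ℝ) + 1 - q = E at *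
    generalize hF : e + 3 = F at *
    generalize hG : e + 5 = G at *
    generalize hI : e + 7 = I at *
    field_simp
    subst hA hB hC hD hE hF hG hI
    ring

theorem hyperTerm_neg_eq_zero (q : ℝ) {n k : ℕ} (hn : 1 ≤ n) (h : n ≤ k) :
    hyperTerm (-(2 * n + 1)) q k = 0 := by
  have : (∏ j ∈ Finset.range k, (4 * (2 * (j : ℝ) + 3) * (2 * (j : ℝ) + 3 + -(2 * (n : ℝ) + 1))) /
      ((4 * (j : ℝ) + 6 + -(2 * (n : ℝ) + 1) - q) * (4 * (j : ℝ) + 6 + -(2 * (n : ℝ) + 1) + q))) =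
        0 := by
    apply Finset.prod_eq_zero (i := n - 1) (Finset.mem_range.2 (by omega))
    have : (2 * ((n - 1 : ℕ) : ℝ) + 3 + -(2 * (n : ℝ) + 1)) = 0 := by push_cast [hn]; ring
    rw [this, mul_zero, zero_div]
  rw [hyperTerm, this, mul_zero]

/-- The sums on the line `e = -p` vanish when `3 ∤ p`. -/
theorem sum_hyperTerm_neg_eq_zero (n : ℕ) (hn : 2 ≤ n) (h3 : n % 3 ≠ 1) :
    ∀ q : ℝ, (∀ m : ℤ, q + m ≠ 0) →
      ∑ k ∈ Finset.range n, hyperTerm (-(2 * n + 1)) q k = 0 := by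
  induction n using Nat.strong_induction_on with
  | _ n ih =>
    intro q hq
    have hq' : ∀ m : ℤ, -q + m ≠ 0 := fun m h => hq (-m) (by push_cast; linarith)
    -- Each shift lowers n by 3 and preserves n % 3 ≠ 1, that is 3 ∤ 2n+1, so every chain ends at n
    -- = 2 or n = 3.
    rcases lt_or_ge n 4 with h4 | h4
    · have hn' : n = 2 ∨ n = 3 := by omega
      rcases hn' with rfl | rfl
      · have a1 : (1 : ℝ) - q ≠ 0 := by convert hq' 1 using 1; push_cast; ring
        have a2 : (1 : ℝ) + q ≠ 0 := by convert hq 1 using 1; push_cast; ring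
        rw [Finset.sum_range_succ, Finset.sum_range_one, hyperTerm_succ, hyperTerm_zero]
        norm_num
        field_simp
        ring
      · have a1 : (-1 : ℝ) - q ≠ 0 := by convert hq' (-1) using 1; push_cast; ring
        have a2 : (-1 : ℝ) + q ≠ 0 := by convert hq (-1) using 1; push_cast; ring
        have a3 : (3 : ℝ) - q ≠ 0 := by convert hq' 3 using 1; push_cast; ring
        have a4 : (3 : ℝ) + q ≠ 0 := by convert hq 3 using 1; push_cast; ring
        rw [Finset.sum_range_succ, Finset.sum_range_succ, Finset.sum_range_one, hyperTerm_succ _ _ 1,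
          hyperTerm_succ _ _ 0, hyperTerm_zero]
        norm_num
        field_simp
        ring
    · obtain ⟨n, rfl⟩ : ∃ l, n = l + 3 := ⟨n - 3, by omega⟩
      have hn1 : 2 ≤ n := by omega
      have hi := ih n (by omega) hn1 (by omega) (q + 2) (fun m h => hq (m + 2) (by
        push_cast; linarith))
      have hnR : (2 : ℝ) ≤ n := by exact_mod_cast hn1
      have hc : (-(2 * ((n + 3 : ℕ) : ℝ) + 1)) + 6 = -(2 * n + 1) := by push_cast; ring
      have key := sum_hyperTerm_shift_six_two (e := -(2 * ((n + 3 : ℕ) : ℝ) + 1)) (q := q) hq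
        (fun m h => hq (2 * (n + 3 : ℕ) + 1 - m) (by push_cast at h ⊢; linarith))
        (fun m h => hq (-(2 * (n + 3 : ℕ) + 1) + m) (by push_cast at h ⊢; linarith))
        (by push_cast; intro h; linarith) (by push_cast; intro h; linarith)
        (by push_cast; intro h; linarith) (n + 3)
      rw [hyperTerm_neg_eq_zero q (by omega) le_rfl, zero_mul, Finset.sum_sub_distrib,
        ← Finset.mul_sum, ← Finset.mul_sum, hc] at key
      have ht : ∑ k ∈ Finset.range (n + 3), hyperTerm (-(2 * (n : ℝ) + 1)) (q + 2) k = 0 := by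
        rw [Finset.sum_range_succ, Finset.sum_range_succ, Finset.sum_range_succ, hi,
          hyperTerm_neg_eq_zero _ (by omega) le_rfl, hyperTerm_neg_eq_zero _ (by omega) (by omega),
          hyperTerm_neg_eq_zero _ (by omega) (by omega)]
        ring
      rw [ht, mul_zero, zero_sub, neg_eq_zero] at key
      refine (mul_eq_zero.1 key).resolve_left ?_
      refine mul_ne_zero (mul_ne_zero ?_ ?_) ?_
      · convert hq (-(2 * (n + 3 : ℕ) + 1) + 6) using 1; push_cast; ring
      · convert hq (-(2 * (n + 3 : ℕ) + 1) + 10) using 1; push_cast; ring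
      · convert hq' (-(2 * (n + 3 : ℕ) + 1) + 6) using 1; push_cast; ring

/-- The closed form of the terminating sums `q = 2n + 1`. -/
noncomputable def hyperProd (e : ℝ) (n : ℕ) : ℝ :=
  ∏ i ∈ Finset.range ((n + 1) / 2), ((e + 2 + (2 * n + 1 - 4 * i)) * (e + 12 - 3 * (2 * n + 1 - 4 * i)) /
    ((e + 6 - (2 * n + 1 - 4 * i)) * (e + 3 * (2 * n + 1 - 4 * i))))

theorem hyperProd_add_two (e : ℝ) (n : ℕ) :
    hyperProd e (n + 2) = hyperProd e n * ((e + 7 + 2 * n) * (e - 3 - 6 * n) /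
      ((e + 1 - 2 * n) * (e + 15 + 6 * n))) := by
  unfold hyperProd
  rw [show (n + 2 + 1) / 2 = (n + 1) / 2 + 1 by omega, Finset.prod_range_succ']
  congr 1
  · apply Finset.prod_congr rfl
    intro i _
    push_cast
    congr 1 <;> ring
  · push_cast
    congr 1 <;> ring

theorem sum_hyperTerm_eq_hyperProd {e : ℝ} (he : ∀ m : ℤ, e + m ≠ 0) :
    ∀ n : ℕ, ∑ k ∈ Finset.range (n + 1), hyperTerm e (2 * n + 1) k = hyperProd e n
  | 0 => by simp [hyperProd, hyperTerm_zero]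
  | 1 => by
    have a1 : e + 3 ≠ 0 := by simpa using he 3
    have a2 : e + 9 ≠ 0 := by simpa using he 9
    have t1 : hyperTerm e (2 * ((1 : ℕ) : ℝ) + 1) 1 = -4 / (e + 9) := by
      rw [hyperTerm_succ, hyperTerm_zero, Nat.cast_zero, Nat.cast_one,
        show 4 * (0 : ℝ) + 6 + e - (2 * 1 + 1) = e + 3 by ring,
        show 4 * (0 : ℝ) + 6 + e + (2 * 1 + 1) = e + 9 by ring,
        show 2 * (0 : ℝ) + 3 + e = e + 3 by ring]
      field_simp
      ring
    have t2 : hyperProd e 1 = (e + 5) * (e + 3) / ((e + 3) * (e + 9)) := by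
      simp only [hyperProd, Nat.reduceAdd, Nat.reduceDiv, Finset.prod_range_one, Nat.cast_zero,
        Nat.cast_one]
      congr 1 <;> ring
    rw [Finset.sum_range_succ, Finset.sum_range_one, t1, t2, hyperTerm_zero]
    field_simp
    ring
  | n + 2 => by
    have ih := sum_hyperTerm_eq_hyperProd he n
    have key := sum_hyperTerm_shift_four (e := e) (q := 2 * n + 1) (by positivity)
      (fun m h => he (m - (2 * n + 1)) (by push_cast; linarith))
      (fun m h => he (m + (2 * n + 1)) (by push_cast; linarith)) (n + 3)
    have hc : 2 * (n : ℝ) + 1 + 4 = 2 * ((n + 2 : ℕ) : ℝ) + 1 := by push_cast; ring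
    rw [hc, hyperTerm_eq_zero e (Nat.lt_succ_self (n + 2)), zero_mul, Finset.sum_sub_distrib,
        ← Finset.mul_sum, ← Finset.mul_sum,
        Finset.sum_range_succ (fun k => hyperTerm e (2 * (n : ℝ) + 1) k),
        Finset.sum_range_succ (fun k => hyperTerm e (2 * (n : ℝ) + 1) k), ih,
        hyperTerm_eq_zero e (Nat.lt_succ_self n),
        hyperTerm_eq_zero e (show n < n + 2 by omega)] at key
    rw [hyperProd_add_two]
    have a1 : e + 1 - 2 * n ≠ 0 := by convert he (1 - 2 * n) using 1; push_cast; ring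
    have a2 : e + 15 + 6 * n ≠ 0 := by convert he (15 + 6 * n) using 1; push_cast; ring
    rw [← mul_div_assoc, eq_div_iff (mul_ne_zero a1 a2)]
    linear_combination key

/-! ### The weight polynomials and their derivatives at p². -/

open Polynomial in
/-- The polynomial `C(2k,k) / (16^k (2k+1)) * ∏_{j<k} (1 - X / (2j+1)^2)`. -/
noncomputable def weightPoly (K : Type*) [Field K] (k : ℕ) : K[X] :=
  C (centralWeight K k) * ∏ j ∈ Finset.range k, (1 - C (1 / (2 * (j : K) + 1) ^ 2) * X)

theorem weightPoly_eval {K : Type*} [Field K] (k : ℕ) (y : K) :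
    (weightPoly K k).eval y =
      centralWeight K k * ∏ j ∈ Finset.range k, (1 - y / (2 * (j : K) + 1) ^ 2) := by
  simp only [weightPoly, Polynomial.eval_mul, Polynomial.eval_C, Polynomial.eval_prod,
    Polynomial.eval_sub, Polynomial.eval_one, Polynomial.eval_X]
  congr 1
  apply Finset.prod_congr rfl
  intro j _
  rw [one_div, inv_mul_eq_div]

theorem weightPoly_map (k : ℕ) :
    (weightPoly ℚ k).map (algebraMap ℚ ℝ) = weightPoly ℝ k := by
  simp [weightPoly, centralWeight, Polynomial.map_prod]

/-- Since (2j+1)² - (2m+1)² = -4(m-j)(m+j+1), the product collapses to a binomial coefficient. The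
case k = m = n evaluates the last terms of both terminating sums; the general case supplies
interpolation values. -/
theorem weightPoly_eval_odd (K : Type*) [Field K] [CharZero K] (m : ℕ) :
    ∀ k : ℕ, k ≤ m → (weightPoly K k).eval ((2 * (m : K) + 1) ^ 2) =
      (-1) ^ k * (Nat.choose (m + k) (2 * k) : K) / (2 * (k : K) + 1)
  | 0, _ => by simp [weightPoly_eval, centralWeight]
  | k + 1, hk => by
    have ih := weightPoly_eval_odd K m k (by omega)
    rw [weightPoly_eval] at ih ⊢
    rw [centralWeight_succ, Finset.prod_range_succ]
    have h1 := two_mul_add_one_ne (K := K) k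
    have h2 : (k : K) + 1 ≠ 0 := by exact_mod_cast Nat.succ_ne_zero k
    have h3 := two_mul_add_three_ne (K := K) k
    have hc : (Nat.choose (m + (k + 1)) (2 * (k + 1)) : K) * ((2 * k + 1) * (2 * (k + 1))) =
        (Nat.choose (m + k) (2 * k) : K) * ((m + k + 1) * (m - k)) := by
      have e1 := Nat.choose_succ_right_eq (m + k) (2 * k)
      have e2 := Nat.add_one_mul_choose_eq (m + k) (2 * k + 1)
      have e1' : (Nat.choose (m + k) (2 * k + 1) : K) * (2 * k + 1) =
          (Nat.choose (m + k) (2 * k) : K) * (m - k) := by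
        have : ((m + k - 2 * k : ℕ) : K) = m - k := by
          rw [Nat.cast_sub (by omega)]; push_cast; ring
        rw [← this]; exact_mod_cast e1
      have e2' : ((m : K) + k + 1) * (Nat.choose (m + k) (2 * k + 1) : K) =
          (Nat.choose (m + (k + 1)) (2 * (k + 1)) : K) * (2 * (k + 1)) := by
        rw [show m + (k + 1) = (m + k).succ by omega,
          show 2 * (k + 1) = (2 * k + 1).succ by omega]
        have := congrArg (Nat.cast (R := K)) e2
        push_cast at this ⊢
        linear_combination this
      linear_combination (-(2 * (k : K) + 1)) * e2' + ((m : K) + k + 1) * e1'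
    have hd : (2 * ((k + 1 : ℕ) : K) + 1) = 2 * (k : K) + 3 := by push_cast; ring
    rw [hd, eq_div_iff h3]
    have hc' : (Nat.choose (m + (k + 1)) (2 * (k + 1)) : K) =
        (Nat.choose (m + k) (2 * k) : K) * ((m + k + 1) * (m - k)) /
          ((2 * k + 1) * (2 * (k + 1))) := by
      rw [eq_div_iff (mul_ne_zero h1 (mul_ne_zero two_ne_zero h2)), hc]
    rw [hc']
    rw [eq_div_iff h1] at ih
    have ih' : centralWeight K k *
        ∏ x ∈ Finset.range k, (1 - (2 * (m : K) + 1) ^ 2 / (2 * (x : K) + 1) ^ 2) =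
        (-1) ^ k * (Nat.choose (m + k) (2 * k) : K) / (2 * (k : K) + 1) := by
      rw [eq_div_iff h1, ih]
    calc _ = (centralWeight K k *
        ∏ x ∈ Finset.range k, (1 - (2 * (m : K) + 1) ^ 2 / (2 * (x : K) + 1) ^ 2)) *
        ((2 * (k : K) + 1) ^ 2 / (8 * ((k : K) + 1) * (2 * (k : K) + 3)) *
          (1 - (2 * (m : K) + 1) ^ 2 / (2 * (k : K) + 1) ^ 2) * (2 * (k : K) + 3)) := by ring
      _ = _ := by
        rw [ih']
        field_simp
        ring

theorem HasDerivAt.of_eq {f g : ℝ → ℝ} {f' g' x : ℝ} (h : HasDerivAt f f' x)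
    (hfg : ∀ t, g t = f t) (hd : g' = f') : HasDerivAt g g' x := by
  rw [hd, funext hfg]; exact h

theorem hasDerivAt_finset_prod {ι : Type*} (s : Finset ι) (f : ι → ℝ → ℝ) (c : ι → ℝ) (x : ℝ)
    (h : ∀ i ∈ s, HasDerivAt (f i) (f i x * c i) x) :
    HasDerivAt (fun t => ∏ i ∈ s, f i t) ((∏ i ∈ s, f i x) * ∑ i ∈ s, c i) x := by
  classical
  induction s using Finset.induction_on with
  | empty => simpa using hasDerivAt_const x (1 : ℝ)
  | insert a s ha ih =>
    have h1 := h a (Finset.mem_insert_self a s)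
    have h2 := ih fun i hi => h i (Finset.mem_insert_of_mem hi)
    simp only [Finset.prod_insert ha, Finset.sum_insert ha]
    exact (h1.fun_mul h2).of_eq (fun t => rfl) (by ring)

-- The hypergeometric identities hold only at generic parameters. Differentiability at the excluded
-- point is enough to carry them over to the value and the derivative there.
open Filter Topology in
theorem HasDerivAt.eq_of_eventuallyEq_punctured {f g : ℝ → ℝ} {f' g' x : ℝ}
    (hf : HasDerivAt f f' x) (hg : HasDerivAt g g' x) (h : ∀ᶠ t in 𝓝[≠] x, f t = g t) :
    f x = g x ∧ f' = g' := by
  have h0 : f x = g x := tendsto_nhds_unique_of_eventuallyEq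
    (hf.continuousAt.tendsto.mono_left nhdsWithin_le_nhds)
    (hg.continuousAt.tendsto.mono_left nhdsWithin_le_nhds) h
  refine ⟨h0, ?_⟩
  have h1 : ∀ᶠ t in 𝓝 x, f t = g t := by
    rw [eventually_nhdsWithin_iff] at h
    filter_upwards [h] with t ht
    rcases eq_or_ne t x with rfl | hne
    · exact h0
    · exact ht hne
  exact hf.unique (hg.congr_of_eventuallyEq h1)

open Filter Topology in
theorem eventually_two_mul_not_int : ∀ᶠ t : ℝ in 𝓝[≠] 0, t ≠ 0 ∧ ∀ m : ℤ, 2 * t ≠ m := by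
  rw [eventually_nhdsWithin_iff]
  filter_upwards [Metric.ball_mem_nhds (0 : ℝ) (show (0 : ℝ) < 1 / 2 by norm_num)] with t ht h0
  refine ⟨h0, fun m hm => ?_⟩
  rw [Metric.mem_ball, Real.dist_eq, sub_zero] at ht
  have : |(m : ℝ)| < 1 := by rw [← hm, abs_mul, abs_two]; linarith
  have hm0 : m = 0 := by
    rw [← Int.abs_lt_one_iff]; exact_mod_cast this
  apply h0
  rw [hm0] at hm
  simpa using hm

theorem hasDerivAt_const_add_div (a b : ℝ) (x y : ℝ) (hb : b ≠ 0) (ha : a ≠ 0) :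
    HasDerivAt (fun t => (a + x * t) / (b + y * t)) (a / b * (x / a - y / b)) 0 := by
  have h1 : HasDerivAt (fun t : ℝ => a + x * t) x 0 := by
    simpa using ((hasDerivAt_id (0 : ℝ)).const_mul x).const_add a
  have h2 : HasDerivAt (fun t : ℝ => b + y * t) y 0 := by
    simpa using ((hasDerivAt_id (0 : ℝ)).const_mul y).const_add b
  refine (h1.fun_div h2 (by simpa using hb)).of_eq (fun t => rfl) ?_
  simp only [mul_zero, add_zero]
  field_simp

theorem odd_sub_ne {n j : ℕ} (hj : j + 1 < n) :
    2 * (j : ℝ) + 3 ≠ 0 ∧ 2 * (j : ℝ) + 3 - (2 * n + 1) ≠ 0 := by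
  have : (j : ℝ) + 1 < n := by exact_mod_cast hj
  constructor
  · positivity
  · intro h; linarith

/-- `∑_{0<j≤k} 1 / (X_j (X_j - p))` with `X_j = 2 j + 1`, `p = 2 n + 1`. -/
def pairSum (K : Type*) [Field K] (n k : ℕ) : K :=
  ∑ j ∈ Finset.range k, 1 / ((2 * (j : K) + 3) * (2 * (j : K) + 3 - (2 * n + 1)))

/-- Value and derivative at t = 0 of the vanishing sum along e = -p, q = p + 2t. At t = 0 every
extra factor is 1, and its logarithmic derivative is 1/(2j+3-p) - 1/(2j+3), which produces
`pairSum`. Only k < n occurs, so the singular factor 2j+3 = p never enters. -/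
theorem sum_weightPoly_derivative (n : ℕ) (hn : 2 ≤ n) (h3 : n % 3 ≠ 1) :
    ∑ k ∈ Finset.range n, (weightPoly ℝ k).eval ((2 * (n : ℝ) + 1) ^ 2) = 0 ∧
    ∑ k ∈ Finset.range n, (4 * (weightPoly ℝ k).derivative.eval ((2 * (n : ℝ) + 1) ^ 2) +
      (weightPoly ℝ k).eval ((2 * (n : ℝ) + 1) ^ 2) * pairSum ℝ n k) = 0 := by
  set p : ℝ := 2 * n + 1 with hp
  have hp0 : p ≠ 0 := two_mul_add_one_ne n
  let G : ℕ → ℝ → ℝ := fun k t => (weightPoly ℝ k).eval ((p + 2 * t) ^ 2) *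
    ∏ j ∈ Finset.range k, ((2 * (j : ℝ) + 3) * (2 * (j : ℝ) + 3 - p) /
      ((2 * (j : ℝ) + 3 - p - t) * (2 * (j : ℝ) + 3 + t)))
  have hG : ∀ k < n, HasDerivAt (G k) (p * (4 * (weightPoly ℝ k).derivative.eval (p ^ 2) +
      (weightPoly ℝ k).eval (p ^ 2) * pairSum ℝ n k)) 0 := by
    intro k hk
    have h1 : HasDerivAt (fun t : ℝ => (weightPoly ℝ k).eval ((p + 2 * t) ^ 2))
        ((weightPoly ℝ k).derivative.eval (p ^ 2) * (4 * p)) 0 := by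
      have a : HasDerivAt (fun t : ℝ => (p + 2 * t) ^ 2) (4 * p) 0 := by
        have := (((hasDerivAt_id (0 : ℝ)).const_mul 2).const_add p).fun_pow 2
        refine this.of_eq (fun t => rfl) ?_
        simp
        ring
      have b := (weightPoly ℝ k).hasDerivAt ((p + 2 * 0) ^ 2)
      have := HasDerivAt.comp (0 : ℝ) b a
      exact this.of_eq (fun t => rfl) (by simp)
    have h2 := hasDerivAt_finset_prod (Finset.range k)
      (fun j t => (2 * (j : ℝ) + 3) * (2 * (j : ℝ) + 3 - p) /
        ((2 * (j : ℝ) + 3 - p - t) * (2 * (j : ℝ) + 3 + t)))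
      (fun j => p * (1 / ((2 * (j : ℝ) + 3) * (2 * (j : ℝ) + 3 - p)))) 0 (by
        intro j hj
        rw [Finset.mem_range] at hj
        obtain ⟨a1, a2⟩ := odd_sub_ne (show j + 1 < n by omega)
        rw [← hp] at a2
        have b1 := hasDerivAt_const_add_div (2 * (j : ℝ) + 3) (2 * (j : ℝ) + 3) 0 1 a1 a1
        have b2 := hasDerivAt_const_add_div (2 * (j : ℝ) + 3 - p) (2 * (j : ℝ) + 3 - p) 0 (-1) a2 a2
        refine (b1.fun_mul b2).of_eq (fun t => ?_) ?_
        · rw [div_mul_div_comm]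
          congr 1 <;> ring
        · generalize 2 * (j : ℝ) + 3 = x at *
          generalize hy : x - p = y at *
          have : p = x - y := by rw [← hy]; ring
          simp only [sub_zero, add_zero, mul_zero]
          rw [this]
          field_simp
          ring)
    have h3 : (∏ j ∈ Finset.range k, ((2 * (j : ℝ) + 3) * (2 * (j : ℝ) + 3 - p) /
        ((2 * (j : ℝ) + 3 - p - 0) * (2 * (j : ℝ) + 3 + 0)))) = 1 := by
      apply Finset.prod_eq_one
      intro j hj
      rw [Finset.mem_range] at hj
      obtain ⟨a1, a2⟩ := odd_sub_ne (show j + 1 < n by omega)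
      rw [← hp] at a2
      rw [sub_zero, add_zero, mul_comm, div_self (mul_ne_zero a2 a1)]
    refine (h1.fun_mul h2).of_eq (fun t => rfl) ?_
    rw [h3, pairSum, ← hp, ← Finset.mul_sum]
    simp only [mul_zero, add_zero]
    ring
  have hsum : HasDerivAt (fun t => ∑ k ∈ Finset.range n, G k t) (∑ k ∈ Finset.range n,
      p * (4 * (weightPoly ℝ k).derivative.eval (p ^ 2) +
      (weightPoly ℝ k).eval (p ^ 2) * pairSum ℝ n k)) 0 :=
    HasDerivAt.fun_sum fun k hk => hG k (Finset.mem_range.1 hk)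
  have key := hsum.eq_of_eventuallyEq_punctured (hasDerivAt_const (0 : ℝ) (0 : ℝ)) (by
    filter_upwards [eventually_two_mul_not_int] with t ht
    rw [← sum_hyperTerm_neg_eq_zero n hn h3 (p + 2 * t) (fun m h => ht.2 (-(2 * n + 1) - m) (by
      rw [hp] at h; push_cast; linarith))]
    apply Finset.sum_congr rfl
    intro k hk
    simp only [G, hyperTerm, weightPoly_eval, ← hp]
    congr 1
    apply Finset.prod_congr rfl
    intro j _
    rw [show (4 * (j : ℝ) + 6 + -p - (p + 2 * t)) * (4 * (j : ℝ) + 6 + -p + (p + 2 * t)) =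
      4 * ((2 * (j : ℝ) + 3 - p - t) * (2 * (j : ℝ) + 3 + t)) by ring,
      show 4 * (2 * (j : ℝ) + 3) * (2 * (j : ℝ) + 3 + -p) =
        4 * ((2 * (j : ℝ) + 3) * (2 * (j : ℝ) + 3 - p)) by ring,
      mul_div_mul_left _ _ (by norm_num : (4 : ℝ) ≠ 0)])
  obtain ⟨k1, k2⟩ := key
  constructor
  · rw [← k1]
    apply Finset.sum_congr rfl
    intro k hk
    rw [Finset.mem_range] at hk
    simp only [G, mul_zero, add_zero, sub_zero]
    rw [Finset.prod_eq_one, mul_one]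
    intro j hj
    rw [Finset.mem_range] at hj
    obtain ⟨a1, a2⟩ := odd_sub_ne (show j + 1 < n by omega)
    rw [← hp] at a2
    rw [mul_comm, div_self (mul_ne_zero a2 a1)]
  · rw [← Finset.mul_sum] at k2
    exact (mul_eq_zero.1 k2).resolve_left hp0

/-- The logarithmic derivative of the closed form `hyperProd` on the line `e = -p`. -/
def logDerivSum (K : Type*) [Field K] (n : ℕ) : K :=
  ∑ i ∈ Finset.range ((n + 1) / 2), (1 / (1 - 2 * (i : K)) + 1 / (6 - 2 * (2 * n + 1) + 6 * i) -
    1 / (3 - (2 * n + 1) + 2 * i) - 1 / (2 * n + 1 - 6 * i))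

theorem int_cast_ne_of_ne {a b : ℤ} {K : Type*} [Field K] [CharZero K] (h : a ≠ b) :
    (a : K) - b ≠ 0 := by
  rw [sub_ne_zero]; exact_mod_cast h

theorem logDeriv_denoms_ne {n i : ℕ} (hn : 2 ≤ n) (_h3 : n % 3 ≠ 1) (hi : i < (n + 1) / 2) :
    1 - 2 * (i : ℝ) ≠ 0 ∧ 6 - 2 * (2 * (n : ℝ) + 1) + 6 * i ≠ 0 ∧
      3 - (2 * (n : ℝ) + 1) + 2 * i ≠ 0 ∧ 2 * (n : ℝ) + 1 - 6 * i ≠ 0 := by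
  refine ⟨?_, ?_, ?_, ?_⟩
  · have := int_cast_ne_of_ne (K := ℝ) (show (1 : ℤ) ≠ 2 * i by omega)
    push_cast at this; exact this
  · have := int_cast_ne_of_ne (K := ℝ) (show (6 + 6 * i : ℤ) ≠ 2 * (2 * n + 1) by omega)
    push_cast at this; intro h; apply this; linarith
  · have := int_cast_ne_of_ne (K := ℝ) (show (3 + 2 * i : ℤ) ≠ (2 * n + 1) by omega)
    push_cast at this; intro h; apply this; linarith
  · have := int_cast_ne_of_ne (K := ℝ) (show (2 * n + 1 : ℤ) ≠ 6 * i by omega)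
    push_cast at this; exact this

/-- The derivative at t = 0 along the other line, q = p and e = -p + 2t. There q is constant, so the
weight polynomials are not differentiated and only `pairSum` appears; the closed form contributes
its logarithmic derivative. -/
theorem sum_weightPoly_pairSum (n : ℕ) (hn : 2 ≤ n) (h3 : n % 3 ≠ 1) :
    (2 * (n : ℝ) + 1) ^ 2 * ∑ k ∈ Finset.range n,
      (weightPoly ℝ k).eval ((2 * (n : ℝ) + 1) ^ 2) * pairSum ℝ n k =
    2 * (-1) ^ n * (logDerivSum ℝ n + 1 / (2 * n + 1) - (2 * n + 1) * pairSum ℝ n (n - 1)) := by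
  have hzero := (sum_weightPoly_derivative n hn h3).1
  have hlast := weightPoly_eval_odd ℝ n n le_rfl
  rw [← two_mul, Nat.choose_self, Nat.cast_one, mul_one] at hlast
  set p : ℝ := 2 * n + 1 with hp
  have hp0 : p ≠ 0 := two_mul_add_one_ne n
  let f : ℕ → ℝ → ℝ := fun j t => (2 * (j : ℝ) + 3) * (2 * (j : ℝ) + 3 - p + 2 * t) /
      ((2 * (j : ℝ) + 3 - p + t) * (2 * (j : ℝ) + 3 + t))
  have hf0 : ∀ j, j + 1 < n → f j 0 = 1 := by
    intro j hj
    obtain ⟨a1, a2⟩ := odd_sub_ne hj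
    rw [← hp] at a2
    simp only [f, mul_zero, add_zero]
    rw [mul_comm, div_self (mul_ne_zero a2 a1)]
  have hf : ∀ j, j + 1 < n → HasDerivAt (f j)
      (f j 0 * (p * (1 / ((2 * (j : ℝ) + 3) * (2 * (j : ℝ) + 3 - p))))) 0 := by
    intro j hj
    rw [hf0 j hj]
    obtain ⟨a1, a2⟩ := odd_sub_ne hj
    rw [← hp] at a2
    have b1 := hasDerivAt_const_add_div (2 * (j : ℝ) + 3) (2 * (j : ℝ) + 3) 0 1 a1 a1
    have b2 := hasDerivAt_const_add_div (2 * (j : ℝ) + 3 - p) (2 * (j : ℝ) + 3 - p) 2 1 a2 a2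
    refine (b1.fun_mul b2).of_eq (fun t => ?_) ?_
    · rw [div_mul_div_comm]
      simp only [f]
      congr 1 <;> ring
    · generalize 2 * (j : ℝ) + 3 = x at *
      generalize hy : x - p = y at *
      have : p = x - y := by rw [← hy]; ring
      simp only [add_zero, mul_zero]
      rw [this]
      field_simp
      ring
  have hprod : ∀ k, k < n → HasDerivAt (fun t => ∏ j ∈ Finset.range k, f j t)
      (p * pairSum ℝ n k) 0 ∧ ∏ j ∈ Finset.range k, f j 0 = 1 := by
    intro k hk
    have e : ∏ j ∈ Finset.range k, f j 0 = 1 :=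
      Finset.prod_eq_one fun j hj => hf0 j (by have := Finset.mem_range.1 hj; omega)
    refine ⟨(hasDerivAt_finset_prod (Finset.range k) f _ 0 fun j hj => hf j (by
      have := Finset.mem_range.1 hj; omega)).of_eq (fun t => rfl) ?_, e⟩
    rw [e, one_mul, pairSum, ← Finset.mul_sum]
  have hL : HasDerivAt (fun t => ∑ k ∈ Finset.range n,
      (weightPoly ℝ k).eval (p ^ 2) * ∏ j ∈ Finset.range k, f j t)
      (∑ k ∈ Finset.range n, (weightPoly ℝ k).eval (p ^ 2) * (p * pairSum ℝ n k)) 0 :=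
    HasDerivAt.fun_sum fun k hk =>
      ((hprod k (Finset.mem_range.1 hk)).1.const_mul _)
  -- This is the term k = n, which is absent on e = -p but survives as a limit here.
  have hT : HasDerivAt (fun t => ((2 * (-1) ^ n + 0 * t) / (p + 1 * t)) *
      ∏ j ∈ Finset.range (n - 1), f j t)
      ((2 * (-1) ^ n) / p * (-1 / p + p * pairSum ℝ n (n - 1))) 0 := by
    have b := hasDerivAt_const_add_div (2 * (-1) ^ n) p 0 1 hp0 (by simp)
    refine (b.fun_mul (hprod (n - 1) (by omega)).1).of_eq (fun t => rfl) ?_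
    rw [(hprod (n - 1) (by omega)).2]
    simp only [mul_zero, add_zero]
    ring
  let g : ℕ → ℝ → ℝ := fun i t => ((1 - 2 * (i : ℝ) + t) * (6 - 2 * p + 6 * i + t)) /
    ((3 - p + 2 * i + t) * (p - 6 * i + t))
  have hR : HasDerivAt (fun t => ∏ i ∈ Finset.range ((n + 1) / 2), g i t)
      ((∏ i ∈ Finset.range ((n + 1) / 2), g i 0) * logDerivSum ℝ n) 0 := by
    refine hasDerivAt_finset_prod _ g _ 0 fun i hi => ?_
    obtain ⟨a1, a2, a3, a4⟩ := logDeriv_denoms_ne hn h3 (Finset.mem_range.1 hi)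
    rw [← hp] at a2 a3 a4 ⊢
    have b1 := hasDerivAt_const_add_div (1 - 2 * (i : ℝ)) (3 - p + 2 * i) 1 1 a3 a1
    have b2 := hasDerivAt_const_add_div (6 - 2 * p + 6 * i) (p - 6 * i) 1 1 a4 a2
    refine (b1.fun_mul b2).of_eq (fun t => ?_) ?_
    · rw [div_mul_div_comm, one_mul]
    · simp only [g, mul_zero, add_zero]
      rw [← div_mul_div_comm]
      ring
  have key := (hL.fun_add hT).eq_of_eventuallyEq_punctured hR (by
    filter_upwards [eventually_two_mul_not_int] with t ht
    have hnot : ∀ m : ℤ, (-p + 2 * t) + m ≠ 0 := fun m h => ht.2 (2 * n + 1 - m) (by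
      rw [hp] at h; push_cast; linarith)
    have hfun : ∀ k, hyperTerm (-p + 2 * t) p k =
        (weightPoly ℝ k).eval (p ^ 2) * ∏ j ∈ Finset.range k, f j t := by
      intro k
      simp only [hyperTerm, weightPoly_eval, f]
      congr 1
      apply Finset.prod_congr rfl
      intro j _
      rw [show (4 * (j : ℝ) + 6 + (-p + 2 * t) - p) * (4 * (j : ℝ) + 6 + (-p + 2 * t) + p) =
        4 * ((2 * (j : ℝ) + 3 - p + t) * (2 * (j : ℝ) + 3 + t)) by ring,
        show 4 * (2 * (j : ℝ) + 3) * (2 * (j : ℝ) + 3 + (-p + 2 * t)) =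
          4 * ((2 * (j : ℝ) + 3) * (2 * (j : ℝ) + 3 - p + 2 * t)) by ring,
        mul_div_mul_left _ _ (by norm_num : (4 : ℝ) ≠ 0)]
    have hmain := sum_hyperTerm_eq_hyperProd hnot n
    rw [← hp, Finset.sum_range_succ, hfun n] at hmain
    -- For j = n - 1 the factor is p·2t / (t(p+t)), a removable 0/0 equal to 2p/(p+t) for t ≠ 0.
    have hsplit : ∏ j ∈ Finset.range n, f j t =
        (∏ j ∈ Finset.range (n - 1), f j t) * (2 * p / (p + t)) := by
      obtain ⟨l, rfl⟩ : ∃ l, n = l + 1 := ⟨n - 1, by omega⟩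
      rw [Finset.prod_range_succ, Nat.add_sub_cancel]
      congr 1
      have hl : 2 * (l : ℝ) + 3 = p := by rw [hp]; push_cast; ring
      simp only [f, hl, sub_self, zero_add]
      have ht0 := ht.1
      rw [show p * (2 * t) = t * (2 * p) by ring, mul_div_mul_left _ _ ht0]
    rw [hsplit, hlast] at hmain
    have hpt : p + t ≠ 0 := fun h => ht.2 (-2 * (2 * n + 1)) (by
      rw [hp] at h; push_cast; linarith)
    have hP : hyperProd (-p + 2 * t) n = ∏ i ∈ Finset.range ((n + 1) / 2), g i t := by
      unfold hyperProd
      apply Finset.prod_congr rfl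
      intro i _
      simp only [g, ← hp]
      rw [← mul_div_mul_left ((1 - 2 * (i : ℝ) + t) * (6 - 2 * p + 6 * i + t)) _
        (by norm_num : (4 : ℝ) ≠ 0)]
      congr 1 <;> ring
    rw [← hP, ← hmain]
    congr 1
    · exact Finset.sum_congr rfl fun k _ => (hfun k).symm
    · rw [zero_mul, add_zero, one_mul]
      field_simp)
  obtain ⟨k1, k2⟩ := key
  have e1 : ∑ k ∈ Finset.range n, (weightPoly ℝ k).eval (p ^ 2) * ∏ j ∈ Finset.range k, f j 0 =
      0 := by
    refine (Finset.sum_congr rfl fun k hk => ?_).trans hzero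
    rw [(hprod k (Finset.mem_range.1 hk)).2, mul_one]
  -- The truncated sum is zero at t = 0, so the closed form there equals 2(-1)^n/p. This converts
  -- its logarithmic derivative into its derivative.
  rw [e1, (hprod (n - 1) (by omega)).2] at k1
  rw [← k1] at k2
  have e2 : ∑ k ∈ Finset.range n, (weightPoly ℝ k).eval (p ^ 2) * (p * pairSum ℝ n k) =
      p * ∑ k ∈ Finset.range n, (weightPoly ℝ k).eval (p ^ 2) * pairSum ℝ n k := by
    rw [Finset.mul_sum]
    exact Finset.sum_congr rfl fun k _ => by ring
  rw [e2] at k2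
  have e3 : p * ∑ k ∈ Finset.range n, (weightPoly ℝ k).eval (p ^ 2) * pairSum ℝ n k =
      2 * (-1) ^ n / p * (logDerivSum ℝ n + 1 / p - p * pairSum ℝ n (n - 1)) := by
    simp only [mul_zero, add_zero, zero_add, mul_one] at k2
    linear_combination k2
  rw [show ∀ S : ℝ, p ^ 2 * S = p * (p * S) from fun S => by ring, e3]
  field_simp

/-! ### The logarithmic derivative in terms of harmonic sums. -/

/-- `∑_{b<N} 1/(b+1)^r`. -/
def recipSum (r N : ℕ) : ℚ := ∑ b ∈ Finset.range N, 1 / ((b : ℚ) + 1) ^ r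

/-- `∑_{b<n} 1/(2b+1)^r`. -/
def oddRecipSum (r n : ℕ) : ℚ := ∑ b ∈ Finset.range n, 1 / (2 * (b : ℚ) + 1) ^ r

/-- `∑_{b<n} 1/(2b+2)^r`. -/
def evenRecipSum (r n : ℕ) : ℚ := ∑ b ∈ Finset.range n, 1 / (2 * (b : ℚ) + 2) ^ r

theorem sum_range_two_mul {M : Type*} [AddCommMonoid M] (f : ℕ → M) (n : ℕ) :
    ∑ b ∈ Finset.range (2 * n), f b =
      ∑ b ∈ Finset.range n, f (2 * b) + ∑ b ∈ Finset.range n, f (2 * b + 1) := by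
  induction n with
  | zero => simp
  | succ n ih =>
    rw [show 2 * (n + 1) = 2 * n + 1 + 1 by ring, Finset.sum_range_succ, Finset.sum_range_succ, ih,
      Finset.sum_range_succ, Finset.sum_range_succ]
    abel

theorem recipSum_two_mul (r n : ℕ) :
    recipSum r (2 * n) = oddRecipSum r n + evenRecipSum r n := by
  rw [recipSum, sum_range_two_mul, oddRecipSum, evenRecipSum]
  congr 1
  · exact Finset.sum_congr rfl fun b _ => by push_cast; ring
  · exact Finset.sum_congr rfl fun b _ => by push_cast; ring

theorem evenRecipSum_eq (r n : ℕ) : evenRecipSum r n = recipSum r n / 2 ^ r := by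
  rw [evenRecipSum, recipSum, Finset.sum_div]
  refine Finset.sum_congr rfl fun b _ => ?_
  rw [show 2 * (b : ℚ) + 2 = 2 * (b + 1) by ring, mul_pow, div_div, mul_comm]

/-- Passing from n to n + 2 appends one term to the first family and slides the window of the
second, so only boundary terms change. The step of 2 respects the floor in the range. -/
theorem sum_recip_odd_even_aux : ∀ n : ℕ, 2 ≤ n →
    ∑ i ∈ Finset.range ((n + 1) / 2), (1 / (1 - 2 * (i : ℚ)) - 1 / (3 - (2 * n + 1) + 2 * i)) =
      1 - recipSum 1 n / 2 + 1 / (n - 1) + 1 / (2 * n)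
  | 0, h => by omega
  | 1, h => by omega
  | 2, _ => by simp [recipSum, Finset.sum_range_succ]; norm_num
  | 3, _ => by simp [recipSum, Finset.sum_range_succ]; norm_num
  | n + 4, _ => by
    have ih := sum_recip_odd_even_aux (n + 2) (by omega)
    obtain ⟨m, hm⟩ : ∃ m, m = n + 2 := ⟨_, rfl⟩
    rw [show n + 4 = m + 2 by omega]
    rw [← hm] at ih
    have hm2 : (2 : ℚ) ≤ m := by exact_mod_cast (by omega : 2 ≤ m)
    set L := (m + 1) / 2 with hL
    have hL' : (m + 2 + 1) / 2 = L + 1 := by omega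
    rw [hL', Finset.sum_sub_distrib]
    rw [Finset.sum_sub_distrib] at ih
    have tel : ∑ i ∈ Finset.range (L + 2), 1 / (3 - (2 * ((m + 2 : ℕ) : ℚ) + 1) + 2 * (i : ℚ)) =
        ∑ i ∈ Finset.range L, 1 / (3 - (2 * (m : ℚ) + 1) + 2 * (i : ℚ)) +
          1 / (-2 * (m : ℚ)) + 1 / (-2 * m - 2) := by
      rw [Finset.sum_range_succ', Finset.sum_range_succ']
      congr 1
      · congr 1
        · refine Finset.sum_congr rfl fun i _ => ?_
          congr 1; push_cast; ring
        · congr 1; push_cast; ring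
      · congr 1; push_cast; ring
    rw [Finset.sum_range_succ] at tel
    rw [Finset.sum_range_succ]
    have hr : recipSum 1 (m + 2) = recipSum 1 m + 1 / (m + 1) + 1 / (m + 2) := by
      simp only [recipSum, Finset.sum_range_succ, pow_one]
      push_cast
      ring
    rw [hr]
    have key : 1 / (1 - 2 * (L : ℚ)) + 1 / (3 - (2 * ((m + 2 : ℕ) : ℚ) + 1) + 2 * ((L + 1 : ℕ) : ℚ)) =
        -1 / (m - 1) - 1 / m := by
      have a1 : (m : ℚ) - 1 ≠ 0 := by intro h; linarith
      have a2 : (m : ℚ) ≠ 0 := by intro h; linarith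
      rcases Nat.even_or_odd' m with ⟨t, ht | ht⟩
      · have : L = t := by omega
        have hQ : 2 * (t : ℚ) = m := by rw [ht]; push_cast; ring
        rw [this]
        push_cast
        rw [show (3 : ℚ) - (2 * (m + 2) + 1) + 2 * (t + 1) = -m by rw [← hQ]; ring, hQ,
          show (1 : ℚ) - m = -(m - 1) by ring]
        field_simp
        ring
      · have : L = t + 1 := by omega
        have hQ : 2 * (t : ℚ) = m - 1 := by rw [ht]; push_cast; ring
        rw [this]
        push_cast
        rw [show (3 : ℚ) - (2 * (m + 2) + 1) + 2 * (t + 1 + 1) = 2 * t - 2 * m + 2 by ring,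
          show (1 : ℚ) - 2 * (t + 1) = -(2 * t) - 1 by ring, hQ,
          show (m : ℚ) - 1 - 2 * m + 2 = -(m - 1) by ring,
          show -((m : ℚ) - 1) - 1 = -m by ring]
        field_simp
        ring
    have b1 : (m : ℚ) - 1 ≠ 0 := by intro h; linarith
    have b2 : (m : ℚ) ≠ 0 := by intro h; linarith
    have b3 : (m : ℚ) + 1 ≠ 0 := by intro h; linarith
    have b4 : (m : ℚ) + 2 ≠ 0 := by intro h; linarith
    have fin : -1 / ((m : ℚ) - 1) - 1 / m - (1 / (-2 * (m : ℚ)) + 1 / (-2 * m - 2)) =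
        -(1 / (m + 1) + 1 / (m + 2)) / 2 + (1 / (((m + 2 : ℕ) : ℚ) - 1) + 1 / (2 * ((m + 2 : ℕ) : ℚ)))
         - (1 / (m - 1) + 1 / (2 * m)) := by
      push_cast
      rw [show (-2 : ℚ) * m - 2 = -(2 * (m + 1)) by ring, show (m : ℚ) + 2 - 1 = m + 1 by ring]
      field_simp
      ring
    linear_combination ih - tel + key + fin

/-- With X = p - 4 - 4i, the denominators 6 - 2p + 6i and p - 6(i+1) equal -(3X+p)/2 and (3X-p)/2.
Pairing them makes the expansion in p even, hence expressible by odd powers of 1/X. -/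
theorem logDerivSum_eq (n : ℕ) (hn : 2 ≤ n) :
    logDerivSum ℚ n + 1 / (2 * n + 1) - (2 * n + 1) * pairSum ℚ n (n - 1) =
      recipSum 1 (2 * n) - recipSum 1 n / 2 -
        ∑ i ∈ Finset.range (n / 2), (2 / (3 * (2 * n - 3 - 4 * (i : ℚ)) + (2 * n + 1)) +
          2 / (3 * (2 * n - 3 - 4 * (i : ℚ)) - (2 * n + 1))) := by
  have hn2 : (2 : ℚ) ≤ n := by exact_mod_cast hn
  have b1 : (n : ℚ) - 1 ≠ 0 := by intro h; linarith
  have b2 : (n : ℚ) ≠ 0 := by intro h; linarith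
  have h1 : logDerivSum ℚ n = ∑ i ∈ Finset.range ((n + 1) / 2),
      (1 / (1 - 2 * (i : ℚ)) - 1 / (3 - (2 * n + 1) + 2 * i)) -
      ∑ i ∈ Finset.range ((n + 1) / 2), 2 / (3 * (2 * n - 3 - 4 * (i : ℚ)) + (2 * n + 1)) -
      ∑ i ∈ Finset.range ((n + 1) / 2), 1 / (2 * n + 1 - 6 * (i : ℚ)) := by
    rw [logDerivSum, ← Finset.sum_sub_distrib, ← Finset.sum_sub_distrib]
    refine Finset.sum_congr rfl fun i _ => ?_
    rw [show 3 * (2 * (n : ℚ) - 3 - 4 * i) + (2 * n + 1) =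
      (-2) * (6 - 2 * (2 * n + 1) + 6 * i) by ring,
      show (2 : ℚ) / ((-2) * (6 - 2 * (2 * n + 1) + 6 * i)) =
        -(1 / (6 - 2 * (2 * n + 1) + 6 * (i : ℚ))) by
        rw [← div_div, show (2 : ℚ) / -2 = -1 by norm_num, neg_div]]
    ring
  have h2 : ∀ i : ℕ, 1 / (2 * (n : ℚ) + 1 - 6 * ((i + 1 : ℕ) : ℚ)) =
      2 / (3 * (2 * n - 3 - 4 * (i : ℚ)) - (2 * n + 1)) := by
    intro i
    rw [show 3 * (2 * n - 3 - 4 * (i : ℚ)) - (2 * n + 1) =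
      2 * (2 * (n : ℚ) + 1 - 6 * ((i + 1 : ℕ) : ℚ)) by push_cast; ring, ← div_div,
      div_self two_ne_zero]
  have h3 : ∑ i ∈ Finset.range ((n + 1) / 2), 2 / (3 * (2 * n - 3 - 4 * (i : ℚ)) + (2 * n + 1)) +
      ∑ i ∈ Finset.range ((n + 1) / 2), 1 / (2 * n + 1 - 6 * (i : ℚ)) =
      ∑ i ∈ Finset.range (n / 2), (2 / (3 * (2 * n - 3 - 4 * (i : ℚ)) + (2 * n + 1)) +
          2 / (3 * (2 * n - 3 - 4 * (i : ℚ)) - (2 * n + 1))) + 1 / (2 * n + 1) + 1 / (n - 1) := by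
    rw [Finset.sum_add_distrib]
    -- The unpaired boundary term 1/(n-1) comes from 3X - p when n is even and from 3X + p when n is
    -- odd.
    rcases Nat.even_or_odd' n with ⟨t, ht | ht⟩
    · obtain ⟨s, rfl⟩ : ∃ s, t = s + 1 := ⟨t - 1, by omega⟩
      rw [show (n + 1) / 2 = s + 1 by omega, show n / 2 = s + 1 by omega,
        Finset.sum_range_succ' (fun i : ℕ => 1 / (2 * (n : ℚ) + 1 - 6 * (i : ℚ))),
        Finset.sum_congr rfl fun i _ => h2 i,
        Finset.sum_range_succ (fun i : ℕ => 2 / (3 * (2 * (n : ℚ) - 3 - 4 * (i : ℚ)) - (2 * n + 1)))]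
      have : 3 * (2 * (n : ℚ) - 3 - 4 * (s : ℚ)) - (2 * n + 1) = -(2 * (n - 1)) := by
        rw [ht]; push_cast; ring
      rw [this]
      have e : (2 : ℚ) / (-(2 * (n - 1))) = - (1 / (n - 1)) := by field_simp
      rw [e]
      push_cast
      ring
    · rw [show (n + 1) / 2 = t + 1 by omega, show n / 2 = t by omega,
        Finset.sum_range_succ' (fun i : ℕ => 1 / (2 * (n : ℚ) + 1 - 6 * (i : ℚ))),
        Finset.sum_congr rfl fun i _ => h2 i,
        Finset.sum_range_succ (fun i : ℕ => 2 / (3 * (2 * (n : ℚ) - 3 - 4 * (i : ℚ)) + (2 * n + 1)))]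
      have : 3 * (2 * (n : ℚ) - 3 - 4 * (t : ℚ)) + (2 * n + 1) = 2 * (n - 1) := by
        rw [ht]; push_cast; ring
      rw [this]
      have e : (2 : ℚ) / (2 * (n - 1)) = 1 / (n - 1) := by field_simp
      rw [e]
      push_cast
      ring
  -- Partial fractions: p/(Y(Y-p)) = -1/Y - 1/(p-Y). As Y runs over the odd numbers 3, …, p-2, p-Y
  -- runs over the even numbers 2, …, p-3.
  have h4 : (2 * (n : ℚ) + 1) * pairSum ℚ n (n - 1) =
      1 + 1 / (2 * n) - recipSum 1 (2 * n) := by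
    obtain ⟨l, rfl⟩ : ∃ l, n = l + 1 := ⟨n - 1, by omega⟩
    have e1 : oddRecipSum 1 (l + 1) = ∑ j ∈ Finset.range l, 1 / (2 * (j : ℚ) + 3) + 1 := by
      rw [oddRecipSum, Finset.sum_range_succ']
      congr 1
      · exact Finset.sum_congr rfl fun j _ => by push_cast; ring
      · simp
    have e2 : evenRecipSum 1 (l + 1) =
        ∑ j ∈ Finset.range l, 1 / (2 * (l : ℚ) - 2 * j) + 1 / (2 * (l + 1)) := by
      rw [evenRecipSum, Finset.sum_range_succ]
      congr 1
      · rw [← Finset.sum_range_reflect]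
        refine Finset.sum_congr rfl fun j hj => ?_
        have := Finset.mem_range.1 hj
        rw [Nat.cast_sub (by omega), Nat.cast_sub (by omega)]
        push_cast
        ring
      · ring
    rw [recipSum_two_mul, e1, e2, pairSum, Nat.add_sub_cancel, Finset.mul_sum]
    have e3 : ∑ i ∈ Finset.range l, (2 * ((l + 1 : ℕ) : ℚ) + 1) * (1 / ((2 * (i : ℚ) + 3) *
        (2 * (i : ℚ) + 3 - (2 * ((l + 1 : ℕ) : ℚ) + 1)))) =
        - ∑ j ∈ Finset.range l, 1 / (2 * (j : ℚ) + 3) -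
          ∑ j ∈ Finset.range l, 1 / (2 * (l : ℚ) - 2 * j) := by
      rw [← Finset.sum_neg_distrib, ← Finset.sum_sub_distrib]
      refine Finset.sum_congr rfl fun j hj => ?_
      have hj' : (j : ℚ) < l := by exact_mod_cast Finset.mem_range.1 hj
      have c1 : 2 * (j : ℚ) + 3 ≠ 0 := two_mul_add_three_ne j
      have c2 : (l : ℚ) - j ≠ 0 := by intro h; linarith
      push_cast
      rw [show 2 * (j : ℚ) + 3 - (2 * (l + 1) + 1) = -(2 * (l - j)) by ring,
        show 2 * (l : ℚ) - 2 * j = 2 * (l - j) by ring]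
      field_simp
      ring
    rw [e3]
    push_cast
    ring
  rw [h1, sum_recip_odd_even_aux n hn, h4]
  linear_combination (-1) * h3

/-! ### The quartic identity behind the alternating sum. -/

/-- The bivariate quartic term with parameters `u`, `v`. -/
noncomputable def quarticTerm {K : Type*} [Field K] (u v : K) (k : ℕ) : K :=
  (-1) ^ k * ((Nat.choose (2 * k) k : K) / 16 ^ k) * ∏ j ∈ Finset.range k,
    (((2 * (j : K) + 1) ^ 2 - (u + v) ^ 2) * ((2 * (j : K) + 1) ^ 2 - (u - v) ^ 2) /
      ((2 * (j : K) + 1 - u) * (2 * (j : K) + 1 + u) *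
        ((2 * (j : K) + 1 - v) * (2 * (j : K) + 1 + v))))

theorem quarticTerm_eq_zero {K : Type*} [Field K] {u v : K} {n k : ℕ} (huv : u + v = 2 * n + 1) (h : n < k) :
    quarticTerm u v k = 0 := by
  unfold quarticTerm
  have : (2 * (n : K) + 1) ^ 2 - (u + v) ^ 2 = 0 := by rw [huv]; ring
  rw [Finset.prod_eq_zero (Finset.mem_range.2 h), mul_zero]
  rw [this, zero_mul, zero_div]

section quartic

variable {K : Type*} [Field K] [CharZero K]

theorem quarticTerm_succ (u v : K) (k : ℕ) :
    quarticTerm u v (k + 1) = quarticTerm u v k *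
      (-(2 * (k : K) + 1) * ((2 * (k : K) + 1) ^ 2 - (u + v) ^ 2) *
        ((2 * (k : K) + 1) ^ 2 - (u - v) ^ 2) /
        (8 * ((k : K) + 1) * ((2 * (k : K) + 1 - u) * (2 * (k : K) + 1 + u) *
        ((2 * (k : K) + 1 - v) * (2 * (k : K) + 1 + v))))) := by
  have hk : (k : K) + 1 ≠ 0 := by exact_mod_cast Nat.succ_ne_zero k
  have h16 : (16 : K) ^ k ≠ 0 := pow_ne_zero _ (by norm_num)
  unfold quarticTerm
  rw [choose_two_mul_succ, Finset.prod_range_succ, pow_succ, pow_succ]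
  generalize (2 * (k : K) + 1 - u) * (2 * (k : K) + 1 + u) *
        ((2 * (k : K) + 1 - v) * (2 * (k : K) + 1 + v)) = c
  rcases eq_or_ne c 0 with rfl | hc
  · simp
  · field_simp
    ring

theorem quarticTerm_shift_two {u v : K} (hu : ∀ m : ℤ, u + m ≠ 0) (hv : ∀ m : ℤ, v + m ≠ 0)
    (hr : ∀ m : ℤ, u - v + m ≠ 0) (hp : ∀ k : ℕ, 2 * (k : K) + 1 + (u + v) ≠ 0) (k : ℕ) :
    quarticTerm u v k = quarticTerm (u + 2) v k *
      (-(2 * (k : K) - 1 - (u + v)) * (2 * (k : K) - 1 - (u - v)) * (2 * (k : K) + 1 + u) /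
        ((2 * (k : K) + 1 + (u + v)) * (2 * (k : K) + 1 + (u - v)) * (2 * (k : K) - 1 - u))) := by
  induction k with
  | zero =>
    have h1 := hp 0
    have h2 : 1 + (u - v) ≠ 0 := by convert hr 1 using 1; push_cast; ring
    have h3 : 1 + u ≠ 0 := by convert hu 1 using 1; push_cast; ring
    have h4 : -1 - u = -(1 + u) := by ring
    simp only [Nat.cast_zero, mul_zero, zero_add] at h1
    simp only [quarticTerm, Nat.cast_zero, mul_zero, zero_add, zero_sub, h4]
    simp only [pow_zero, Finset.range_zero, Finset.prod_empty, mul_one, one_mul,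
      Nat.choose_self, Nat.cast_one, div_one]
    rw [eq_div_iff (mul_ne_zero (mul_ne_zero h1 h2) (neg_ne_zero.2 h3))]
    ring
  | succ k ih =>
    have hk : (k : K) + 1 ≠ 0 := by exact_mod_cast Nat.succ_ne_zero k
    have a1 : 2 * (k : K) + 1 - u ≠ 0 := fun h => hu (-(2 * k + 1)) (by
      push_cast; linear_combination -h)
    have a2 : 2 * (k : K) + 1 + u ≠ 0 := fun h => hu (2 * k + 1) (by
      push_cast; linear_combination h)
    have a3 : 2 * (k : K) + 1 - v ≠ 0 := fun h => hv (-(2 * k + 1)) (by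
      push_cast; linear_combination -h)
    have a4 : 2 * (k : K) + 1 + v ≠ 0 := fun h => hv (2 * k + 1) (by
      push_cast; linear_combination h)
    have a5 : 2 * (k : K) - 1 - u ≠ 0 := fun h => hu (-(2 * k - 1)) (by
      push_cast; linear_combination -h)
    have a6 : 2 * (k : K) + 3 + u ≠ 0 := fun h => hu (2 * k + 3) (by
      push_cast; linear_combination h)
    have b1 := hp k
    have b2 : 2 * (k : K) + 3 + (u + v) ≠ 0 := by convert hp (k + 1) using 1; push_cast; ring
    have b3 : 2 * (k : K) + 1 + (u - v) ≠ 0 := fun h => hr (2 * k + 1) (by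
      push_cast; linear_combination h)
    have b4 : 2 * (k : K) + 3 + (u - v) ≠ 0 := fun h => hr (2 * k + 3) (by
      push_cast; linear_combination h)
    rw [quarticTerm_succ, quarticTerm_succ, ih]
    rw [show 2 * ((k + 1 : ℕ) : K) - 1 - (u + v) = 2 * (k : K) + 1 - (u + v) by push_cast; ring,
      show 2 * ((k + 1 : ℕ) : K) - 1 - (u - v) = 2 * (k : K) + 1 - (u - v) by push_cast; ring,
      show 2 * ((k + 1 : ℕ) : K) + 1 + u = 2 * (k : K) + 3 + u by push_cast; ring,
      show 2 * ((k + 1 : ℕ) : K) + 1 + (u + v) = 2 * (k : K) + 3 + (u + v) by push_cast; ring,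
      show 2 * ((k + 1 : ℕ) : K) + 1 + (u - v) = 2 * (k : K) + 3 + (u - v) by push_cast; ring,
      show 2 * ((k + 1 : ℕ) : K) - 1 - u = 2 * (k : K) + 1 - u by push_cast; ring,
      show 2 * (k : K) + 1 - (u + 2) = 2 * (k : K) - 1 - u by ring,
      show 2 * (k : K) + 1 + (u + 2) = 2 * (k : K) + 3 + u by ring]
    generalize hA : 2 * (k : K) + 1 - u = A at *
    generalize hB : 2 * (k : K) + 1 + u = B at *
    generalize hC : 2 * (k : K) + 1 - v = C at *
    generalize hD : 2 * (k : K) + 1 + v = D at *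
    generalize hE : 2 * (k : K) - 1 - u = E at *
    generalize hF : 2 * (k : K) + 3 + u = F at *
    generalize hG : 2 * (k : K) + 1 + (u + v) = G at *
    generalize hH : 2 * (k : K) + 3 + (u + v) = H at *
    generalize hI : 2 * (k : K) + 1 + (u - v) = I at *
    generalize hJ : 2 * (k : K) + 3 + (u - v) = J at *
    field_simp
    subst hA hB hC hD hE hF hG hH hI hJ
    ring

/-- The telescoping certificate for u ↦ u + 2 at fixed v. It says that u times the sum is unchanged
by the shift, up to a boundary term that vanishes when u + 2 + v is a positive odd integer and N is
large. -/
theorem sum_quarticTerm_shift_two {u v : K} (hu : ∀ m : ℤ, u + m ≠ 0) (hv : ∀ m : ℤ, v + m ≠ 0)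
    (hr : ∀ m : ℤ, u - v + m ≠ 0) (hp : ∀ k : ℕ, 2 * (k : K) + 1 + (u + v) ≠ 0) (N : ℕ) :
    ∑ k ∈ Finset.range N, ((u + 2) * (quarticTerm (u + 2) v k *
      ((5 * (2 * (k : K) + 1) ^ 2 - (u + 2) ^ 2 - v ^ 2) /
        ((2 * (k : K) + 1 - (u + 2)) * (2 * (k : K) + 1 + (u + 2)) *
          ((2 * (k : K) + 1 - v) * (2 * (k : K) + 1 + v))))) -
      u * (quarticTerm u v k *
      ((5 * (2 * (k : K) + 1) ^ 2 - u ^ 2 - v ^ 2) /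
        ((2 * (k : K) + 1 - u) * (2 * (k : K) + 1 + u) *
          ((2 * (k : K) + 1 - v) * (2 * (k : K) + 1 + v)))))) =
    quarticTerm (u + 2) v N * (-(16 * (u + 1) * N) /
      ((2 * (N : K) + 1 + (u + v)) * (2 * (N : K) + 1 + (u - v)) * (2 * (N : K) - 1 - u))) := by
  induction N with
  | zero => simp
  | succ k ih =>
    have hk : (k : K) + 1 ≠ 0 := by exact_mod_cast Nat.succ_ne_zero k
    have a1 : 2 * (k : K) + 1 - u ≠ 0 := fun h => hu (-(2 * k + 1)) (by
      push_cast; linear_combination -h)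
    have a2 : 2 * (k : K) + 1 + u ≠ 0 := fun h => hu (2 * k + 1) (by
      push_cast; linear_combination h)
    have a3 : 2 * (k : K) + 1 - v ≠ 0 := fun h => hv (-(2 * k + 1)) (by
      push_cast; linear_combination -h)
    have a4 : 2 * (k : K) + 1 + v ≠ 0 := fun h => hv (2 * k + 1) (by
      push_cast; linear_combination h)
    have a5 : 2 * (k : K) - 1 - u ≠ 0 := fun h => hu (-(2 * k - 1)) (by
      push_cast; linear_combination -h)
    have a6 : 2 * (k : K) + 3 + u ≠ 0 := fun h => hu (2 * k + 3) (by
      push_cast; linear_combination h)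
    have b1 := hp k
    have b2 : 2 * (k : K) + 3 + (u + v) ≠ 0 := by convert hp (k + 1) using 1; push_cast; ring
    have b3 : 2 * (k : K) + 1 + (u - v) ≠ 0 := fun h => hr (2 * k + 1) (by
      push_cast; linear_combination h)
    have b4 : 2 * (k : K) + 3 + (u - v) ≠ 0 := fun h => hr (2 * k + 3) (by
      push_cast; linear_combination h)
    rw [Finset.sum_range_succ, ih, quarticTerm_succ, quarticTerm_shift_two hu hv hr hp k]
    rw [show 2 * ((k + 1 : ℕ) : K) + 1 + (u + v) = 2 * (k : K) + 3 + (u + v) by push_cast; ring,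
      show 2 * ((k + 1 : ℕ) : K) + 1 + (u - v) = 2 * (k : K) + 3 + (u - v) by push_cast; ring,
      show 2 * ((k + 1 : ℕ) : K) - 1 - u = 2 * (k : K) + 1 - u by push_cast; ring,
      show 2 * (k : K) + 1 - (u + 2) = 2 * (k : K) - 1 - u by ring,
      show 2 * (k : K) + 1 + (u + 2) = 2 * (k : K) + 3 + u by ring]
    push_cast
    generalize hA : 2 * (k : K) + 1 - u = A at *
    generalize hB : 2 * (k : K) + 1 + u = B at *
    generalize hC : 2 * (k : K) + 1 - v = C at *
    generalize hD : 2 * (k : K) + 1 + v = D at *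
    generalize hE : 2 * (k : K) - 1 - u = E at *
    generalize hF : 2 * (k : K) + 3 + u = F at *
    generalize hG : 2 * (k : K) + 1 + (u + v) = G at *
    generalize hH : 2 * (k : K) + 3 + (u + v) = H at *
    generalize hI : 2 * (k : K) + 1 + (u - v) = I at *
    generalize hJ : 2 * (k : K) + 3 + (u - v) = J at *
    field_simp
    subst hA hB hC hD hE hF hG hH hI hJ
    ring

/-- Repeated shifts of u by -2 reduce to u + v = 1, where a single term remains. A general field is
needed because the application takes complex u and v. -/
theorem sum_quarticTerm (n : ℕ) : ∀ u v : K, u + v = 2 * n + 1 → (∀ m : ℤ, u + m ≠ 0) →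
    (∀ m : ℤ, v + m ≠ 0) → (∀ m : ℤ, u - v + m ≠ 0) →
    u * ∑ k ∈ Finset.range (n + 1), (quarticTerm u v k *
      ((5 * (2 * (k : K) + 1) ^ 2 - u ^ 2 - v ^ 2) /
        ((2 * (k : K) + 1 - u) * (2 * (k : K) + 1 + u) *
          ((2 * (k : K) + 1 - v) * (2 * (k : K) + 1 + v))))) = 2 / v := by
  induction n with
  | zero =>
    intro u v huv hu hv hr
    have hv' : v = 1 - u := by linear_combination huv
    have a1 : 1 - u ≠ 0 := fun h => hu (-1) (by push_cast; linear_combination -h)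
    have a2 : 1 + u ≠ 0 := fun h => hu 1 (by push_cast; linear_combination h)
    have a3 : 2 - u ≠ 0 := fun h => hu (-2) (by push_cast; linear_combination -h)
    have a4 : u ≠ 0 := fun h => hu 0 (by push_cast; linear_combination h)
    subst hv'
    simp only [zero_add, Finset.sum_range_one, quarticTerm, Nat.cast_zero, mul_zero, pow_zero,
      Finset.range_zero, Finset.prod_empty, Nat.choose_self, Nat.cast_one, one_mul, div_one,
      one_pow, mul_one]
    rw [show 1 - (1 - u) = u by ring, show 1 + (1 - u) = 2 - u by ring]
    field_simp
    ring
  | succ n ih =>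
    intro u v huv hu hv hr
    have hu' : ∀ m : ℤ, u - 2 + m ≠ 0 := fun m h => hu (m - 2) (by
      push_cast; linear_combination h)
    have hr' : ∀ m : ℤ, u - 2 - v + m ≠ 0 := fun m h => hr (m - 2) (by
      push_cast; linear_combination h)
    have huv' : u - 2 + v = 2 * n + 1 := by push_cast at huv; linear_combination huv
    have hi := ih (u - 2) v huv' hu' hv hr'
    have key := sum_quarticTerm_shift_two hu' hv hr' (fun k => by
      rw [huv']
      have : ((2 * k + 1 + (2 * n + 1) : ℕ) : K) ≠ 0 := Nat.cast_ne_zero.2 (by omega)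
      push_cast at this; exact this) (n + 1 + 1)
    rw [sub_add_cancel, quarticTerm_eq_zero huv (Nat.lt_succ_self (n + 1)), zero_mul,
      Finset.sum_sub_distrib, ← Finset.mul_sum, ← Finset.mul_sum,
      Finset.sum_range_succ (fun k => quarticTerm (u - 2) v k * _),
      quarticTerm_eq_zero huv' (Nat.lt_succ_self n), zero_mul, add_zero, hi, sub_eq_zero] at key
    exact key

end quartic

/-- For u, v = p(1 ± i)/2 one has u² + v² = 0, uv = p²/2 and (u-v)² = -(u+v)², so all quadratic
terms in p cancel from the summand. Non-real parameters also avoid every pole. -/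
theorem sum_quarticTerm_special (n : ℕ) :
    ∑ k ∈ Finset.range (n + 1), (-1 : ℚ) ^ k * ((Nat.choose (2 * k) k : ℚ) / 16 ^ k) *
      (∏ j ∈ Finset.range k, (((2 * (j : ℚ) + 1) ^ 4 - (2 * (n : ℚ) + 1) ^ 4) /
        ((2 * (j : ℚ) + 1) ^ 4 + (2 * (n : ℚ) + 1) ^ 4 / 4))) *
      (5 * (2 * (k : ℚ) + 1) ^ 2 / ((2 * (k : ℚ) + 1) ^ 4 + (2 * (n : ℚ) + 1) ^ 4 / 4)) =
    4 / (2 * (n : ℚ) + 1) ^ 2 := by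
  have hI : Complex.I ^ 2 = -1 := Complex.I_sq
  set p : ℂ := 2 * (n : ℂ) + 1 with hp
  have hp0 : p ≠ 0 := two_mul_add_one_ne n
  set u : ℂ := p / 2 * (1 + Complex.I) with hu
  set v : ℂ := p / 2 * (1 - Complex.I) with hv
  have him : ∀ z : ℂ, z.im ≠ 0 → ∀ m : ℤ, z + m ≠ 0 := fun z hz m h => hz (by
    have := congrArg Complex.im h
    simpa using this)
  have hnR : (0 : ℝ) < 2 * n + 1 := by positivity
  have hpR : p = ((2 * (n : ℝ) + 1 : ℝ) : ℂ) := by rw [hp]; push_cast; rfl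
  have hu' : u.im ≠ 0 := by
    have : u = (((2 * (n : ℝ) + 1) / 2 : ℝ) : ℂ) * (1 + Complex.I) := by
      rw [hu, hpR]; push_cast; rfl
    rw [this, Complex.im_ofReal_mul]; simp; linarith
  have hv' : v.im ≠ 0 := by
    have : v = (((2 * (n : ℝ) + 1) / 2 : ℝ) : ℂ) * (1 - Complex.I) := by
      rw [hv, hpR]; push_cast; rfl
    rw [this, Complex.im_ofReal_mul]; simp; linarith
  have hr' : (u - v).im ≠ 0 := by
    have : u - v = ((2 * (n : ℝ) + 1 : ℝ) : ℂ) * Complex.I := by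
      rw [hu, hv, hpR]; ring
    rw [this, Complex.im_ofReal_mul]; simp; linarith
  have key := sum_quarticTerm n u v (by rw [hu, hv]; ring) (him u hu') (him v hv') (him _ hr')
  have hu0 : u ≠ 0 := by simpa using him u hu' 0
  have hv0 : v ≠ 0 := by simpa using him v hv' 0
  have huv : u * v = p ^ 2 / 2 := by rw [hu, hv]; linear_combination (-p ^ 2 / 4) * hI
  have hadd : u + v = p := by rw [hu, hv]; ring
  have hsub : (u - v) ^ 2 = -p ^ 2 := by rw [hu, hv]; linear_combination p ^ 2 * hI
  have hsq : u ^ 2 + v ^ 2 = 0 := by rw [hu, hv]; linear_combination p ^ 2 / 2 * hI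
  have hden : ∀ X : ℂ, (X - u) * (X + u) * ((X - v) * (X + v)) = X ^ 4 + p ^ 4 / 4 := by
    intro X
    linear_combination (-X ^ 2) * hsq + (u * v + p ^ 2 / 2) * huv
  have hsum : ∑ k ∈ Finset.range (n + 1), (-1 : ℂ) ^ k * ((Nat.choose (2 * k) k : ℂ) / 16 ^ k) *
      (∏ j ∈ Finset.range k, (((2 * (j : ℂ) + 1) ^ 4 - p ^ 4) /
        ((2 * (j : ℂ) + 1) ^ 4 + p ^ 4 / 4))) *
      (5 * (2 * (k : ℂ) + 1) ^ 2 / ((2 * (k : ℂ) + 1) ^ 4 + p ^ 4 / 4)) = 4 / p ^ 2 := by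
    have e : (4 : ℂ) / p ^ 2 = 2 / v / u := by
      rw [div_div, mul_comm v u, huv]
      field_simp
      norm_num
    rw [e, ← key, mul_div_cancel_left₀ _ hu0]
    refine Finset.sum_congr rfl fun k _ => ?_
    unfold quarticTerm
    rw [hden, show 5 * (2 * (k : ℂ) + 1) ^ 2 - u ^ 2 - v ^ 2 = 5 * (2 * (k : ℂ) + 1) ^ 2 by
      linear_combination -hsq]
    congr 2
    refine Finset.prod_congr rfl fun j _ => ?_
    rw [hden, hadd, hsub]
    congr 1
    ring
  rw [hp] at hsum
  apply Rat.cast_injective (α := ℂ)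
  push_cast
  exact hsum

/-- The term k = n is moved to the right. Its factor X⁴ - p⁴ splits as (X²-p²)(X²+p²); the first
half, with the central binomial coefficient, gives (-1)^n by `weightPoly_eval_odd`, which cancels
the sign. -/
theorem sum_truncated_quartic (n : ℕ) :
    5 * ∑ k ∈ Finset.range n, (-1 : ℚ) ^ k * ((Nat.choose (2 * k) k : ℚ) / 16 ^ k) *
      (∏ j ∈ Finset.range k, (((2 * (j : ℚ) + 1) ^ 4 - (2 * (n : ℚ) + 1) ^ 4) /
        ((2 * (j : ℚ) + 1) ^ 4 + (2 * (n : ℚ) + 1) ^ 4 / 4))) *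
      ((2 * (k : ℚ) + 1) ^ 2 / ((2 * (k : ℚ) + 1) ^ 4 + (2 * (n : ℚ) + 1) ^ 4 / 4)) =
    4 / (2 * (n : ℚ) + 1) ^ 2 * (1 - ∏ j ∈ Finset.range n, ((1 + (2 * (n : ℚ) + 1) ^ 2 / (2 * (j : ℚ) + 1) ^ 2) /
      (1 + (2 * (n : ℚ) + 1) ^ 4 / (4 * (2 * (j : ℚ) + 1) ^ 4)))) := by
  have h := sum_quarticTerm_special n
  rw [Finset.sum_range_succ] at h
  have hw := weightPoly_eval_odd ℚ n n le_rfl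
  rw [← two_mul, Nat.choose_self, Nat.cast_one, mul_one, weightPoly_eval, centralWeight] at hw
  have hp0 : 2 * (n : ℚ) + 1 ≠ 0 := two_mul_add_one_ne n
  have hw' : (Nat.choose (2 * n) n : ℚ) / 16 ^ n * ∏ j ∈ Finset.range n,
      (1 - (2 * (n : ℚ) + 1) ^ 2 / (2 * (j : ℚ) + 1) ^ 2) = (-1) ^ n := by
    rw [← div_div] at hw
    field_simp at hw ⊢
    exact hw
  have hprod : ∏ j ∈ Finset.range n, (((2 * (j : ℚ) + 1) ^ 4 - (2 * (n : ℚ) + 1) ^ 4) /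
        ((2 * (j : ℚ) + 1) ^ 4 + (2 * (n : ℚ) + 1) ^ 4 / 4)) =
      (∏ j ∈ Finset.range n, (1 - (2 * (n : ℚ) + 1) ^ 2 / (2 * (j : ℚ) + 1) ^ 2)) *
      ∏ j ∈ Finset.range n, ((1 + (2 * (n : ℚ) + 1) ^ 2 / (2 * (j : ℚ) + 1) ^ 2) /
      (1 + (2 * (n : ℚ) + 1) ^ 4 / (4 * (2 * (j : ℚ) + 1) ^ 4))) := by
    rw [← Finset.prod_mul_distrib]
    refine Finset.prod_congr rfl fun j _ => ?_
    have hX : 2 * (j : ℚ) + 1 ≠ 0 := two_mul_add_one_ne j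
    generalize 2 * (j : ℚ) + 1 = X at *
    generalize 2 * (n : ℚ) + 1 = p at *
    have h1 : X ^ 4 + p ^ 4 / 4 ≠ 0 := by positivity
    have h2 : 1 + p ^ 4 / (4 * X ^ 4) ≠ 0 := by positivity
    have h3 : 4 * X ^ 4 + p ^ 4 ≠ 0 := by positivity
    rw [mul_div_assoc', div_eq_div_iff h1 h2]
    field_simp
    ring
  have hlast : 5 * (2 * (n : ℚ) + 1) ^ 2 / ((2 * (n : ℚ) + 1) ^ 4 + (2 * (n : ℚ) + 1) ^ 4 / 4) =
      4 / (2 * (n : ℚ) + 1) ^ 2 := by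
    generalize 2 * (n : ℚ) + 1 = p at *
    field_simp
    ring
  rw [hlast, hprod] at h
  have hs : (-1 : ℚ) ^ n * (-1) ^ n = 1 := by rw [← mul_pow]; simp
  rw [Finset.mul_sum]
  have e : ∀ k : ℕ, 5 * ((-1 : ℚ) ^ k * ((Nat.choose (2 * k) k : ℚ) / 16 ^ k) *
      (∏ j ∈ Finset.range k, (((2 * (j : ℚ) + 1) ^ 4 - (2 * (n : ℚ) + 1) ^ 4) /
        ((2 * (j : ℚ) + 1) ^ 4 + (2 * (n : ℚ) + 1) ^ 4 / 4))) *
      ((2 * (k : ℚ) + 1) ^ 2 / ((2 * (k : ℚ) + 1) ^ 4 + (2 * (n : ℚ) + 1) ^ 4 / 4))) =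
      (-1 : ℚ) ^ k * ((Nat.choose (2 * k) k : ℚ) / 16 ^ k) *
      (∏ j ∈ Finset.range k, (((2 * (j : ℚ) + 1) ^ 4 - (2 * (n : ℚ) + 1) ^ 4) /
        ((2 * (j : ℚ) + 1) ^ 4 + (2 * (n : ℚ) + 1) ^ 4 / 4))) *
      (5 * (2 * (k : ℚ) + 1) ^ 2 / ((2 * (k : ℚ) + 1) ^ 4 + (2 * (n : ℚ) + 1) ^ 4 / 4)) := by
    intro k; ring
  rw [Finset.sum_congr rfl fun k _ => e k]
  generalize (∏ j ∈ Finset.range n, ((1 + (2 * (n : ℚ) + 1) ^ 2 / (2 * (j : ℚ) + 1) ^ 2) /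
      (1 + (2 * (n : ℚ) + 1) ^ 4 / (4 * (2 * (j : ℚ) + 1) ^ 4)))) = Q at *
  linear_combination h - (-1 : ℚ) ^ n * Q * (4 / (2 * (n : ℚ) + 1) ^ 2) * hw' -
    Q * (4 / (2 * (n : ℚ) + 1) ^ 2) * hs

/-! ### Calculus of p-adic divisibility. -/

/-- `x` is `p ^ e` times a `p`-integral rational number. -/
def PadicDvd (p e : ℕ) (x : ℚ) : Prop := padicNorm p x ≤ ((p : ℚ) ^ e)⁻¹

/-- `x` is a `p`-adic unit. -/
def PadicUnit (p : ℕ) (x : ℚ) : Prop := padicNorm p x = 1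

section

variable {p : ℕ} [hp : Fact p.Prime] {e f : ℕ} {x y : ℚ}

theorem PadicDvd.zero : PadicDvd p e 0 := by
  simp [PadicDvd]

theorem PadicDvd.add (hx : PadicDvd p e x) (hy : PadicDvd p e y) : PadicDvd p e (x + y) :=
  padicNorm.nonarchimedean.trans (max_le hx hy)

theorem PadicDvd.neg (hx : PadicDvd p e x) : PadicDvd p e (-x) := by
  rwa [PadicDvd, padicNorm.neg]

theorem PadicDvd.sub (hx : PadicDvd p e x) (hy : PadicDvd p e y) : PadicDvd p e (x - y) := by
  rw [sub_eq_add_neg]; exact hx.add hy.neg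

theorem PadicDvd.mul (hx : PadicDvd p e x) (hy : PadicDvd p f y) :
    PadicDvd p (e + f) (x * y) := by
  rw [PadicDvd, padicNorm.mul, pow_add, mul_inv]
  exact mul_le_mul hx hy (padicNorm.nonneg _) (by positivity)

theorem PadicDvd.mul_left (hx : PadicDvd p e x) (hy : PadicDvd p 0 y) : PadicDvd p e (y * x) := by
  have := hy.mul hx
  rwa [zero_add] at this

theorem PadicDvd.mul_right (hx : PadicDvd p e x) (hy : PadicDvd p 0 y) :
    PadicDvd p e (x * y) := hx.mul hy

theorem PadicDvd.mono (hx : PadicDvd p e x) (h : f ≤ e) : PadicDvd p f x := by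
  refine hx.trans ?_
  have : (1 : ℚ) ≤ p := by exact_mod_cast hp.out.one_lt.le
  have hp0 : (0 : ℚ) < p := by linarith
  exact inv_anti₀ (by positivity) (pow_le_pow_right₀ this h)

theorem PadicDvd.of_eq (hx : PadicDvd p e x) (h : x = y) : PadicDvd p e y := h ▸ hx

theorem PadicDvd.intCast (z : ℤ) : PadicDvd p 0 z := by
  simpa [PadicDvd] using padicNorm.of_int z

theorem PadicDvd.natCast (z : ℕ) : PadicDvd p 0 z := by
  exact_mod_cast PadicDvd.intCast (p := p) z

theorem PadicDvd.one : PadicDvd p 0 1 := by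
  simpa using PadicDvd.natCast (p := p) 1

theorem PadicDvd.pow_zero (hx : PadicDvd p 0 x) (k : ℕ) : PadicDvd p 0 (x ^ k) := by
  induction k with
  | zero => simpa using PadicDvd.one
  | succ k ih => rw [pow_succ]; exact ih.mul hx

theorem padicNorm_prime_pow (k : ℕ) : padicNorm p ((p : ℚ) ^ k) = ((p : ℚ) ^ k)⁻¹ := by
  induction k with
  | zero => simp
  | succ k ih => rw [pow_succ, padicNorm.mul, ih, padicNorm.padicNorm_p_of_prime, mul_inv]

theorem PadicDvd.prime_pow (k : ℕ) : PadicDvd p k ((p : ℚ) ^ k) :=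
  (padicNorm_prime_pow k).le

theorem PadicDvd.pow_mul (hx : PadicDvd p 0 x) (k : ℕ) : PadicDvd p k ((p : ℚ) ^ k * x) :=
  (PadicDvd.prime_pow k).mul hx

theorem PadicDvd.pow_mul' (hx : PadicDvd p e x) (k : ℕ) :
    PadicDvd p (k + e) ((p : ℚ) ^ k * x) :=
  (PadicDvd.prime_pow k).mul hx

theorem PadicDvd.of_pow_mul {k : ℕ} (h : PadicDvd p (k + e) ((p : ℚ) ^ k * x)) :
    PadicDvd p e x := by
  have hp0 : (0 : ℚ) < p := by exact_mod_cast hp.out.pos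
  rw [PadicDvd, padicNorm.mul, padicNorm_prime_pow, pow_add, mul_inv] at h
  exact le_of_mul_le_mul_left h (by positivity)

theorem PadicDvd.sum {ι : Type*} {s : Finset ι} {g : ι → ℚ} (h : ∀ i ∈ s, PadicDvd p e (g i)) :
    PadicDvd p e (∑ i ∈ s, g i) := by
  classical
  induction s using Finset.induction_on with
  | empty => simpa using PadicDvd.zero
  | insert a s ha ih =>
    rw [Finset.sum_insert ha]
    exact (h a (by simp)).add (ih fun i hi => h i (by simp [hi]))

theorem PadicUnit.dvd (hx : PadicUnit p x) : PadicDvd p 0 x := by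
  rw [PadicDvd, hx]; simp

theorem PadicUnit.ne_zero (hx : PadicUnit p x) : x ≠ 0 := by
  rintro rfl
  simp [PadicUnit] at hx

theorem PadicUnit.mul (hx : PadicUnit p x) (hy : PadicUnit p y) : PadicUnit p (x * y) := by
  rw [PadicUnit, padicNorm.mul, hx, hy, mul_one]

theorem PadicUnit.pow (hx : PadicUnit p x) (k : ℕ) : PadicUnit p (x ^ k) := by
  induction k with
  | zero => simp [PadicUnit]
  | succ k ih => rw [pow_succ]; exact ih.mul hx

theorem PadicUnit.neg (hx : PadicUnit p x) : PadicUnit p (-x) := by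
  rwa [PadicUnit, padicNorm.neg]

theorem PadicUnit.inv (hx : PadicUnit p x) : PadicUnit p x⁻¹ := by
  have h := padicNorm.mul (p := p) x x⁻¹
  rw [mul_inv_cancel₀ hx.ne_zero, hx, one_mul, padicNorm.one] at h
  exact h.symm

theorem PadicUnit.div_dvd (hx : PadicUnit p x) (hy : PadicDvd p e y) : PadicDvd p e (y / x) := by
  rw [div_eq_mul_inv]
  exact hy.mul_right hx.inv.dvd

theorem PadicUnit.one_div (hx : PadicUnit p x) : PadicDvd p 0 (1 / x) :=
  hx.div_dvd PadicDvd.one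

theorem PadicUnit.intCast {z : ℤ} (h : ¬ (p : ℤ) ∣ z) : PadicUnit p z :=
  (padicNorm.int_eq_one_iff z).2 h

theorem PadicUnit.natCast {z : ℕ} (h : ¬ p ∣ z) : PadicUnit p z :=
  (padicNorm.nat_eq_one_iff z).2 h

theorem PadicUnit.add (hx : PadicUnit p x) (hy : PadicDvd p 1 y) : PadicUnit p (x + y) := by
  have h1 : padicNorm p y < 1 := by
    refine lt_of_le_of_lt hy ?_
    rw [pow_one]
    exact inv_lt_one_of_one_lt₀ (by exact_mod_cast hp.out.one_lt)
  have hx' : padicNorm p x = 1 := hx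
  rw [PadicUnit, padicNorm.add_eq_max_of_ne (by rw [hx']; exact h1.ne'), hx', max_eq_left h1.le]

theorem PadicUnit.two (h : 5 < p) : PadicUnit p 2 := by
  exact_mod_cast PadicUnit.natCast (p := p) (z := 2) fun h' => by have := Nat.le_of_dvd (by norm_num) h'; omega

theorem PadicUnit.three (h : 5 < p) : PadicUnit p 3 := by
  exact_mod_cast PadicUnit.natCast (p := p) (z := 3) fun h' => by have := Nat.le_of_dvd (by norm_num) h'; omega

theorem PadicUnit.five (h : 5 < p) : PadicUnit p 5 := by
  exact_mod_cast PadicUnit.natCast (p := p) (z := 5) fun h' => by have := Nat.le_of_dvd (by norm_num) h'; omega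

/-- A rational number whose denominator has no prime factor above `5` is `p`-integral for `p > 5`. -/
theorem PadicDvd.const (h : 5 < p) (a : ℤ) (k : ℕ) : PadicDvd p 0 ((a : ℚ) / 30 ^ k) := by
  have h30 : PadicUnit p 30 := by
    have := ((PadicUnit.two h).mul (PadicUnit.three h)).mul (PadicUnit.five h)
    norm_num at this
    exact this
  exact (h30.pow k).div_dvd (PadicDvd.intCast a)

theorem PadicDvd.rat (h : 5 < p) {q : ℚ} (k : ℕ) (hq : q.den ∣ 30 ^ k) : PadicDvd p 0 q := by
  obtain ⟨d, hd⟩ := hq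
  have := PadicDvd.const h (q.num * d) k
  refine this.of_eq ?_
  have h1 : (30 : ℚ) ^ k = q.den * d := by exact_mod_cast hd
  have hd0 : (d : ℚ) ≠ 0 := by
    intro h0
    rw [h0, mul_zero] at h1
    exact pow_ne_zero k (by norm_num) h1
  rw [h1]
  push_cast
  rw [mul_div_mul_right _ _ hd0, Rat.num_div_den]

/-- If p divided the reduced denominator of the p-integral quotient c, then c.num = c · c.den would
be divisible by p, contradicting reducedness. -/
theorem PadicDvd.ratModEq (h : PadicDvd p e (x - y)) : RatModEq (p ^ e) x y := by
  have hp0 : (p : ℚ) ^ e ≠ 0 := pow_ne_zero _ (by exact_mod_cast hp.out.ne_zero)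
  refine ⟨(x - y) / (p : ℚ) ^ e, ?_, by push_cast; rw [mul_div_cancel₀ _ hp0]⟩
  set c := (x - y) / (p : ℚ) ^ e with hc
  have hD : PadicDvd p 0 c := by
    apply PadicDvd.of_pow_mul (k := e)
    rwa [hc, mul_div_cancel₀ _ hp0]
  refine Nat.Coprime.pow_right e ?_
  rw [Nat.coprime_comm, Nat.Prime.coprime_iff_not_dvd hp.out]
  intro hdvd
  have hnum : ¬ (p : ℤ) ∣ c.num := fun h' => by
    have h1 : p ∣ c.num.natAbs := Int.natCast_dvd.1 h'
    have := Nat.dvd_gcd h1 hdvd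
    rw [c.reduced.gcd_eq_one] at this
    exact hp.out.one_lt.ne' (Nat.dvd_one.1 this)
  have hden : PadicDvd p 1 (c.den : ℚ) := by
    obtain ⟨d, hd⟩ := hdvd
    rw [hd]
    push_cast
    have := PadicDvd.pow_mul (p := p) (PadicDvd.natCast d) 1
    rwa [pow_one] at this
  have hU : PadicUnit p (c.num : ℚ) := PadicUnit.intCast hnum
  have : PadicDvd p 1 (c.num : ℚ) := by
    have h2 := hden.mul_left hD
    rwa [Rat.mul_den_eq_num] at h2
  rw [PadicDvd, hU, pow_one] at this
  have h1 : (1 : ℚ) < p := by exact_mod_cast hp.out.one_lt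
  have := inv_lt_one_of_one_lt₀ h1
  linarith

end

attribute [irreducible] PadicDvd PadicUnit

/-! ### Rearrangements of reciprocals by residue modulo 2 and 4. -/

/-- Doubling 1, …, 2n gives the even numbers up to 4n; those above p = 2n+1 are p plus an odd number
below p. -/
theorem recipSum_two_mul_div (r n : ℕ) :
    recipSum r (2 * n) / 2 ^ r =
      evenRecipSum r n + ∑ b ∈ Finset.range n, 1 / ((2 * (n : ℚ) + 1) + (2 * b + 1)) ^ r := by
  rw [← evenRecipSum_eq, evenRecipSum, two_mul n, Finset.sum_range_add, evenRecipSum]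
  congr 1
  refine Finset.sum_congr rfl fun b _ => ?_
  push_cast
  ring_nf

theorem evenRecipSum_eq_sum_sub (r n : ℕ) :
    evenRecipSum r n = ∑ b ∈ Finset.range n, 1 / ((2 * (n : ℚ) + 1) - (2 * b + 1)) ^ r := by
  rw [evenRecipSum, ← Finset.sum_range_reflect]
  refine Finset.sum_congr rfl fun b hb => ?_
  have := Finset.mem_range.1 hb
  rw [Nat.cast_sub (by omega), Nat.cast_sub (by omega)]
  push_cast
  ring_nf

/-- Among the numbers ≡ 2 mod 4 below 4n, the largest ⌊n/2⌋ are the 4n-2-4i; the others, with the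
multiples of 4, are exactly the even numbers up to 2n. -/
theorem sum_range_four (f : ℕ → ℚ) (n : ℕ) :
    ∑ b ∈ Finset.range n, f (4 * b + 2) + ∑ i ∈ Finset.range (n / 2), f (4 * i + 4) =
      ∑ i ∈ Finset.range (n / 2), f (4 * n - 2 - 4 * i) + ∑ b ∈ Finset.range n, f (2 * b + 2) := by
  rcases Nat.even_or_odd' n with ⟨t, rfl | rfl⟩
  · rw [show 2 * t / 2 = t by omega, sum_range_two_mul (fun b => f (2 * b + 2)), two_mul t,
      Finset.sum_range_add, ← Finset.sum_range_reflect (fun x => f (4 * (t + x) + 2)) t]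
    have h1 : ∑ b ∈ Finset.range t, f (2 * (2 * b) + 2) = ∑ b ∈ Finset.range t, f (4 * b + 2) :=
      Finset.sum_congr rfl fun b _ => by congr 1; ring
    have h2 : ∑ b ∈ Finset.range t, f (2 * (2 * b + 1) + 2) = ∑ b ∈ Finset.range t, f (4 * b + 4) :=
      Finset.sum_congr rfl fun b _ => by congr 1; ring
    have h3 : ∑ j ∈ Finset.range t, f (4 * (t + (t - 1 - j)) + 2) =
        ∑ i ∈ Finset.range t, f (4 * (t + t) - 2 - 4 * i) :=
      Finset.sum_congr rfl fun b hb => by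
        have := Finset.mem_range.1 hb
        congr 1
        omega
    rw [h1, h2, h3]
    ring
  · rw [show (2 * t + 1) / 2 = t by omega, Finset.sum_range_succ (fun b => f (2 * b + 2)),
      sum_range_two_mul (fun b => f (2 * b + 2)), show 2 * t + 1 = t + 1 + t by ring,
      Finset.sum_range_add, Finset.sum_range_succ,
      ← Finset.sum_range_reflect (fun x => f (4 * (t + 1 + x) + 2)) t]
    have h1 : ∑ b ∈ Finset.range t, f (2 * (2 * b) + 2) = ∑ b ∈ Finset.range t, f (4 * b + 2) :=
      Finset.sum_congr rfl fun b _ => by congr 1; ring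
    have h2 : ∑ b ∈ Finset.range t, f (2 * (2 * b + 1) + 2) = ∑ b ∈ Finset.range t, f (4 * b + 4) :=
      Finset.sum_congr rfl fun b _ => by congr 1; ring
    have h3 : ∑ j ∈ Finset.range t, f (4 * (t + 1 + (t - 1 - j)) + 2) =
        ∑ i ∈ Finset.range t, f (4 * (t + 1 + t) - 2 - 4 * i) :=
      Finset.sum_congr rfl fun b hb => by
        have := Finset.mem_range.1 hb
        congr 1
        omega
    rw [h1, h2, h3, show 2 * (2 * t) + 2 = 4 * t + 2 by ring]
    ring

/-- `∑_{i<n/2} 1/(2n-3-4i)^r`. -/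
def quarterRecipSum (r n : ℕ) : ℚ :=
  ∑ i ∈ Finset.range (n / 2), 1 / (2 * (n : ℚ) - 3 - 4 * i) ^ r

theorem sum_quarter_shift {r : ℕ} (hr : Odd r) (n : ℕ) :
    ∑ i ∈ Finset.range (n / 2), (1 / ((2 * (n : ℚ) - 3 - 4 * i) + (2 * n + 1)) ^ r +
      1 / ((2 * (n : ℚ) - 3 - 4 * i) - (2 * n + 1)) ^ r) =
      oddRecipSum r n / 2 ^ r - evenRecipSum r n := by
  have h := sum_range_four (fun b => 1 / (b : ℚ) ^ r) n
  have h1 : ∑ b ∈ Finset.range n, 1 / ((4 * b + 2 : ℕ) : ℚ) ^ r = oddRecipSum r n / 2 ^ r := by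
    rw [oddRecipSum, Finset.sum_div]
    refine Finset.sum_congr rfl fun b _ => ?_
    rw [div_div, ← mul_pow]
    push_cast
    ring_nf
  have h2 : ∑ i ∈ Finset.range (n / 2), 1 / ((4 * i + 4 : ℕ) : ℚ) ^ r =
      -∑ i ∈ Finset.range (n / 2), 1 / ((2 * (n : ℚ) - 3 - 4 * i) - (2 * n + 1)) ^ r := by
    rw [← Finset.sum_neg_distrib]
    refine Finset.sum_congr rfl fun i _ => ?_
    rw [show (2 * (n : ℚ) - 3 - 4 * i) - (2 * n + 1) = -((4 * i + 4 : ℕ) : ℚ) by push_cast; ring,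
      hr.neg_pow, div_neg, neg_neg]
  have h3 : ∑ i ∈ Finset.range (n / 2), 1 / ((4 * n - 2 - 4 * i : ℕ) : ℚ) ^ r =
      ∑ i ∈ Finset.range (n / 2), 1 / ((2 * (n : ℚ) - 3 - 4 * i) + (2 * n + 1)) ^ r := by
    refine Finset.sum_congr rfl fun i hi => ?_
    have := Finset.mem_range.1 hi
    rw [Nat.cast_sub (by omega), Nat.cast_sub (by omega)]
    push_cast
    ring_nf
  have h4 : ∑ b ∈ Finset.range n, 1 / ((2 * b + 2 : ℕ) : ℚ) ^ r = evenRecipSum r n := by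
    rw [evenRecipSum]
    refine Finset.sum_congr rfl fun b _ => ?_
    push_cast
    rfl
  rw [h1, h2, h3, h4] at h
  rw [Finset.sum_add_distrib]
  linear_combination -h

/-! ### Expansions in p with explicit remainders. -/

section

variable {p : ℕ} [hp : Fact p.Prime]

theorem PadicUnit.int_of_lt {z : ℤ} (h0 : z ≠ 0) (h : |z| < p) : PadicUnit p z :=
  PadicUnit.intCast fun hd => h0 (Int.eq_zero_of_abs_lt_dvd hd h)

theorem PadicUnit.odd {n b : ℕ} (hn : 2 * n + 1 = p) (hb : b < n) :
    PadicUnit p (2 * (b : ℚ) + 1) := by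
  have := PadicUnit.int_of_lt (p := p) (z := 2 * b + 1) (by omega) (by rw [abs_of_nonneg] <;> omega)
  exact_mod_cast this

theorem PadicUnit.quarter {n i : ℕ} (hn : 2 * n + 1 = p) (hi : i < n / 2) :
    PadicUnit p (2 * (n : ℚ) - 3 - 4 * i) := by
  have := PadicUnit.int_of_lt (p := p) (z := 2 * n - 3 - 4 * i) (by omega)
    (by rw [abs_of_nonneg] <;> omega)
  exact_mod_cast this

variable {X : ℚ}

theorem PadicDvd.self_mul {x : ℚ} (hx : PadicDvd p 0 x) : PadicDvd p 1 ((p : ℚ) * x) := by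
  have := hx.pow_mul 1
  rwa [pow_one] at this

theorem PadicUnit.add_prime (hX : PadicUnit p X) : PadicUnit p (p + X) := by
  rw [add_comm]
  exact hX.add ((PadicDvd.self_mul PadicDvd.one).of_eq (mul_one _))

theorem PadicUnit.add_prime' (hX : PadicUnit p X) : PadicUnit p (X + p) := by
  rw [add_comm]
  exact hX.add_prime

theorem PadicUnit.sub_prime (hX : PadicUnit p X) : PadicUnit p (X - p) := by
  rw [← neg_sub, sub_eq_add_neg]
  exact hX.neg.add_prime.neg

theorem PadicUnit.prime_sub (hX : PadicUnit p X) : PadicUnit p (p - X) := by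
  rw [sub_eq_add_neg]
  exact hX.neg.add_prime

theorem PadicDvd.ofNat (k : ℕ) [k.AtLeastTwo] : PadicDvd p 0 (OfNat.ofNat k : ℚ) :=
  PadicDvd.natCast k

theorem PadicDvd.mul_zero {x y : ℚ} (hx : PadicDvd p 0 x) (hy : PadicDvd p 0 y) :
    PadicDvd p 0 (x * y) := hx.mul hy

theorem PadicUnit.one_div_add_one_div_sub (hX : PadicUnit p X) :
    PadicDvd p 5 (1 / X + 1 / (p - X) + p * (1 / X ^ 2) + (p : ℚ) ^ 2 * (1 / X ^ 3) + (p : ℚ) ^ 3 * (1 / X ^ 4) +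
      (p : ℚ) ^ 4 * (1 / X ^ 5)) := by
  -- The remainder is p⁵/(X⁵(p-X)). Its numerator 1 is written 3 - 2 because the closure rules below
  -- cover numerals from 2 on.
  have hd : PadicDvd p 0 ((3 : ℚ) - 2) := by
    with_reducible repeat' first
      | exact hX.dvd | exact PadicDvd.natCast _ | exact PadicDvd.ofNat _
      | apply PadicDvd.pow_zero | apply PadicDvd.mul_zero | apply PadicDvd.add | apply PadicDvd.sub
  refine (PadicDvd.pow_mul (((hX.pow 5).mul hX.prime_sub).div_dvd hd) 5).of_eq ?_
  have h1 := hX.ne_zero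
  have h2 := hX.prime_sub.ne_zero
  have h3 := hX.add_prime.ne_zero
  field_simp
  ring

theorem PadicUnit.one_div_sub_add_one_div_add (hX : PadicUnit p X) :
    PadicDvd p 5 (1 / (p - X) + 1 / (p + X) + 2 * p * (1 / X ^ 2) + 2 * (p : ℚ) ^ 3 * (1 / X ^ 4)) := by
  have hd : PadicDvd p 0 ((2 : ℚ)) := by
    with_reducible repeat' first
      | exact hX.dvd | exact PadicDvd.natCast _ | exact PadicDvd.ofNat _
      | apply PadicDvd.pow_zero | apply PadicDvd.mul_zero | apply PadicDvd.add | apply PadicDvd.sub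
  refine (PadicDvd.pow_mul ((((hX.pow 4).mul hX.prime_sub).mul hX.add_prime).div_dvd hd) 5).of_eq ?_
  have h1 := hX.ne_zero
  have h2 := hX.prime_sub.ne_zero
  have h3 := hX.add_prime.ne_zero
  field_simp
  ring

theorem PadicUnit.one_div_sub_cube_add (hX : PadicUnit p X) :
    PadicDvd p 3 (1 / (p - X) ^ 3 + 1 / (p + X) ^ 3 + 6 * p * (1 / X ^ 4)) := by
  have hd : PadicDvd p 0 (20 * X ^ 4 - 18 * (p : ℚ) ^ 2 * X ^ 2 + 6 * (p : ℚ) ^ 4) := by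
    with_reducible repeat' first
      | exact hX.dvd | exact PadicDvd.natCast _ | exact PadicDvd.ofNat _
      | apply PadicDvd.pow_zero | apply PadicDvd.mul_zero | apply PadicDvd.add | apply PadicDvd.sub
  refine (PadicDvd.pow_mul (((((hX.pow 4).mul (hX.prime_sub.pow 3)).mul (hX.add_prime.pow 3))).div_dvd hd) 3).of_eq ?_
  have h1 := hX.ne_zero
  have h2 := hX.prime_sub.ne_zero
  have h3 := hX.add_prime.ne_zero
  field_simp
  ring

theorem PadicUnit.one_div_sub_four_add (hX : PadicUnit p X) :
    PadicDvd p 2 (1 / (p - X) ^ 4 + 1 / (p + X) ^ 4 - 2 * (1 / X ^ 4)) := by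
  have hd : PadicDvd p 0 (2 * (10 * X ^ 6 - 5 * X ^ 4 * (p : ℚ) ^ 2 + 4 * X ^ 2 * (p : ℚ) ^ 4 - (p : ℚ) ^ 6)) := by
    with_reducible repeat' first
      | exact hX.dvd | exact PadicDvd.natCast _ | exact PadicDvd.ofNat _
      | apply PadicDvd.pow_zero | apply PadicDvd.mul_zero | apply PadicDvd.add | apply PadicDvd.sub
  refine (PadicDvd.pow_mul (((((hX.pow 4).mul (hX.prime_sub.pow 4)).mul (hX.add_prime.pow 4))).div_dvd hd) 2).of_eq ?_
  have h1 := hX.ne_zero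
  have h2 := hX.prime_sub.ne_zero
  have h3 := hX.add_prime.ne_zero
  field_simp
  ring

theorem PadicUnit.one_div_sub_four (hX : PadicUnit p X) :
    PadicDvd p 2 (1 / (p - X) ^ 4 - 1 / X ^ 4 - 4 * p * (1 / X ^ 5)) := by
  have hd : PadicDvd p 0 (10 * X ^ 3 - 20 * X ^ 2 * p + 15 * X * (p : ℚ) ^ 2 - 4 * (p : ℚ) ^ 3) := by
    with_reducible repeat' first
      | exact hX.dvd | exact PadicDvd.natCast _ | exact PadicDvd.ofNat _
      | apply PadicDvd.pow_zero | apply PadicDvd.mul_zero | apply PadicDvd.add | apply PadicDvd.sub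
  refine (PadicDvd.pow_mul (((hX.pow 5).mul (hX.prime_sub.pow 4)).div_dvd hd) 2).of_eq ?_
  have h1 := hX.ne_zero
  have h2 := hX.prime_sub.ne_zero
  have h3 := hX.add_prime.ne_zero
  field_simp
  ring

theorem PadicUnit.one_div_sub_five (hX : PadicUnit p X) :
    PadicDvd p 1 (1 / (p - X) ^ 5 + 1 / X ^ 5) := by
  have hd : PadicDvd p 0 ((p : ℚ) ^ 4 - 5 * (p : ℚ) ^ 3 * X + 10 * (p : ℚ) ^ 2 * X ^ 2 - 10 * p * X ^ 3 + 5 * X ^ 4) := by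
    with_reducible repeat' first
      | exact hX.dvd | exact PadicDvd.natCast _ | exact PadicDvd.ofNat _
      | apply PadicDvd.pow_zero | apply PadicDvd.mul_zero | apply PadicDvd.add | apply PadicDvd.sub
  refine (PadicDvd.pow_mul (((hX.pow 5).mul (hX.prime_sub.pow 5)).div_dvd hd) 1).of_eq ?_
  have h1 := hX.ne_zero
  have h2 := hX.prime_sub.ne_zero
  have h3 := hX.add_prime.ne_zero
  field_simp
  ring

theorem PadicUnit.one_div_add_prime_add (hX : PadicUnit p X) :
    PadicDvd p 5 (1 / (X + p) + 1 / (X - p) - 2 * (1 / X) - 2 * (p : ℚ) ^ 2 * (1 / X ^ 3) - 2 * (p : ℚ) ^ 4 * (1 / X ^ 5)) := by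
  have hd : PadicDvd p 0 (2 * (p : ℚ)) := by
    with_reducible repeat' first
      | exact hX.dvd | exact PadicDvd.natCast _ | exact PadicDvd.ofNat _
      | apply PadicDvd.pow_zero | apply PadicDvd.mul_zero | apply PadicDvd.add | apply PadicDvd.sub
  refine (PadicDvd.pow_mul (((((hX.pow 5).mul (hX.sub_prime.pow 1)).mul (hX.add_prime'.pow 1))).div_dvd hd) 5).of_eq ?_
  have h1 := hX.ne_zero
  have h2 := (hX.sub_prime).ne_zero
  have h3 := hX.add_prime'.ne_zero
  field_simp
  ring

theorem PadicUnit.one_div_add_prime_cube_add (hX : PadicUnit p X) :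
    PadicDvd p 3 (1 / (X + p) ^ 3 + 1 / (X - p) ^ 3 - 2 * (1 / X ^ 3) - 12 * (p : ℚ) ^ 2 * (1 / X ^ 5)) := by
  have hd : PadicDvd p 0 (p * (30 * X ^ 4 - 34 * X ^ 2 * (p : ℚ) ^ 2 + 12 * (p : ℚ) ^ 4)) := by
    with_reducible repeat' first
      | exact hX.dvd | exact PadicDvd.natCast _ | exact PadicDvd.ofNat _
      | apply PadicDvd.pow_zero | apply PadicDvd.mul_zero | apply PadicDvd.add | apply PadicDvd.sub
  refine (PadicDvd.pow_mul (((((hX.pow 5).mul (hX.sub_prime.pow 3)).mul (hX.add_prime'.pow 3))).div_dvd hd) 3).of_eq ?_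
  have h1 := hX.ne_zero
  have h2 := (hX.sub_prime).ne_zero
  have h3 := hX.add_prime'.ne_zero
  field_simp
  ring

theorem PadicUnit.one_div_add_prime_five_add (hX : PadicUnit p X) :
    PadicDvd p 1 (1 / (X + p) ^ 5 + 1 / (X - p) ^ 5 - 2 * (1 / X ^ 5)) := by
  have hd : PadicDvd p 0 (p * (30 * X ^ 8 - 10 * X ^ 6 * (p : ℚ) ^ 2 + 20 * X ^ 4 * (p : ℚ) ^ 4 - 10 * X ^ 2 * (p : ℚ) ^ 6 + 2 * (p : ℚ) ^ 8)) := by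
    with_reducible repeat' first
      | exact hX.dvd | exact PadicDvd.natCast _ | exact PadicDvd.ofNat _
      | apply PadicDvd.pow_zero | apply PadicDvd.mul_zero | apply PadicDvd.add | apply PadicDvd.sub
  refine (PadicDvd.pow_mul (((((hX.pow 5).mul (hX.sub_prime.pow 5)).mul (hX.add_prime'.pow 5))).div_dvd hd) 1).of_eq ?_
  have h1 := hX.ne_zero
  have h2 := (hX.sub_prime).ne_zero
  have h3 := hX.add_prime'.ne_zero
  field_simp
  ring

theorem PadicUnit.two_div_three_mul_add (h5 : 5 < p) (hX : PadicUnit p X) :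
    PadicDvd p 5 (2 / (3 * X + p) + 2 / (3 * X - p) - 4 / 3 * (1 / X) - 4 / 27 * (p : ℚ) ^ 2 * (1 / X ^ 3) -
      4 / 243 * (p : ℚ) ^ 4 * (1 / X ^ 5)) := by
  have hp3 := PadicUnit.three h5
  have h3X := hp3.mul hX
  have hd : PadicDvd p 0 (4 * (p : ℚ)) := by
    with_reducible repeat' first
      | exact hX.dvd | exact PadicDvd.natCast _ | exact PadicDvd.ofNat _
      | apply PadicDvd.pow_zero | apply PadicDvd.mul_zero | apply PadicDvd.add | apply PadicDvd.sub
  refine (PadicDvd.pow_mul ((((((hp3.pow 5).mul (hX.pow 5)).mul h3X.sub_prime).mul h3X.add_prime')).div_dvd hd) 5).of_eq ?_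
  have h1 := hX.ne_zero
  have h2 := (h3X.sub_prime).ne_zero
  have h3 := h3X.add_prime'.ne_zero
  field_simp
  ring

end

/-! ### Congruences between harmonic sums. -/

section

variable {p n : ℕ} [hp : Fact p.Prime]

theorem recipSum_one_add (hn : 2 * n + 1 = p) :
    PadicDvd p 5 (recipSum 1 (2 * n) + p * oddRecipSum 2 n + (p : ℚ) ^ 2 * oddRecipSum 3 n +
      (p : ℚ) ^ 3 * oddRecipSum 4 n + (p : ℚ) ^ 4 * oddRecipSum 5 n) := by
  have hP : 2 * (n : ℚ) + 1 = p := by exact_mod_cast hn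
  refine (PadicDvd.sum fun b hb =>
    (PadicUnit.odd hn (Finset.mem_range.1 hb)).one_div_add_one_div_sub).of_eq ?_
  rw [recipSum_two_mul, evenRecipSum_eq_sum_sub, hP]
  simp only [oddRecipSum, Finset.sum_add_distrib, ← Finset.mul_sum, pow_one]

theorem half_recipSum_one_add (hn : 2 * n + 1 = p) :
    PadicDvd p 5 (recipSum 1 (2 * n) / 2 + 2 * p * oddRecipSum 2 n +
      2 * (p : ℚ) ^ 3 * oddRecipSum 4 n) := by
  have hP : 2 * (n : ℚ) + 1 = p := by exact_mod_cast hn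
  refine (PadicDvd.sum fun b hb =>
    (PadicUnit.odd hn (Finset.mem_range.1 hb)).one_div_sub_add_one_div_add).of_eq ?_
  have := recipSum_two_mul_div 1 n
  rw [pow_one] at this
  rw [this, evenRecipSum_eq_sum_sub, hP]
  simp only [oddRecipSum, Finset.sum_add_distrib, ← Finset.mul_sum, pow_one]

theorem recipSum_three_add (hn : 2 * n + 1 = p) :
    PadicDvd p 3 (recipSum 3 (2 * n) / 2 ^ 3 + 6 * p * oddRecipSum 4 n) := by
  have hP : 2 * (n : ℚ) + 1 = p := by exact_mod_cast hn
  refine (PadicDvd.sum fun b hb =>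
    (PadicUnit.odd hn (Finset.mem_range.1 hb)).one_div_sub_cube_add).of_eq ?_
  rw [recipSum_two_mul_div, evenRecipSum_eq_sum_sub, hP]
  simp only [oddRecipSum, Finset.sum_add_distrib, ← Finset.mul_sum]

theorem recipSum_four_sub (hn : 2 * n + 1 = p) :
    PadicDvd p 2 (recipSum 4 (2 * n) / 2 ^ 4 - 2 * oddRecipSum 4 n) := by
  have hP : 2 * (n : ℚ) + 1 = p := by exact_mod_cast hn
  refine (PadicDvd.sum fun b hb =>
    (PadicUnit.odd hn (Finset.mem_range.1 hb)).one_div_sub_four_add).of_eq ?_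
  rw [recipSum_two_mul_div, evenRecipSum_eq_sum_sub, hP]
  simp only [oddRecipSum, Finset.sum_add_distrib, Finset.sum_sub_distrib, ← Finset.mul_sum]

theorem recipSum_four_sub' (hn : 2 * n + 1 = p) :
    PadicDvd p 2 (recipSum 4 (2 * n) - 2 * oddRecipSum 4 n - 4 * p * oddRecipSum 5 n) := by
  have hP : 2 * (n : ℚ) + 1 = p := by exact_mod_cast hn
  refine (PadicDvd.sum fun b hb =>
    (PadicUnit.odd hn (Finset.mem_range.1 hb)).one_div_sub_four).of_eq ?_
  rw [recipSum_two_mul, evenRecipSum_eq_sum_sub, hP]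
  simp only [oddRecipSum, Finset.sum_sub_distrib, ← Finset.mul_sum]
  ring

theorem evenRecipSum_five_add (hn : 2 * n + 1 = p) :
    PadicDvd p 1 (evenRecipSum 5 n + oddRecipSum 5 n) := by
  have hP : 2 * (n : ℚ) + 1 = p := by exact_mod_cast hn
  refine (PadicDvd.sum fun b hb =>
    (PadicUnit.odd hn (Finset.mem_range.1 hb)).one_div_sub_five).of_eq ?_
  rw [evenRecipSum_eq_sum_sub, hP]
  simp only [oddRecipSum, Finset.sum_add_distrib]

theorem quarterRecipSum_one (hn : 2 * n + 1 = p) :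
    PadicDvd p 5 (oddRecipSum 1 n / 2 - evenRecipSum 1 n - 2 * quarterRecipSum 1 n -
      2 * (p : ℚ) ^ 2 * quarterRecipSum 3 n - 2 * (p : ℚ) ^ 4 * quarterRecipSum 5 n) := by
  have hP : 2 * (n : ℚ) + 1 = p := by exact_mod_cast hn
  refine (PadicDvd.sum fun b hb =>
    (PadicUnit.quarter hn (Finset.mem_range.1 hb)).one_div_add_prime_add).of_eq ?_
  have := sum_quarter_shift odd_one n
  rw [hP, pow_one] at this
  rw [← this]
  simp only [quarterRecipSum, Finset.sum_add_distrib, Finset.sum_sub_distrib, ← Finset.mul_sum, pow_one]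

theorem quarterRecipSum_three (hn : 2 * n + 1 = p) :
    PadicDvd p 3 (oddRecipSum 3 n / 2 ^ 3 - evenRecipSum 3 n - 2 * quarterRecipSum 3 n -
      12 * (p : ℚ) ^ 2 * quarterRecipSum 5 n) := by
  have hP : 2 * (n : ℚ) + 1 = p := by exact_mod_cast hn
  refine (PadicDvd.sum fun b hb =>
    (PadicUnit.quarter hn (Finset.mem_range.1 hb)).one_div_add_prime_cube_add).of_eq ?_
  rw [← sum_quarter_shift (by decide : Odd 3) n, hP]
  simp only [quarterRecipSum, Finset.sum_add_distrib, Finset.sum_sub_distrib, ← Finset.mul_sum]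

theorem quarterRecipSum_five (hn : 2 * n + 1 = p) :
    PadicDvd p 1 (oddRecipSum 5 n / 2 ^ 5 - evenRecipSum 5 n - 2 * quarterRecipSum 5 n) := by
  have hP : 2 * (n : ℚ) + 1 = p := by exact_mod_cast hn
  refine (PadicDvd.sum fun b hb =>
    (PadicUnit.quarter hn (Finset.mem_range.1 hb)).one_div_add_prime_five_add).of_eq ?_
  rw [← sum_quarter_shift (by decide : Odd 5) n, hP]
  simp only [quarterRecipSum, Finset.sum_add_distrib, Finset.sum_sub_distrib, ← Finset.mul_sum]

theorem sum_two_div_three_mul (h5 : 5 < p) (hn : 2 * n + 1 = p) :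
    PadicDvd p 5 (∑ i ∈ Finset.range (n / 2), (2 / (3 * (2 * n - 3 - 4 * (i : ℚ)) + (2 * n + 1)) +
          2 / (3 * (2 * n - 3 - 4 * (i : ℚ)) - (2 * n + 1))) - 4 / 3 * quarterRecipSum 1 n -
      4 / 27 * (p : ℚ) ^ 2 * quarterRecipSum 3 n - 4 / 243 * (p : ℚ) ^ 4 * quarterRecipSum 5 n) := by
  have hP : 2 * (n : ℚ) + 1 = p := by exact_mod_cast hn
  refine (PadicDvd.sum fun b hb =>
    (PadicUnit.quarter hn (Finset.mem_range.1 hb)).two_div_three_mul_add h5).of_eq ?_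
  rw [hP]
  simp only [quarterRecipSum, Finset.sum_add_distrib, Finset.sum_sub_distrib, ← Finset.mul_sum, pow_one]

theorem padicDvd_oddRecipSum (hn : 2 * n + 1 = p) (r : ℕ) : PadicDvd p 0 (oddRecipSum r n) :=
  PadicDvd.sum fun _ hb => ((PadicUnit.odd hn (Finset.mem_range.1 hb)).pow r).one_div

end

section

variable {p n : ℕ} [hp : Fact p.Prime]

theorem PadicDvd.rat_mul (h5 : 5 < p) {e : ℕ} {x : ℚ} (q : ℚ) (hx : PadicDvd p e x)
    (hq : q.den ∣ 30 ^ 5) : PadicDvd p e (q * x) :=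
  hx.mul_left (PadicDvd.rat h5 5 hq)

/-- The two expansions give H_{p-1}(4) ≡ 32 O_4 and H_{p-1}(4) ≡ 2 O_4 + 4p O_5 mod p²; subtracting,
30 O_4 ≡ 4p O_5. -/
theorem oddRecipSum_four_sub (h5 : 5 < p) (hn : 2 * n + 1 = p) :
    PadicDvd p 2 (oddRecipSum 4 n - 2 / 15 * p * oddRecipSum 5 n) := by
  have h1 := recipSum_four_sub hn
  have h2 := recipSum_four_sub' hn
  refine ((h2.rat_mul h5 (1 / 30) (by norm_num)).sub (h1.rat_mul h5 (16 / 30) (by norm_num))).of_eq ?_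
  ring

theorem oddRecipSum_two_add (h5 : 5 < p) (hn : 2 * n + 1 = p) :
    PadicDvd p 4 (oddRecipSum 2 n + recipSum 1 (2 * n) / (4 * p) + (p : ℚ) ^ 2 * oddRecipSum 4 n) := by
  have hp0 : (p : ℚ) ≠ 0 := by exact_mod_cast hp.out.ne_zero
  apply PadicDvd.of_pow_mul (k := 1)
  refine ((half_recipSum_one_add hn).rat_mul h5 (1 / 2) (by norm_num)).of_eq ?_
  field_simp
  ring

/-- Half of the expansion of H/2 removes both O_2 and O_4 from the expansion of H. -/
theorem oddRecipSum_three_add (h5 : 5 < p) (hn : 2 * n + 1 = p) :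
    PadicDvd p 5 ((p : ℚ) ^ 2 * oddRecipSum 3 n + 3 / 4 * recipSum 1 (2 * n) +
      (p : ℚ) ^ 4 * oddRecipSum 5 n) := by
  refine ((recipSum_one_add hn).sub
    ((half_recipSum_one_add hn).rat_mul h5 (1 / 2) (by norm_num))).of_eq ?_
  ring

theorem padicDvd_oddRecipSum_two (h5 : 5 < p) (hn : 2 * n + 1 = p) :
    PadicDvd p 1 (oddRecipSum 2 n) := by
  apply PadicDvd.of_pow_mul (k := 1)
  have h1 := ((half_recipSum_one_add hn).rat_mul h5 2 (by norm_num)).sub (recipSum_one_add hn)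
  have h2 := (padicDvd_oddRecipSum hn 3).pow_mul 2
  have h3 := ((padicDvd_oddRecipSum hn 4).pow_mul 3).mono (show 2 ≤ 3 by norm_num)
  have h4 := ((padicDvd_oddRecipSum hn 5).pow_mul 4).mono (show 2 ≤ 4 by norm_num)
  have h6 := (((h1.mono (show 2 ≤ 5 by norm_num)).add h2).sub
    (h3.rat_mul h5 3 (by norm_num))).add h4
  refine (h6.rat_mul h5 (1 / 3) (by norm_num)).of_eq ?_
  ring

/-- The multipliers are forced by elimination: 2/3, 16/27 and 704/243 remove the quarter sums of
orders 1, 3 and 5, and the remaining ones remove H_{p-1}(3), the even sum of order 5, O_4 and O_3,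
leaving H and O_5. -/
theorem logDerivSum_combination (h5 : 5 < p) (hn : 2 * n + 1 = p) :
    PadicDvd p 5 (logDerivSum ℚ n + 1 / (2 * n + 1) - (2 * n + 1) * pairSum ℚ n (n - 1) -
      recipSum 1 (2 * n) / 6 - 56 / 405 * (p : ℚ) ^ 4 * oddRecipSum 5 n) := by
  rw [logDerivSum_eq n (by omega)]
  have S := sum_two_div_three_mul h5 hn
  have q1 := quarterRecipSum_one hn
  have q3 := (quarterRecipSum_three hn).pow_mul' 2
  have q5 := (quarterRecipSum_five hn).pow_mul' 4
  have e5 := (evenRecipSum_five_add hn).pow_mul' 4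
  have h3 := (recipSum_three_add hn).pow_mul' 2
  have h4 := (oddRecipSum_four_sub h5 hn).pow_mul' 3
  have b := oddRecipSum_three_add h5 hn
  have r1 := recipSum_two_mul 1 n
  have r3 := recipSum_two_mul 3 n
  have re := evenRecipSum_eq 1 n
  refine ((((((((q1.rat_mul h5 (2 / 3) (by norm_num)).sub S).sub
    (q3.rat_mul h5 (16 / 27) (by norm_num))).add
    (q5.rat_mul h5 (704 / 243) (by norm_num))).add
    (e5.rat_mul h5 (704 / 243) (by norm_num))).sub
    (h3.rat_mul h5 (128 / 27) (by norm_num))).add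
    (h4.rat_mul h5 (256 / 9) (by norm_num))).add
    (b.rat_mul h5 (2 / 3) (by norm_num))).of_eq ?_
  linear_combination (-1 / 3 : ℚ) * r1 + (-16 / 27 : ℚ) * (p : ℚ) ^ 2 * r3 - re

end

/-! ### Power sums and the Bernoulli number. -/

section

variable {p n : ℕ} [hp : Fact p.Prime]

/-- `∑_{b<n} (2b+1)^k`. -/
def oddPowSum (k n : ℕ) : ℚ := ∑ b ∈ Finset.range n, (2 * (b : ℚ) + 1) ^ k

theorem PadicUnit.pow_card_sub_one {z : ℤ} (h : PadicUnit p z) :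
    PadicDvd p 1 ((z : ℚ) ^ (p - 1) - 1) := by
  have hz : ¬ (p : ℤ) ∣ z := by
    rw [← padicNorm.int_eq_one_iff]
    unfold PadicUnit at h
    exact h
  have hcop : IsCoprime z (p : ℤ) := by
    rw [isCoprime_comm, Prime.coprime_iff_not_dvd (Nat.prime_iff_prime_int.1 hp.out)]
    exact hz
  obtain ⟨c, hc⟩ := (Int.ModEq.pow_card_sub_one_eq_one hp.out hcop).symm.dvd
  have : (z : ℚ) ^ (p - 1) - 1 = p * (c : ℚ) := by exact_mod_cast hc
  rw [this]
  exact PadicDvd.self_mul (PadicDvd.intCast c)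

theorem PadicUnit.recip_sub_pow {z : ℤ} {r : ℕ} (h : PadicUnit p z) (hr : r ≤ p - 1) :
    PadicDvd p 1 (1 / (z : ℚ) ^ r - (z : ℚ) ^ (p - 1 - r)) := by
  refine (((h.pow r).div_dvd h.pow_card_sub_one).neg).of_eq ?_
  have := h.ne_zero
  rw [← pow_sub_mul_pow (z : ℚ) hr]
  field_simp
  ring

theorem padicDvd_sum_pow {k : ℕ} (hk : k < p - 1) :
    PadicDvd p 1 (∑ a ∈ Finset.range p, (a : ℚ) ^ k) := by
  have h : ((∑ a ∈ Finset.range p, (a : ℤ) ^ k : ℤ) : ZMod p) = 0 := by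
    have h1 := FiniteField.sum_pow_lt_card_sub_one (ZMod p) k (by rwa [ZMod.card])
    rw [← h1]
    push_cast
    refine Finset.sum_bij (fun a _ => (a : ZMod p)) (fun _ _ => Finset.mem_univ _) ?_ ?_ (fun _ _ => rfl)
    · intro a ha b hb hab
      have := (ZMod.natCast_eq_natCast_iff' a b p).1 hab
      rwa [Nat.mod_eq_of_lt (Finset.mem_range.1 ha), Nat.mod_eq_of_lt (Finset.mem_range.1 hb)] at this
    · intro x _
      exact ⟨x.val, Finset.mem_range.2 x.val_lt, ZMod.natCast_zmod_val x⟩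
  rw [ZMod.intCast_zmod_eq_zero_iff_dvd] at h
  obtain ⟨c, hc⟩ := h
  have : ∑ a ∈ Finset.range p, (a : ℚ) ^ k = p * (c : ℚ) := by exact_mod_cast hc
  rw [this]
  exact PadicDvd.self_mul (PadicDvd.intCast c)

theorem sum_range_pow_eq_odd_add (hn : 2 * n + 1 = p) {k : ℕ} (hk : 0 < k) :
    ∑ a ∈ Finset.range p, (a : ℚ) ^ k =
      oddPowSum k n + ∑ b ∈ Finset.range n, ((p : ℚ) - (2 * b + 1)) ^ k := by
  have hP : 2 * (n : ℚ) + 1 = p := by exact_mod_cast hn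
  rw [← hP, ← hn, Finset.sum_range_succ', Nat.cast_zero, zero_pow hk.ne', add_zero,
    sum_range_two_mul (fun a => ((a + 1 : ℕ) : ℚ) ^ k), oddPowSum,
    ← Finset.sum_range_reflect (fun b => ((2 * (n : ℚ) + 1) - (2 * (b : ℚ) + 1)) ^ k)]
  congr 1
  · exact Finset.sum_congr rfl fun b _ => by push_cast; ring
  · refine Finset.sum_congr rfl fun b hb => ?_
    have := Finset.mem_range.1 hb
    rw [Nat.cast_sub (by omega), Nat.cast_sub (by omega)]
    push_cast
    ring

theorem two_pow_mul_sum_range_pow (hn : 2 * n + 1 = p) {k : ℕ} (hk : 0 < k) :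
    2 ^ k * ∑ a ∈ Finset.range p, (a : ℚ) ^ k =
      ∑ b ∈ Finset.range n, ((p : ℚ) - (2 * b + 1)) ^ k +
        ∑ b ∈ Finset.range n, ((p : ℚ) + (2 * b + 1)) ^ k := by
  have hP : 2 * (n : ℚ) + 1 = p := by exact_mod_cast hn
  rw [← hP, ← hn, Finset.sum_range_succ', Nat.cast_zero, zero_pow hk.ne', add_zero,
    two_mul n, Finset.sum_range_add, mul_add, ← Finset.sum_range_reflect, Finset.mul_sum,
    Finset.mul_sum]
  congr 1
  · refine Finset.sum_congr rfl fun b hb => ?_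
    have := Finset.mem_range.1 hb
    rw [Nat.cast_add, Nat.cast_sub (by omega), Nat.cast_sub (by omega), ← mul_pow]
    push_cast
    ring
  · refine Finset.sum_congr rfl fun b _ => ?_
    rw [← mul_pow]
    push_cast
    ring

theorem PadicDvd.add_pow_sub {x s : ℚ} (hx : PadicDvd p 0 x) (hs : PadicDvd p 1 s) (m : ℕ) :
    PadicDvd p 2 ((x + s) ^ (m + 1) - x ^ (m + 1) - (m + 1) * s * x ^ m) := by
  induction m with
  | zero => exact PadicDvd.zero.of_eq (by simp)
  | succ m ih =>
    have h1 := ih.mul_right (hx.add (hs.mono zero_le_one))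
    have h2 := (hs.mul hs).mul_right ((PadicDvd.natCast (m + 1)).mul_zero (hx.pow_zero m))
    refine (h1.add h2).of_eq ?_
    push_cast
    ring

theorem padicDvd_oddPowSum (k : ℕ) : PadicDvd p 0 (oddPowSum k n) := by
  refine PadicDvd.sum fun b _ => ?_
  have := PadicDvd.natCast (p := p) ((2 * b + 1) ^ k)
  exact_mod_cast this

theorem sum_prime_sub_pow (m : ℕ) (hm : Odd m) :
    PadicDvd p 2 (∑ b ∈ Finset.range n, ((p : ℚ) - (2 * b + 1)) ^ (m + 1) - oddPowSum (m + 1) n +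
      (m + 1) * p * oddPowSum m n) := by
  have h : ∀ b ∈ Finset.range n, PadicDvd p 2 ((-(2 * (b : ℚ) + 1) + p) ^ (m + 1) -
      (-(2 * (b : ℚ) + 1)) ^ (m + 1) - (m + 1) * p * (-(2 * (b : ℚ) + 1)) ^ m) := fun b _ =>
    PadicDvd.add_pow_sub (by exact_mod_cast (PadicDvd.natCast (p := p) (2 * b + 1)).neg)
      ((PadicDvd.self_mul PadicDvd.one).of_eq (mul_one _)) m
  refine (PadicDvd.sum h).of_eq ?_
  simp only [hm.neg_pow, hm.add_one.neg_pow, oddPowSum, Finset.sum_sub_distrib, mul_neg,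
    sub_neg_eq_add, Finset.sum_add_distrib, ← Finset.mul_sum]
  simp only [neg_add_eq_sub]

theorem sum_prime_add_pow (m : ℕ) :
    PadicDvd p 2 (∑ b ∈ Finset.range n, ((p : ℚ) + (2 * b + 1)) ^ (m + 1) - oddPowSum (m + 1) n -
      (m + 1) * p * oddPowSum m n) := by
  have h : ∀ b ∈ Finset.range n, PadicDvd p 2 (((2 * (b : ℚ) + 1) + p) ^ (m + 1) -
      (2 * (b : ℚ) + 1) ^ (m + 1) - (m + 1) * p * (2 * (b : ℚ) + 1) ^ m) := fun b _ =>
    PadicDvd.add_pow_sub (by exact_mod_cast (PadicDvd.natCast (p := p) (2 * b + 1)))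
      ((PadicDvd.self_mul PadicDvd.one).of_eq (mul_one _)) m
  refine (PadicDvd.sum h).of_eq ?_
  simp only [oddPowSum, Finset.sum_sub_distrib, ← Finset.mul_sum]
  simp only [add_comm (p : ℚ)]

/-- The defining recurrence divides only by integers k - j + 1 ≤ k + 1 < p. -/
theorem padicDvd_bernoulli' {k : ℕ} (hk : k + 1 < p) : PadicDvd p 0 (bernoulli' k) := by
  induction k using Nat.strong_induction_on with
  | _ k ih =>
    rw [bernoulli'_def]
    refine PadicDvd.one.sub (PadicDvd.sum fun j hj => ?_)
    have hj' := Finset.mem_range.1 hj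
    refine PadicDvd.mul_zero (PadicUnit.div_dvd ?_ (PadicDvd.natCast _)) (ih j hj' (by omega))
    have := PadicUnit.natCast (p := p) (z := k - j + 1) (Nat.not_dvd_of_pos_of_lt (by omega) (by omega))
    rwa [Nat.cast_add, Nat.cast_sub hj'.le, Nat.cast_one] at this

theorem padicDvd_bernoulli {k : ℕ} (hk : k + 1 < p) : PadicDvd p 0 (bernoulli k) := by
  rw [bernoulli]
  exact ((PadicDvd.intCast (-1)).of_eq (by simp) |>.pow_zero k).mul_zero (padicDvd_bernoulli' hk)

/-- In Faulhaber's formula every term except the linear one carries p², and the coefficients are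
p-integral. -/
theorem sum_range_pow_sub_bernoulli {m : ℕ} (hm : m + 1 < p) :
    PadicDvd p 2 (∑ a ∈ Finset.range p, (a : ℚ) ^ m - p * bernoulli m) := by
  have hU : PadicUnit p ((m : ℚ) + 1) := by
    have := PadicUnit.natCast (p := p) (z := m + 1) (Nat.not_dvd_of_pos_of_lt (by omega) hm)
    exact_mod_cast this
  rw [sum_range_pow, Finset.sum_range_succ]
  have e : bernoulli m * ((m + 1).choose m : ℚ) * (p : ℚ) ^ (m + 1 - m) / (m + 1) = p * bernoulli m := by
    have := hU.ne_zero
    rw [Nat.choose_succ_self_right, Nat.add_sub_cancel_left]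
    push_cast
    field_simp
  rw [e, add_sub_cancel_right]
  refine PadicDvd.sum fun i hi => hU.div_dvd ?_
  have hi' := Finset.mem_range.1 hi
  exact ((PadicDvd.prime_pow (m + 1 - i)).mono (by omega)).mul_left
    ((padicDvd_bernoulli (by omega)).mul_zero (PadicDvd.natCast _))

/-- By Fermat O_5 ≡ ∑ X^m with m = p - 6. Splitting S = ∑ a^{m+1} by parity, and 2^{m+1}S by size
relative to p, gives (2^{m+1} - 1)S ≡ (m+1)p ∑ X^m mod p². With S ≡ pB_{p-5} and 2^{p-5} ≡ 1/16 this
reads -(15/16)B_{p-5} ≡ -5 O_5 mod p. -/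
theorem oddRecipSum_five_sub_bernoulli (h5 : 5 < p) (hn : 2 * n + 1 = p) :
    PadicDvd p 1 (oddRecipSum 5 n - 3 / 16 * bernoulli (p - 5)) := by
  obtain ⟨m, hm⟩ : ∃ m, m + 6 = p := ⟨p - 6, by omega⟩
  have hodd : Odd m := ⟨n - 3, by omega⟩
  have hmp : (m : ℚ) + 6 = p := by exact_mod_cast hm
  have hS := sum_range_pow_eq_odd_add hn (Nat.succ_pos m)
  have hT := two_pow_mul_sum_range_pow hn (Nat.succ_pos m)
  have h1 := sum_prime_sub_pow (p := p) (n := n) m hodd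
  have h2 := sum_prime_add_pow (p := p) (n := n) m
  have hB := sum_range_pow_sub_bernoulli (p := p) (m := m + 1) (by omega)
  have hQ : PadicDvd p 1 (oddRecipSum 5 n - oddPowSum m n) := by
    refine (PadicDvd.sum (s := Finset.range n) fun b hb => PadicUnit.recip_sub_pow (z := 2 * b + 1) (r := 5)
      (by exact_mod_cast PadicUnit.odd hn (Finset.mem_range.1 hb)) (by omega)).of_eq ?_
    rw [Finset.sum_sub_distrib, oddRecipSum, oddPowSum, show p - 1 - 5 = m by omega]
    push_cast
    rfl
  have hF : PadicDvd p 1 (2 ^ 4 * 2 ^ (m + 1) - 1) := by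
    have := PadicUnit.pow_card_sub_one (p := p) (z := 2) (by exact_mod_cast PadicUnit.two h5)
    rw [show p - 1 = 4 + (m + 1) by omega, pow_add] at this
    exact_mod_cast this
  rw [show p - 5 = m + 1 by omega]
  have hBi := padicDvd_bernoulli (p := p) (k := m + 1) (by omega)
  have hQi := padicDvd_oddPowSum (p := p) (n := n) m
  have key : PadicDvd p 1 ((2 ^ (m + 1) - 1) * bernoulli (m + 1) - (m + 1) * oddPowSum m n) := by
    apply PadicDvd.of_pow_mul (k := 1)
    have h2i : PadicDvd p 0 ((2 : ℚ) ^ (m + 1) - 1) := ((PadicDvd.ofNat 2).pow_zero _).sub PadicDvd.one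
    refine ((h2.add (hB.mul_left h2i).neg)).of_eq ?_
    simp only [Nat.succ_eq_add_one] at hS hT
    linear_combination hS - hT
  have hfin := (((key.mul_left (PadicDvd.ofNat 16)).sub (hF.mul_right hBi)).add
    ((PadicDvd.self_mul hQi).mul_left (PadicDvd.ofNat 16))).rat_mul h5 (1 / 80) (by norm_num)
  refine (hQ.add hfin).of_eq ?_
  rw [← hmp]
  ring

end

/-! ### The alternating sum modulo p⁴. -/

section

variable {p n : ℕ} [hp : Fact p.Prime]

theorem PadicDvd.prod_sub_one {e : ℕ} {g : ℕ → ℚ} {N : ℕ}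
    (h : ∀ j < N, PadicDvd p e (g j - 1)) :
    PadicDvd p e (∏ j ∈ Finset.range N, g j - 1) := by
  induction N with
  | zero => simpa using PadicDvd.zero
  | succ N ih =>
    rw [Finset.prod_range_succ]
    have h1 := ih fun j hj => h j (by omega)
    have h2 := h N (by omega)
    refine ((h1.mul_right ((h2.mono (Nat.zero_le e)).add PadicDvd.one)).add h2).of_eq ?_
    ring

/-- Each factor is 1 + p²z - p⁴z²/4 mod p⁶. The coefficient of p⁴ is the second elementary symmetric
function (S₁² - S₂)/2 minus S₂/4, for the power sums S₁, S₂ of the z_j. -/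
theorem padicDvd_prod_quotient (h5 : 5 < p) {z : ℕ → ℚ} {N : ℕ} (hz : ∀ j < N, PadicDvd p 0 (z j)) :
    PadicDvd p 6 (∏ j ∈ Finset.range N, ((1 + (p : ℚ) ^ 2 * z j) / (1 + (p : ℚ) ^ 4 * z j ^ 2 / 4)) -
      1 - (p : ℚ) ^ 2 * ∑ j ∈ Finset.range N, z j - (p : ℚ) ^ 4 * (1 / 2 * (∑ j ∈ Finset.range N, z j) ^ 2 -
        3 / 4 * ∑ j ∈ Finset.range N, z j ^ 2)) := by
  have hP : PadicDvd p 0 (p : ℚ) := PadicDvd.natCast p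
  have hU : ∀ j < N, PadicUnit p (1 + (p : ℚ) ^ 4 * z j ^ 2 / 4) := fun j hj => by
    refine PadicUnit.add (by unfold PadicUnit; simp) ?_
    refine ((((hz j hj).pow_zero 2).rat_mul h5 (1 / 4) (by norm_num)).pow_mul 4 |>.mono
      (show 1 ≤ 4 by norm_num)).of_eq ?_
    ring
  induction N with
  | zero => exact PadicDvd.zero.of_eq (by simp)
  | succ N ih =>
    have ih' := ih (fun j hj => hz j (by omega)) fun j hj => hU j (by omega)
    have hzN := hz N (by omega)
    have hUN := hU N (by omega)
    have hS1 : PadicDvd p 0 (∑ j ∈ Finset.range N, z j) :=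
      PadicDvd.sum fun j hj => hz j (by have := Finset.mem_range.1 hj; omega)
    have hS2 : PadicDvd p 0 (∑ j ∈ Finset.range N, z j ^ 2) :=
      PadicDvd.sum fun j hj => (hz j (by have := Finset.mem_range.1 hj; omega)).pow_zero 2
    rw [Finset.prod_range_succ, Finset.sum_range_succ, Finset.sum_range_succ]
    generalize ∏ j ∈ Finset.range N, ((1 + (p : ℚ) ^ 2 * z j) / (1 + (p : ℚ) ^ 4 * z j ^ 2 / 4)) = Q at *
    generalize ∑ j ∈ Finset.range N, z j ^ 2 = S2 at *
    generalize ∑ j ∈ Finset.range N, z j = S1 at *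
    generalize z N = w at *
    have hq : PadicDvd p 0 ((1 + (p : ℚ) ^ 2 * w) / (1 + (p : ℚ) ^ 4 * w ^ 2 / 4)) :=
      hUN.div_dvd (PadicDvd.one.add ((hP.pow_zero 2).mul_zero hzN))
    have c2 := PadicDvd.rat h5 5 (q := 1 / 2) (by norm_num)
    have c4 := PadicDvd.rat h5 5 (q := 1 / 4) (by norm_num)
    have c34 := PadicDvd.rat h5 5 (q := 3 / 4) (by norm_num)
    -- the quotient modulo `p ^ 6`
    have hr : PadicDvd p 6 ((1 + (p : ℚ) ^ 2 * w) / (1 + (p : ℚ) ^ 4 * w ^ 2 / 4) -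
        1 - (p : ℚ) ^ 2 * w + (p : ℚ) ^ 4 * (1 / 4 * w ^ 2)) := by
      have hd : PadicDvd p 0 ((-(1 / 4)) * w ^ 3 + 1 / 4 * (1 / 4 * (p : ℚ) ^ 2 * w ^ 4)) :=
        (c4.neg.mul_zero (hzN.pow_zero 3)).add
          (c4.mul_zero ((c4.mul_zero (hP.pow_zero 2)).mul_zero (hzN.pow_zero 4)))
      refine ((hUN.div_dvd hd).pow_mul 6).of_eq ?_
      have := hUN.ne_zero
      rw [eq_comm, ← sub_eq_zero]
      have h4 : 4 + (p : ℚ) ^ 4 * w ^ 2 ≠ 0 := by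
        intro h0
        apply this
        linear_combination (1 / 4 : ℚ) * h0
      field_simp
      ring
    have hT : PadicDvd p 0 (1 / 2 * S1 ^ 2 - 3 / 4 * S2) :=
      (c2.mul_zero (hS1.pow_zero 2)).sub (c34.mul_zero hS2)
    have hW : PadicDvd p 0 (1 + (p : ℚ) ^ 2 * S1 + (p : ℚ) ^ 4 * (1 / 2 * S1 ^ 2 - 3 / 4 * S2)) :=
      (PadicDvd.one.add ((hP.pow_zero 2).mul_zero hS1)).add ((hP.pow_zero 4).mul_zero hT)
    have hE : PadicDvd p 0 (w * (1 / 2 * S1 ^ 2 - 3 / 4 * S2) - S1 * (1 / 4 * w ^ 2) -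
        (p : ℚ) ^ 2 * ((1 / 2 * S1 ^ 2 - 3 / 4 * S2) * (1 / 4 * w ^ 2))) :=
      ((hzN.mul_zero hT).sub (hS1.mul_zero (c4.mul_zero (hzN.pow_zero 2)))).sub
        ((hP.pow_zero 2).mul_zero (hT.mul_zero (c4.mul_zero (hzN.pow_zero 2))))
    refine (((ih'.mul_right hq).add (hr.mul_left hW)).add (hE.pow_mul 6)).of_eq ?_
    ring

theorem padicDvd_centralBinom_div (h5 : 5 < p) (k : ℕ) :
    PadicDvd p 0 ((Nat.choose (2 * k) k : ℚ) / 16 ^ k) := by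
  have h16 : PadicUnit p 16 := by
    have := (PadicUnit.two h5).pow 4
    norm_num at this
    exact this
  exact (h16.pow k).div_dvd (PadicDvd.natCast _)

theorem sum_alternating_sub_quartic (h5 : 5 < p) (hn : 2 * n + 1 = p) :
    PadicDvd p 4 (∑ k ∈ Finset.range n,
        (Nat.choose (2 * k) k : ℚ) / ((-16 : ℚ) ^ k * (2 * (k : ℚ) + 1) ^ 2) -
      ∑ k ∈ Finset.range n, (-1 : ℚ) ^ k * ((Nat.choose (2 * k) k : ℚ) / 16 ^ k) *
      (∏ j ∈ Finset.range k, (((2 * (j : ℚ) + 1) ^ 4 - (2 * (n : ℚ) + 1) ^ 4) /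
        ((2 * (j : ℚ) + 1) ^ 4 + (2 * (n : ℚ) + 1) ^ 4 / 4))) *
      ((2 * (k : ℚ) + 1) ^ 2 / ((2 * (k : ℚ) + 1) ^ 4 + (2 * (n : ℚ) + 1) ^ 4 / 4))) := by
  have hP : 2 * (n : ℚ) + 1 = p := by exact_mod_cast hn
  rw [← Finset.sum_sub_distrib, hP]
  have c4 := PadicDvd.rat h5 5 (q := 1 / 4) (by norm_num)
  have c54 := PadicDvd.rat h5 5 (q := 5 / 4) (by norm_num)
  have hU : ∀ j < n, PadicUnit p ((2 * (j : ℚ) + 1) ^ 4 + (p : ℚ) ^ 4 / 4) := fun j hj =>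
    ((PadicUnit.odd hn hj).pow 4).add (((c4.pow_mul 4).mono (show 1 ≤ 4 by norm_num)).of_eq (by ring))
  refine PadicDvd.sum fun k hk => ?_
  have hk' := Finset.mem_range.1 hk
  have hA : PadicDvd p 4 (∏ j ∈ Finset.range k, (((2 * (j : ℚ) + 1) ^ 4 - (p : ℚ) ^ 4) /
        ((2 * (j : ℚ) + 1) ^ 4 + (p : ℚ) ^ 4 / 4)) - 1) := by
    refine PadicDvd.prod_sub_one fun j hj => ?_
    have hj' := hU j (by omega)
    refine (((hj'.div_dvd c54).pow_mul 4).neg).of_eq ?_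
    have := hj'.ne_zero
    rw [div_sub_one this]
    ring
  have hX := PadicUnit.odd hn hk'
  have hUk := hU k hk'
  have hB : PadicDvd p 4 ((2 * (k : ℚ) + 1) ^ 2 / ((2 * (k : ℚ) + 1) ^ 4 + (p : ℚ) ^ 4 / 4) -
      1 / (2 * (k : ℚ) + 1) ^ 2) := by
    refine (((((hX.pow 2).mul hUk).div_dvd c4).pow_mul 4).neg).of_eq ?_
    have h1 := hX.ne_zero
    have h2 := hUk.ne_zero
    rw [div_sub_div _ _ h2 (pow_ne_zero 2 h1), mul_comm ((2 * (k : ℚ) + 1) ^ 2)]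
    ring
  have hw := ((PadicDvd.one.neg (p := p)).pow_zero k).mul_zero (padicDvd_centralBinom_div h5 k)
  have hC : PadicDvd p 0 ((2 * (k : ℚ) + 1) ^ 2 / ((2 * (k : ℚ) + 1) ^ 4 + (p : ℚ) ^ 4 / 4)) :=
    hUk.div_dvd (hX.dvd.pow_zero 2)
  refine (((hA.mul_right hC).add hB).mul_left hw).neg.of_eq ?_
  rw [show (-16 : ℚ) = (-1) * 16 by norm_num, mul_pow]
  have hs : (-1 : ℚ) ^ k * (-1) ^ k = 1 := by rw [← mul_pow]; simp
  have hs0 : (-1 : ℚ) ^ k ≠ 0 := pow_ne_zero _ (by norm_num)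
  have h16 : (16 : ℚ) ^ k ≠ 0 := pow_ne_zero _ (by norm_num)
  have h1 := hX.ne_zero
  have e : (Nat.choose (2 * k) k : ℚ) / ((-1) ^ k * 16 ^ k * (2 * (k : ℚ) + 1) ^ 2) =
      (-1) ^ k * ((Nat.choose (2 * k) k : ℚ) / 16 ^ k) * (1 / (2 * (k : ℚ) + 1) ^ 2) := by
    rw [div_eq_iff (by positivity)]
    generalize 2 * (k : ℚ) + 1 = X at *
    field_simp
    linear_combination (-1 : ℚ) * (Nat.choose (2 * k) k : ℚ) * hs
  rw [e]
  ring

theorem alternating_sum_congr (h5 : 5 < p) (hn : 2 * n + 1 = p) :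
    PadicDvd p 4 (∑ k ∈ Finset.range n,
        (Nat.choose (2 * k) k : ℚ) / ((-16 : ℚ) ^ k * (2 * (k : ℚ) + 1) ^ 2) -
      (recipSum 1 (2 * n) / (5 * p) + 7 / 200 * (p : ℚ) ^ 3 * bernoulli (p - 5))) := by
  have hp0 : (p : ℚ) ≠ 0 := by exact_mod_cast hp.out.ne_zero
  have hP : 2 * (n : ℚ) + 1 = p := by exact_mod_cast hn
  have h1 := sum_alternating_sub_quartic h5 hn
  have h2 := sum_truncated_quartic n
  rw [hP] at h1 h2
  have h3 := padicDvd_prod_quotient h5 (N := n) (z := fun j => 1 / (2 * (j : ℚ) + 1) ^ 2)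
    fun j hj => ((PadicUnit.odd hn hj).pow 2).one_div
  have e1 : ∏ j ∈ Finset.range n, ((1 + (p : ℚ) ^ 2 / (2 * (j : ℚ) + 1) ^ 2) /
      (1 + (p : ℚ) ^ 4 / (4 * (2 * (j : ℚ) + 1) ^ 4))) =
      ∏ j ∈ Finset.range n, ((1 + (p : ℚ) ^ 2 * (1 / (2 * (j : ℚ) + 1) ^ 2)) /
      (1 + (p : ℚ) ^ 4 * (1 / (2 * (j : ℚ) + 1) ^ 2) ^ 2 / 4)) := by
    refine Finset.prod_congr rfl fun j _ => ?_
    have hX : 2 * (j : ℚ) + 1 ≠ 0 := two_mul_add_one_ne j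
    generalize 2 * (j : ℚ) + 1 = X at *
    congr 1
    · ring
    · field_simp
  have e2 : ∑ j ∈ Finset.range n, (1 / (2 * (j : ℚ) + 1) ^ 2) ^ 2 = oddRecipSum 4 n :=
    Finset.sum_congr rfl fun j _ => by rw [div_pow, one_pow, ← pow_mul]
  rw [e1] at h2
  simp only [e2] at h3
  rw [show ∑ j ∈ Finset.range n, 1 / (2 * (j : ℚ) + 1) ^ 2 = oddRecipSum 2 n from rfl] at h3
  generalize ∏ j ∈ Finset.range n, ((1 + (p : ℚ) ^ 2 * (1 / (2 * (j : ℚ) + 1) ^ 2)) /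
      (1 + (p : ℚ) ^ 4 * (1 / (2 * (j : ℚ) + 1) ^ 2) ^ 2 / 4)) = Q at *
  generalize ∑ k ∈ Finset.range n, (-1 : ℚ) ^ k * ((Nat.choose (2 * k) k : ℚ) / 16 ^ k) *
      (∏ j ∈ Finset.range k, (((2 * (j : ℚ) + 1) ^ 4 - (p : ℚ) ^ 4) /
        ((2 * (j : ℚ) + 1) ^ 4 + (p : ℚ) ^ 4 / 4))) *
      ((2 * (k : ℚ) + 1) ^ 2 / ((2 * (k : ℚ) + 1) ^ 4 + (p : ℚ) ^ 4 / 4)) = A at *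
  have hO2 := padicDvd_oddRecipSum_two h5 hn
  have g1 : PadicDvd p 4 (5 * A + 4 * oddRecipSum 2 n - 3 * (p : ℚ) ^ 2 * oddRecipSum 4 n) := by
    -- Since p divides O_2, the term p²O_2² is negligible modulo p⁴.
    have hsq := ((hO2.mul hO2).pow_mul' 2).rat_mul h5 (-2) (by norm_num)
    have h3' : PadicDvd p 4 (4 / (p : ℚ) ^ 2 * (1 - Q) + 4 * oddRecipSum 2 n +
        (p : ℚ) ^ 2 * (2 * (oddRecipSum 2 n) ^ 2 - 3 * oddRecipSum 4 n)) := by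
      apply PadicDvd.of_pow_mul (k := 2)
      refine (h3.rat_mul h5 (-4) (by norm_num)).of_eq ?_
      field_simp
      ring
    refine (h3'.add hsq).of_eq ?_
    rw [h2]
    ring
  have g2 := oddRecipSum_two_add h5 hn
  have g3 := (oddRecipSum_four_sub h5 hn).pow_mul' 2
  have g4 := (oddRecipSum_five_sub_bernoulli h5 hn).pow_mul' 3
  -- From 5A ≡ -4 O_2 + 3p²O_4 ≡ H/p + 7p²O_4, the final constant is 7/5 · 2/15 · 3/16 = 7/200.
  refine ((((h1.add (g1.rat_mul h5 (1 / 5) (by norm_num))).sub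
    (g2.rat_mul h5 (4 / 5) (by norm_num))).add (g3.rat_mul h5 (7 / 5) (by norm_num))).add
    (g4.rat_mul h5 (14 / 75) (by norm_num))).of_eq ?_
  have e3 : recipSum 1 (2 * n) / (5 * p) = 4 / 5 * (recipSum 1 (2 * n) / (4 * p)) := by
    field_simp
  rw [e3]
  ring

end

/-! ### Values of T at odd squares and its coefficient of x². -/

/-- `∑_{k≤m} (-1)^k C(m+k,2k)`. -/
def evenAlternatingSum (m : ℕ) : ℚ :=
  ∑ k ∈ Finset.range (m + 1), (-1) ^ k * (Nat.choose (m + k) (2 * k) : ℚ)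

/-- `∑_{k≤m} (-1)^k C(m+k,2k+1)`. -/
def oddAlternatingSum (m : ℕ) : ℚ :=
  ∑ k ∈ Finset.range (m + 1), (-1) ^ k * (Nat.choose (m + k) (2 * k + 1) : ℚ)

theorem oddAlternatingSum_succ (m : ℕ) :
    oddAlternatingSum (m + 1) = oddAlternatingSum m + evenAlternatingSum m := by
  rw [oddAlternatingSum, Finset.sum_range_succ, Nat.choose_eq_zero_of_lt (by omega), Nat.cast_zero,
    mul_zero, add_zero, oddAlternatingSum, evenAlternatingSum, ← Finset.sum_add_distrib]
  refine Finset.sum_congr rfl fun k _ => ?_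
  rw [show m + 1 + k = (m + k) + 1 by ring, Nat.choose_succ_succ]
  push_cast
  ring

theorem evenAlternatingSum_succ (m : ℕ) :
    evenAlternatingSum (m + 1) = -oddAlternatingSum m := by
  have h : evenAlternatingSum (m + 1) = evenAlternatingSum m - oddAlternatingSum (m + 1) := by
    have e : ∀ k ∈ Finset.range (m + 1), (-1 : ℚ) ^ (k + 1) *
        (Nat.choose (m + 1 + (k + 1)) (2 * (k + 1)) : ℚ) =
        (-1) ^ (k + 1) * (Nat.choose (m + (k + 1)) (2 * (k + 1)) : ℚ) -
          (-1) ^ k * (Nat.choose (m + 1 + k) (2 * k + 1) : ℚ) := fun k _ => by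
      rw [show m + 1 + (k + 1) = (m + (k + 1)) + 1 by ring, show 2 * (k + 1) = (2 * k + 1) + 1 by ring,
        Nat.choose_succ_succ, show m + (k + 1) = m + 1 + k by ring]
      push_cast
      ring
    rw [evenAlternatingSum, Finset.sum_range_succ', Finset.sum_congr rfl e, Finset.sum_sub_distrib,
      oddAlternatingSum, Finset.sum_range_succ (fun k => (-1 : ℚ) ^ k *
        (Nat.choose (m + 1 + k) (2 * k + 1) : ℚ)) (m + 1),
      Nat.choose_eq_zero_of_lt (by omega : m + 1 + (m + 1) < 2 * (m + 1) + 1)]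
    have e2 : evenAlternatingSum m = ∑ k ∈ Finset.range (m + 1), (-1 : ℚ) ^ (k + 1) *
        (Nat.choose (m + (k + 1)) (2 * (k + 1)) : ℚ) + 1 := by
      rw [Finset.sum_range_succ, Nat.choose_eq_zero_of_lt (by omega), Nat.cast_zero,
        mul_zero, add_zero, evenAlternatingSum, Finset.sum_range_succ']
      simp
    rw [e2]
    simp
    ring
  rw [h, oddAlternatingSum_succ]
  ring

/-- The values `(2m+1) ∑_k C(2k,k)/(16^k(2k+1)) ∏_{j<k} (1 - (2m+1)²/(2j+1)²)`, i.e.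
`2 sin((2m+1)π/6)`. -/
def twoSin (m : ℕ) : ℚ := (-1) ^ m * (if m % 3 = 1 then -2 else 1)

/-- By Pascal's rule the pair (E, O) of alternating sums evolves as (E, O) ↦ (-O, E + O), whose cube
is -1; three initial values suffice. -/
theorem evenAlternatingSum_add (m : ℕ) :
    evenAlternatingSum m + 2 * oddAlternatingSum m = twoSin m := by
  induction m using Nat.strong_induction_on with
  | _ m ih =>
    match m, ih with
    | 0, _ => simp [evenAlternatingSum, oddAlternatingSum, twoSin]
    | 1, _ => simp [evenAlternatingSum, oddAlternatingSum, twoSin, Finset.sum_range_succ]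
    | 2, _ =>
      simp [evenAlternatingSum_succ, oddAlternatingSum_succ, twoSin]
      norm_num [evenAlternatingSum, oddAlternatingSum]
    | m + 3, ih =>
      have h := ih m (by omega)
      have e : twoSin (m + 3) = -twoSin m := by
        rw [twoSin, twoSin, Nat.add_mod_right]
        ring
      rw [e, ← h]
      simp only [evenAlternatingSum_succ, oddAlternatingSum_succ]
      ring

/-- Terms with k > m vanish. In the others 2m+1 = (2k+1) + 2(m-k) turns (2m+1)C(m+k,2k)/(2k+1) into
C(m+k,2k) + 2C(m+k,2k+1). -/
theorem sum_weightPoly_eval_odd {n m : ℕ} (hm : m < n) :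
    (2 * (m : ℚ) + 1) * ∑ k ∈ Finset.range n, (weightPoly ℚ k).eval ((2 * (m : ℚ) + 1) ^ 2) =
      twoSin m := by
  rw [← evenAlternatingSum_add, evenAlternatingSum, oddAlternatingSum, Finset.mul_sum,
    Finset.mul_sum, ← Finset.sum_add_distrib]
  symm
  have hsub : Finset.range (m + 1) ⊆ Finset.range n := by
    intro x hx
    rw [Finset.mem_range] at *
    omega
  rw [← Finset.sum_subset hsub]
  · refine Finset.sum_congr rfl fun k hk => ?_
    have hk' : k ≤ m := by rw [Finset.mem_range] at hk; omega
    rw [weightPoly_eval_odd ℚ m k hk']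
    have h1 : 2 * (k : ℚ) + 1 ≠ 0 := two_mul_add_one_ne k
    have e1' : (Nat.choose (m + k) (2 * k + 1) : ℚ) * (2 * k + 1) =
        (Nat.choose (m + k) (2 * k) : ℚ) * (m - k) := by
      have : ((m + k - 2 * k : ℕ) : ℚ) = m - k := by
        rw [Nat.cast_sub (by omega)]; push_cast; ring
      rw [← this]; exact_mod_cast Nat.choose_succ_right_eq (m + k) (2 * k)
    rw [mul_div_assoc', eq_div_iff h1]
    linear_combination 2 * (-1 : ℚ) ^ k * e1'
  · intro k _ hk
    rw [Finset.mem_range, not_lt] at hk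
    rw [weightPoly_eval]
    have : ∏ j ∈ Finset.range k, (1 - (2 * (m : ℚ) + 1) ^ 2 / (2 * (j : ℚ) + 1) ^ 2) = 0 := by
      refine Finset.prod_eq_zero (Finset.mem_range.2 hk) ?_
      rw [div_self (pow_ne_zero 2 (two_mul_add_one_ne m)), sub_self]
    rw [this, mul_zero, mul_zero]

section

variable {p n : ℕ} [hp : Fact p.Prime]

open Polynomial

/-- All coefficients of `P` are `p`-integral. -/
def PadicIntegralPoly (p : ℕ) (P : ℚ[X]) : Prop := ∀ i, PadicDvd p 0 (P.coeff i)

theorem PadicIntegralPoly.mul {P Q : ℚ[X]} (hP : PadicIntegralPoly p P)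
    (hQ : PadicIntegralPoly p Q) : PadicIntegralPoly p (P * Q) := fun i => by
  rw [coeff_mul]
  exact PadicDvd.sum fun x _ => (hP _).mul_zero (hQ _)

theorem PadicIntegralPoly.C {a : ℚ} (ha : PadicDvd p 0 a) : PadicIntegralPoly p (C a) := fun i => by
  rw [coeff_C]
  split_ifs
  exacts [ha, PadicDvd.zero]

theorem PadicIntegralPoly.sum {g : ℕ → ℚ[X]} {s : Finset ℕ} (h : ∀ k ∈ s, PadicIntegralPoly p (g k)) :
    PadicIntegralPoly p (∑ k ∈ s, g k) := fun i => by
  rw [finsetSum_coeff]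
  exact PadicDvd.sum fun k hk => h k hk i

theorem PadicIntegralPoly.prod {g : ℕ → ℚ[X]} {s : Finset ℕ} (h : ∀ k ∈ s, PadicIntegralPoly p (g k)) :
    PadicIntegralPoly p (∏ k ∈ s, g k) := by
  induction s using Finset.induction_on with
  | empty => simpa using PadicIntegralPoly.C (p := p) PadicDvd.one
  | insert a s ha ih =>
    rw [Finset.prod_insert ha]
    exact (h a (by simp)).mul (ih fun i hi => h i (by simp [hi]))

theorem padicIntegralPoly_weightPoly (h5 : 5 < p) (hn : 2 * n + 1 = p) {k : ℕ} (hk : k < n) :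
    PadicIntegralPoly p (weightPoly ℚ k) := by
  refine (PadicIntegralPoly.C ?_).mul (PadicIntegralPoly.prod fun j hj i => ?_)
  · rw [centralWeight, ← div_div]
    exact (PadicUnit.odd hn hk).div_dvd (padicDvd_centralBinom_div h5 k)
  · have hj' := Finset.mem_range.1 hj
    rw [coeff_sub]
    refine PadicDvd.sub ?_ ?_
    · rw [coeff_one]
      split_ifs
      exacts [PadicDvd.one, PadicDvd.zero]
    · rw [coeff_C_mul, coeff_X]
      refine PadicDvd.mul_zero ((PadicUnit.odd hn (by omega)).pow 2).one_div ?_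
      split_ifs
      exacts [PadicDvd.one, PadicDvd.zero]

theorem natDegree_weightPoly_le (k : ℕ) : (weightPoly ℚ k).natDegree ≤ k := by
  refine (natDegree_C_mul_le _ _).trans ((natDegree_prod_le _ _).trans ?_)
  refine (Finset.sum_le_sum (g := fun _ => 1) fun j _ => ?_).trans (by simp)
  refine (natDegree_sub_le _ _).trans ?_
  simp only [natDegree_one, zero_le, sup_of_le_right]
  exact (natDegree_C_mul_le _ _).trans natDegree_X_le

/-- `∑_{k<n} C(2k,k)/(16^k(2k+1)) ∏_{j<k} (1 - X/(2j+1)²)`. -/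
noncomputable def truncatedPoly (n : ℕ) : ℚ[X] := ∑ k ∈ Finset.range n, weightPoly ℚ k

theorem padicIntegralPoly_truncatedPoly (h5 : 5 < p) (hn : 2 * n + 1 = p) :
    PadicIntegralPoly p (truncatedPoly n) :=
  PadicIntegralPoly.sum fun _ hk => padicIntegralPoly_weightPoly h5 hn (Finset.mem_range.1 hk)

theorem natDegree_truncatedPoly_lt (hn : 0 < n) : (truncatedPoly n).natDegree < n := by
  rw [truncatedPoly]
  refine lt_of_le_of_lt (natDegree_sum_le_of_forall_le (n := n - 1) _ _ fun k hk => ?_) (by omega)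
  have := Finset.mem_range.1 hk
  exact (natDegree_weightPoly_le k).trans (by omega)

/-- For an even exponent X and p - X contribute equally mod p, so twice this sum is the full power
sum, which vanishes mod p below exponent p - 1. -/
theorem padicDvd_oddPowSum_even (h5 : 5 < p) (hn : 2 * n + 1 = p) {k : ℕ} (hk : k + 2 < p - 1) (hkE : Even k) :
    PadicDvd p 1 (oddPowSum (k + 2) n) := by
  have h1 := padicDvd_sum_pow hk
  rw [sum_range_pow_eq_odd_add hn (by omega)] at h1
  have h2 := (sum_prime_sub_pow (p := p) (n := n) (k + 1) hkE.add_one).mono (show 1 ≤ 2 by norm_num)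
  have h3 := PadicDvd.self_mul ((PadicDvd.natCast (p := p) (k + 1 + 1)).mul_zero
    (padicDvd_oddPowSum (p := p) (n := n) (k + 1)))
  refine (((h1.sub h2).add h3).rat_mul h5 (1 / 2) (by norm_num)).of_eq ?_
  push_cast
  ring

/-- Summing T(x)x^{-2} over the nodes x = (2m+1)² gives ∑_i c_i ∑ x^{i-2}. Every inner power sum
vanishes mod p except i = 2, which gives n ≡ -1/2; hence the factor 2. -/
theorem coeff_two_truncatedPoly (h5 : 5 < p) (hn : 2 * n + 1 = p) :
    PadicDvd p 1 ((truncatedPoly n).coeff 2 +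
      2 * ∑ m ∈ Finset.range n, twoSin m / (2 * (m : ℚ) + 1) ^ 5) := by
  have hP : 2 * (n : ℚ) + 1 = p := by exact_mod_cast hn
  have hint := padicIntegralPoly_truncatedPoly h5 hn
  have hsum : ∑ m ∈ Finset.range n, twoSin m / (2 * (m : ℚ) + 1) ^ 5 =
      ∑ i ∈ Finset.range n, (truncatedPoly n).coeff i *
        ∑ m ∈ Finset.range n, (2 * (m : ℚ) + 1) ^ (2 * i) / (2 * (m : ℚ) + 1) ^ 4 := by
    simp only [Finset.mul_sum]
    rw [Finset.sum_comm]
    refine Finset.sum_congr rfl fun m hm => ?_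
    rw [← sum_weightPoly_eval_odd (Finset.mem_range.1 hm), ← eval_finsetSum, ← truncatedPoly,
      eval_eq_sum_range' (natDegree_truncatedPoly_lt (by omega : 0 < n)), Finset.mul_sum,
      Finset.sum_div]
    refine Finset.sum_congr rfl fun i _ => ?_
    have hX : 2 * (m : ℚ) + 1 ≠ 0 := two_mul_add_one_ne m
    generalize 2 * (m : ℚ) + 1 = X at *
    rw [← pow_mul]
    field_simp
  have hJ : ∀ i ∈ Finset.range n, PadicDvd p 1 ((truncatedPoly n).coeff i *
      (∑ m ∈ Finset.range n, (2 * (m : ℚ) + 1) ^ (2 * i) / (2 * (m : ℚ) + 1) ^ 4 -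
        if i = 2 then (n : ℚ) else 0)) := fun i hi => by
    have hi' := Finset.mem_range.1 hi
    refine PadicDvd.mul_left ?_ (hint i)
    match i, hi' with
    | 0, _ =>
      have h2 := (PadicDvd.self_mul (padicDvd_oddRecipSum hn 5)).rat_mul h5 (2 / 15) (by norm_num)
      refine (((oddRecipSum_four_sub h5 hn).mono one_le_two).add h2).of_eq ?_
      simp [oddRecipSum]
      ring
    | 1, _ =>
      refine (padicDvd_oddRecipSum_two h5 hn).of_eq ?_
      rw [if_neg (by norm_num), sub_zero]
      refine Finset.sum_congr rfl fun m _ => ?_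
      have hX : 2 * (m : ℚ) + 1 ≠ 0 := two_mul_add_one_ne m
      field_simp
    | 2, _ =>
      refine PadicDvd.zero.of_eq ?_
      rw [if_pos rfl, Finset.sum_congr rfl fun m _ => div_self (pow_ne_zero 4 (two_mul_add_one_ne m))]
      simp
    | i + 3, hi3 =>
      refine (padicDvd_oddPowSum_even h5 hn (k := 2 * i) (by omega) (even_two_mul i)).of_eq ?_
      rw [if_neg (by omega), sub_zero]
      refine Finset.sum_congr rfl fun m _ => ?_
      have hX : 2 * (m : ℚ) + 1 ≠ 0 := two_mul_add_one_ne m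
      generalize 2 * (m : ℚ) + 1 = X at *
      field_simp
      ring
  have h2n : 2 < n := by omega
  have hfin := (PadicDvd.sum hJ).rat_mul h5 2 (by norm_num)
  have hf2 := PadicDvd.self_mul (hint 2)
  refine (hf2.add hfin).of_eq ?_
  simp only [mul_sub, Finset.sum_sub_distrib, mul_ite, mul_zero]
  rw [← hsum, Finset.sum_ite_eq' (Finset.range n) 2, if_pos (Finset.mem_range.2 h2n), ← hP]
  ring

end

/-! ### The signed fifth-power sum via multiplication by 3. -/

/-- `(-1)^b / (2b+1)^5`. -/
def signedRecip (b : ℕ) : ℚ := (-1) ^ b / (2 * (b : ℚ) + 1) ^ 5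

theorem sum_range_three_mul (f : ℕ → ℚ) (e : ℕ) :
    ∑ b ∈ Finset.range (3 * e), f b = ∑ c ∈ Finset.range e, f (3 * c) +
      ∑ c ∈ Finset.range e, f (3 * c + 1) + ∑ c ∈ Finset.range e, f (3 * c + 2) := by
  induction e with
  | zero => simp
  | succ e ih =>
    rw [show 3 * (e + 1) = 3 * e + 1 + 1 + 1 by ring]
    simp only [Finset.sum_range_succ]
    rw [ih]
    ring

/-- After multiplication by (-1)^n the positive terms are those with 2b+1 = 2n-3, 2n-7, …, which
form the quarter sum; the signed sum is twice these minus everything. -/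
theorem sum_signedRecip_eq : ∀ n : ℕ,
    (-1) ^ n * ∑ b ∈ Finset.range n, signedRecip b = 2 * quarterRecipSum 5 n - oddRecipSum 5 n
  | 0 => by simp [quarterRecipSum, oddRecipSum]
  | 1 => by simp [quarterRecipSum, oddRecipSum, signedRecip]
  | n + 2 => by
    have ih := sum_signedRecip_eq n
    have hq : quarterRecipSum 5 (n + 2) = quarterRecipSum 5 n + 1 / (2 * (n : ℚ) + 1) ^ 5 := by
      rw [quarterRecipSum, show (n + 2) / 2 = n / 2 + 1 by omega, Finset.sum_range_succ',
        quarterRecipSum]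
      congr 1
      · refine Finset.sum_congr rfl fun i _ => ?_
        push_cast
        ring_nf
      · push_cast
        ring_nf
    have hs : (-1 : ℚ) ^ n * (-1) ^ n = 1 := by rw [← mul_pow]; simp
    rw [hq, oddRecipSum, Finset.sum_range_succ, Finset.sum_range_succ, Finset.sum_range_succ,
      Finset.sum_range_succ, ← oddRecipSum, signedRecip, signedRecip]
    push_cast
    linear_combination ih + hs * (1 / (2 * (n : ℚ) + 1) ^ 5 - 1 / (2 * ((n : ℚ) + 1) + 1) ^ 5)

theorem signedRecip_three_mul_add_one (b : ℕ) :
    signedRecip (3 * b + 1) = -(1 / 243) * signedRecip b := by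
  rw [signedRecip, signedRecip]
  have h : 2 * (b : ℚ) + 1 ≠ 0 := two_mul_add_one_ne b
  rw [show (2 * ((3 * b + 1 : ℕ) : ℚ) + 1) = 3 * (2 * b + 1) by push_cast; ring,
    show (-1 : ℚ) ^ (3 * b + 1) = -(-1) ^ b by rw [pow_succ, pow_mul]; norm_num]
  field_simp
  norm_num

section

variable {p n : ℕ} [hp : Fact p.Prime]

theorem PadicUnit.one_div_five_add {x y : ℚ} (hx : PadicUnit p x) (hy : PadicUnit p y)
    (h : PadicDvd p 1 (x + y)) : PadicDvd p 1 (1 / x ^ 5 + 1 / y ^ 5) := by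
  have hd : PadicDvd p 0 (x ^ 4 - x ^ 3 * y + x ^ 2 * y ^ 2 - x * y ^ 3 + y ^ 4) := by
    have := hx.dvd
    have := hy.dvd
    with_reducible repeat' first
      | assumption | apply PadicDvd.pow_zero | apply PadicDvd.mul_zero | apply PadicDvd.add
      | apply PadicDvd.sub
  refine (((hx.pow 5).mul (hy.pow 5)).div_dvd (h.mul_right hd)).of_eq ?_
  have h1 := hx.ne_zero
  have h2 := hy.ne_zero
  field_simp
  ring

theorem signedRecip_add_reflect (h5 : 5 < p) (hn : 2 * n + 1 = p) {b c : ℕ} (hb : b < n) (hc : c < n)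
    (h : 3 * b + 1 + c = 2 * n) : PadicDvd p 1 (signedRecip (3 * b + 1) + signedRecip c) := by
  have hP : 2 * (n : ℚ) + 1 = p := by exact_mod_cast hn
  have hx := (PadicUnit.three h5).mul (PadicUnit.odd hn hb)
  have hy := PadicUnit.odd hn hc
  have hh : 3 * (b : ℚ) + 1 + c = 2 * n := by exact_mod_cast h
  have hxy : PadicDvd p 1 (3 * (2 * (b : ℚ) + 1) + (2 * c + 1)) := by
    refine (PadicDvd.self_mul (PadicDvd.ofNat 2)).of_eq ?_
    linear_combination (-2 : ℚ) * hP - 2 * hh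
  refine ((hx.one_div_five_add hy hxy).mul_left (PadicDvd.one.neg.pow_zero c)).of_eq ?_
  have hs : (-1 : ℚ) ^ (3 * b + 1) = (-1) ^ c := by
    have h1 : (-1 : ℚ) ^ (3 * b + 1) * (-1) ^ c = 1 := by rw [← pow_add, h, pow_mul]; simp
    have h2 : (-1 : ℚ) ^ c * (-1) ^ c = 1 := by rw [← mul_pow]; simp
    linear_combination (-1 : ℚ) ^ c * h1 - (-1 : ℚ) ^ (3 * b + 1) * h2
  rw [signedRecip, signedRecip, hs, show (2 * ((3 * b + 1 : ℕ) : ℚ) + 1) = 3 * (2 * b + 1) by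
    push_cast; ring]
  ring

theorem signedRecip_add_shift (h5 : 5 < p) (hn : 2 * n + 1 = p) {b c : ℕ} (hb : b < n) (hc : c < n)
    (h : 3 * b = 2 * n + c) : PadicDvd p 1 (signedRecip (3 * b + 1) + signedRecip c) := by
  have hP : 2 * (n : ℚ) + 1 = p := by exact_mod_cast hn
  have hx := (PadicUnit.three h5).mul (PadicUnit.odd hn hb)
  have hy := (PadicUnit.odd hn hc).neg
  have hh : 3 * (b : ℚ) = 2 * n + c := by exact_mod_cast h
  have hxy : PadicDvd p 1 (3 * (2 * (b : ℚ) + 1) + -(2 * c + 1)) := by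
    refine (PadicDvd.self_mul (PadicDvd.ofNat 2)).of_eq ?_
    linear_combination (-2 : ℚ) * hP - 2 * hh
  refine ((hx.one_div_five_add hy hxy).mul_left (PadicDvd.one.neg.pow_zero c)).neg.of_eq ?_
  have hs : (-1 : ℚ) ^ (3 * b + 1) = -(-1) ^ c := by
    rw [h, pow_succ, pow_add, pow_mul]
    simp
  rw [signedRecip, signedRecip, hs, show (2 * ((3 * b + 1 : ℕ) : ℚ) + 1) = 3 * (2 * b + 1) by
    push_cast; ring, (by decide : Odd 5).neg_pow, div_neg]
  ring

/-- The numbers 3(2b+1) are odd and below 3p. Those below p have index ≡ 1 mod 3; those in (p, 2p)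
are reflected to 2p - x and those in (2p, 3p) shifted to x - 2p, each time reversing the sign of the
term. As 3 ∤ p, these cover the other two residue classes exactly once. -/
theorem sum_signedRecip_three_mul (h5 : 5 < p) (hn : 2 * n + 1 = p) :
    PadicDvd p 1 (∑ b ∈ Finset.range n, signedRecip (3 * b + 1) -
      2 * ∑ b ∈ Finset.range n, (if b % 3 = 1 then signedRecip b else 0) +
      ∑ b ∈ Finset.range n, signedRecip b) := by
  have h3 : n % 3 ≠ 1 := fun h => by
    have : 3 ∣ p := by omega
    have := (Nat.prime_dvd_prime_iff_eq Nat.prime_three hp.out).1 this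
    omega
  obtain ⟨e, rfl | rfl⟩ : ∃ e, n = 3 * e ∨ n = 3 * e + 2 := ⟨n / 3, by omega⟩
  · rw [sum_range_three_mul (fun b => if b % 3 = 1 then signedRecip b else 0),
      sum_range_three_mul signedRecip]
    have s0 : ∀ c : ℕ, ¬ (3 * c) % 3 = 1 := fun c => by omega
    have s1 : ∀ c : ℕ, (3 * c + 1) % 3 = 1 := fun c => by omega
    have s2 : ∀ c : ℕ, ¬ (3 * c + 2) % 3 = 1 := fun c => by omega
    simp only [s0, s1, s2, if_true, if_false, Finset.sum_const_zero]
    rw [show 3 * e = e + e + e by ring, Finset.sum_range_add, Finset.sum_range_add,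
      ← Finset.sum_range_reflect (fun c => signedRecip (3 * c + 2))]
    have a1 : PadicDvd p 1 (∑ c ∈ Finset.range e,
        (signedRecip (3 * (e + c) + 1) + signedRecip (3 * (e - 1 - c) + 2))) :=
      PadicDvd.sum fun c hc => by
        have := Finset.mem_range.1 hc
        exact signedRecip_add_reflect h5 hn (by omega) (by omega) (by omega)
    have a2 : PadicDvd p 1 (∑ c ∈ Finset.range e,
        (signedRecip (3 * (e + e + c) + 1) + signedRecip (3 * c))) :=
      PadicDvd.sum fun c hc => by
        have := Finset.mem_range.1 hc
        exact signedRecip_add_shift h5 hn (by omega) (by omega) (by omega)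
    rw [Finset.sum_add_distrib] at a1 a2
    refine (a1.add a2).of_eq ?_
    ring
  · rw [Finset.sum_range_succ (fun b => if b % 3 = 1 then signedRecip b else 0),
      Finset.sum_range_succ (fun b => if b % 3 = 1 then signedRecip b else 0),
      Finset.sum_range_succ signedRecip, Finset.sum_range_succ signedRecip,
      sum_range_three_mul (fun b => if b % 3 = 1 then signedRecip b else 0),
      sum_range_three_mul signedRecip]
    have s0 : ∀ c : ℕ, ¬ (3 * c) % 3 = 1 := fun c => by omega
    have s1 : ∀ c : ℕ, (3 * c + 1) % 3 = 1 := fun c => by omega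
    have s2 : ∀ c : ℕ, ¬ (3 * c + 2) % 3 = 1 := fun c => by omega
    simp only [s0, s1, s2, if_true, if_false, Finset.sum_const_zero]
    rw [show 3 * e + 2 = e + 1 + (e + 1) + e by ring, Finset.sum_range_add, Finset.sum_range_add]
    have a1 : PadicDvd p 1 (∑ c ∈ Finset.range (e + 1),
        (signedRecip (3 * (e + 1 + c) + 1) + signedRecip (3 * (e + 1 - 1 - c)))) :=
      PadicDvd.sum fun c hc => by
        have := Finset.mem_range.1 hc
        exact signedRecip_add_reflect h5 hn (by omega) (by omega) (by omega)
    have a2 : PadicDvd p 1 (∑ c ∈ Finset.range e,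
        (signedRecip (3 * (e + 1 + (e + 1) + c) + 1) + signedRecip (3 * c + 2))) :=
      PadicDvd.sum fun c hc => by
        have := Finset.mem_range.1 hc
        exact signedRecip_add_shift h5 hn (by omega) (by omega) (by omega)
    rw [Finset.sum_add_distrib] at a1 a2
    rw [Finset.sum_range_reflect (fun c => signedRecip (3 * c))] at a1
    refine (a1.add a2).of_eq ?_
    rw [Finset.sum_range_succ (fun c => signedRecip (3 * c)),
      Finset.sum_range_succ (fun c => signedRecip (3 * c + 1)) e]
    ring

/-- Let S be the signed sum and S₁ its part over b ≡ 1 mod 3. Tripling gives -S/243 ≡ 2S₁ - S, so S₁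
≡ (121/243)S and c₂ ≡ -2(S - 3S₁) ≡ (80/81)S. Finally (-1)^n S ≡ O_5/32, whence 5/162. -/
theorem coeff_two_truncatedPoly_oddRecipSum (h5 : 5 < p) (hn : 2 * n + 1 = p) :
    PadicDvd p 1 ((truncatedPoly n).coeff 2 - (-1) ^ n * (5 / 162 * oddRecipSum 5 n)) := by
  have h1 := coeff_two_truncatedPoly h5 hn
  have h2 := sum_signedRecip_three_mul h5 hn
  have h3 := sum_signedRecip_eq n
  have h4 := (quarterRecipSum_five hn).add (evenRecipSum_five_add hn)
  have e1 : ∑ m ∈ Finset.range n, twoSin m / (2 * (m : ℚ) + 1) ^ 5 =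
      ∑ b ∈ Finset.range n, signedRecip b -
        3 * ∑ b ∈ Finset.range n, (if b % 3 = 1 then signedRecip b else 0) := by
    rw [Finset.mul_sum, ← Finset.sum_sub_distrib]
    refine Finset.sum_congr rfl fun m _ => ?_
    rw [twoSin, signedRecip]
    split_ifs <;> ring
  have e2 : ∑ b ∈ Finset.range n, signedRecip (3 * b + 1) =
      -(1 / 243) * ∑ b ∈ Finset.range n, signedRecip b := by
    rw [Finset.mul_sum]
    exact Finset.sum_congr rfl fun b _ => signedRecip_three_mul_add_one b
  have hs : (-1 : ℚ) ^ n * (-1) ^ n = 1 := by rw [← mul_pow]; simp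
  rw [e1] at h1
  rw [e2] at h2
  have h4' := (h4.mul_left ((PadicDvd.one.neg (p := p)).pow_zero n)).rat_mul h5 (80 / 81) (by norm_num)
  refine ((h1.sub (h2.rat_mul h5 3 (by norm_num))).sub h4').of_eq ?_
  linear_combination (-80 / 81 : ℚ) * (-1) ^ n * h3 +
    (80 / 81 : ℚ) * hs * ∑ b ∈ Finset.range n, signedRecip b

end

/-! ### Taylor expansion at p² and conclusion. -/

open Polynomial in
theorem weightPoly_real_eval (k : ℕ) (x : ℚ) :
    (weightPoly ℝ k).eval (x : ℝ) = (((weightPoly ℚ k).eval x : ℚ) : ℝ) := by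
  rw [← weightPoly_map]
  exact eval_map_apply (algebraMap ℚ ℝ) x

open Polynomial in
theorem weightPoly_real_derivative_eval (k : ℕ) (x : ℚ) :
    (derivative (weightPoly ℝ k)).eval (x : ℝ) = (((derivative (weightPoly ℚ k)).eval x : ℚ) : ℝ) := by
  rw [← weightPoly_map, derivative_map]
  exact eval_map_apply (algebraMap ℚ ℝ) x

theorem pairSum_cast (n k : ℕ) : pairSum ℝ n k = ((pairSum ℚ n k : ℚ) : ℝ) := by
  simp [pairSum]

theorem logDerivSum_cast (n : ℕ) : logDerivSum ℝ n = ((logDerivSum ℚ n : ℚ) : ℝ) := by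
  simp [logDerivSum]

open Polynomial in
/-- The relation between the values of `truncatedPoly n` and its derivative at `(2n+1)²`. -/
theorem truncatedPoly_derivative_eval {n : ℕ} (hn : 2 ≤ n) (h3 : n % 3 ≠ 1) :
    (truncatedPoly n).eval ((2 * (n : ℚ) + 1) ^ 2) = 0 ∧
    2 * (2 * (n : ℚ) + 1) ^ 2 * (derivative (truncatedPoly n)).eval ((2 * (n : ℚ) + 1) ^ 2) =
      -((-1) ^ n * (logDerivSum ℚ n + 1 / (2 * n + 1) - (2 * n + 1) * pairSum ℚ n (n - 1))) := by
  obtain ⟨h1, h2⟩ := sum_weightPoly_derivative n hn h3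
  have h4 := sum_weightPoly_pairSum n hn h3
  have hx : (2 * (n : ℝ) + 1) ^ 2 = (((2 * (n : ℚ) + 1) ^ 2 : ℚ) : ℝ) := by push_cast; ring
  simp only [hx, weightPoly_real_eval, weightPoly_real_derivative_eval, pairSum_cast,
    logDerivSum_cast] at h1 h2 h4
  have g1 : ∑ k ∈ Finset.range n, (weightPoly ℚ k).eval ((2 * (n : ℚ) + 1) ^ 2) = 0 := by
    exact_mod_cast h1
  have g2 : ∑ k ∈ Finset.range n, (4 * (derivative (weightPoly ℚ k)).eval ((2 * (n : ℚ) + 1) ^ 2) +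
      (weightPoly ℚ k).eval ((2 * (n : ℚ) + 1) ^ 2) * pairSum ℚ n k) = 0 := by
    exact_mod_cast h2
  have g4 : (2 * (n : ℚ) + 1) ^ 2 * ∑ k ∈ Finset.range n,
      (weightPoly ℚ k).eval ((2 * (n : ℚ) + 1) ^ 2) * pairSum ℚ n k =
      2 * (-1) ^ n * (logDerivSum ℚ n + 1 / (2 * n + 1) - (2 * n + 1) * pairSum ℚ n (n - 1)) := by
    apply Rat.cast_injective (α := ℝ)
    push_cast at h4 ⊢
    exact h4
  rw [Finset.sum_add_distrib, ← Finset.mul_sum] at g2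
  rw [truncatedPoly, derivative_sum, eval_finsetSum, eval_finsetSum]
  refine ⟨g1, ?_⟩
  -- The `pairSum` contribution is common to the two lines of differentiation and is eliminated
  -- here.
  linear_combination (1 / 2 : ℚ) * (2 * (n : ℚ) + 1) ^ 2 * g2 - (1 / 2 : ℚ) * g4

section

variable {p n : ℕ} [hp : Fact p.Prime]

open Polynomial

theorem PadicIntegralPoly.eval {P : ℚ[X]} (hP : PadicIntegralPoly p P) {x : ℚ}
    (hx : PadicDvd p 0 x) : PadicDvd p 0 (P.eval x) := by
  rw [eval_eq_sum_range]
  exact PadicDvd.sum fun i _ => (hP i).mul_zero (hx.pow_zero i)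

theorem PadicIntegralPoly.derivative {P : ℚ[X]} (hP : PadicIntegralPoly p P) :
    PadicIntegralPoly p (derivative P) := fun i => by
  rw [coeff_derivative]
  have := PadicDvd.natCast (p := p) (i + 1)
  push_cast at this
  exact (hP _).mul_zero this

theorem PadicIntegralPoly.divX {P : ℚ[X]} (hP : PadicIntegralPoly p P) :
    PadicIntegralPoly p (divX P) := fun i => by
  rw [coeff_divX]
  exact hP _

/-- P(0) - P(x) + xP'(x) = c₂x² + O(x³) with p-integral error coefficients, taken at x = p². -/
theorem PadicIntegralPoly.eval_zero_sub {P : ℚ[X]} (hP : PadicIntegralPoly p P) :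
    PadicDvd p 6 (P.eval 0 - P.eval ((p : ℚ) ^ 2) +
      (p : ℚ) ^ 2 * (Polynomial.derivative P).eval ((p : ℚ) ^ 2) - (p : ℚ) ^ 4 * P.coeff 2) := by
  set Q := Polynomial.divX (Polynomial.divX (Polynomial.divX P)) with hQ
  have hQi : PadicIntegralPoly p Q := hP.divX.divX.divX
  have e : P = X ^ 3 * Q + Polynomial.C (P.coeff 2) * X ^ 2 + Polynomial.C (P.coeff 1) * X +
      Polynomial.C (P.coeff 0) := by
    conv_lhs => rw [← divX_mul_X_add P, ← divX_mul_X_add P.divX, ← divX_mul_X_add P.divX.divX]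
    simp only [coeff_divX, zero_add, one_add_one_eq_two]
    rw [← hQ]
    ring
  have hx := (PadicDvd.natCast (p := p) p).pow_zero 2
  have h1 := hQi.eval hx
  have h2 := hQi.derivative.eval hx
  refine ((((h1.mul_left (PadicDvd.ofNat 2))).add (h2.mul_left hx)).pow_mul 6).of_eq ?_
  have e1 : P.eval ((p : ℚ) ^ 2) = (p : ℚ) ^ 6 * Q.eval ((p : ℚ) ^ 2) + P.coeff 2 * (p : ℚ) ^ 4 +
      P.coeff 1 * (p : ℚ) ^ 2 + P.coeff 0 := by
    conv_lhs => rw [e]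
    simp only [eval_add, eval_mul, eval_pow, eval_X, eval_C]
    ring
  have e2 : (Polynomial.derivative P).eval ((p : ℚ) ^ 2) =
      (p : ℚ) ^ 6 * (Polynomial.derivative Q).eval ((p : ℚ) ^ 2) +
      3 * (p : ℚ) ^ 4 * Q.eval ((p : ℚ) ^ 2) + 2 * P.coeff 2 * (p : ℚ) ^ 2 + P.coeff 1 := by
    conv_lhs => rw [e]
    simp only [derivative_add, derivative_mul, derivative_X_pow, derivative_C, derivative_X,
      eval_add, eval_mul, eval_pow, eval_X, eval_C, eval_zero, eval_one, Nat.cast_ofNat, map_ofNat,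
      eval_ofNat]
    ring
  rw [e1, e2, ← coeff_zero_eq_eval_zero]
  ring

/-- The derivative term gives H/12 + (28/405)p⁴O_5 and c₂ gives (5/162)p⁴O_5, up to the sign (-1)^n.
The coefficients of O_5 add to 1/10, and 1/10 · 3/16 = 3/160. -/
theorem central_sum_congr (h5 : 5 < p) (hn : 2 * n + 1 = p) :
    PadicDvd p 5 (∑ k ∈ Finset.range n, (Nat.choose (2 * k) k : ℚ) / ((16 : ℚ) ^ k * (2 * (k : ℚ) + 1)) -
      (-1) ^ n * (recipSum 1 (2 * n) / 12 + 3 / 160 * (p : ℚ) ^ 4 * _root_.bernoulli (p - 5))) := by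
  have hP : 2 * (n : ℚ) + 1 = p := by exact_mod_cast hn
  have h3 : n % 3 ≠ 1 := fun h => by
    have : 3 ∣ p := by omega
    have := (Nat.prime_dvd_prime_iff_eq Nat.prime_three hp.out).1 this
    omega
  obtain ⟨g1, g2⟩ := truncatedPoly_derivative_eval (n := n) (by omega) h3
  have hT := ((padicIntegralPoly_truncatedPoly h5 hn).eval_zero_sub).mono (show 5 ≤ 6 by norm_num)
  have hB := logDerivSum_combination h5 hn
  have hC := (coeff_two_truncatedPoly_oddRecipSum h5 hn).pow_mul' 4
  have hO := ((oddRecipSum_five_sub_bernoulli h5 hn).pow_mul' 4).rat_mul h5 (1 / 10) (by norm_num)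
  have hB' := hB.rat_mul h5 (1 / 2) (by norm_num)
  have e : (truncatedPoly n).eval 0 =
      ∑ k ∈ Finset.range n, (Nat.choose (2 * k) k : ℚ) / ((16 : ℚ) ^ k * (2 * (k : ℚ) + 1)) := by
    rw [truncatedPoly, eval_finsetSum]
    refine Finset.sum_congr rfl fun k _ => ?_
    rw [weightPoly_eval, centralWeight]
    simp
  rw [hP] at g1 g2 hB'
  rw [g1, e] at hT
  have hs := (PadicDvd.one.neg (p := p)).pow_zero n
  refine (((hT.add (hB'.mul_left hs)).add hC).add (hO.mul_left hs)).of_eq ?_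
  linear_combination (1 / 2 : ℚ) * g2

end

theorem harmonicSum_eq_recipSum (n r : ℕ) : harmonicSum n r = recipSum r n := by
  have h := Finset.sum_Ico_add' (fun k : ℕ => 1 / (k : ℚ) ^ r) 0 n 1
  rw [zero_add] at h
  rw [harmonicSum, recipSum, Finset.range_eq_Ico, ← Finset.Ico_add_one_right_eq_Icc, ← h]
  exact Finset.sum_congr rfl fun k _ => by push_cast; rfl

theorem theorem3p1 (p : ℕ) (hp : p.Prime) (hp5 : 5 < p) :
    RatModEq (p ^ 5)
      (∑ k ∈ Finset.Icc 0 ((p - 3) / 2),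
        (Nat.choose (2 * k) k : ℚ) / ((16 : ℚ) ^ k * (2 * (k : ℚ) + 1)))
      ((-1 : ℚ) ^ ((p - 1) / 2) *
        (harmonicSum (p - 1) 1 / 12 + 3 / 160 * (p : ℚ) ^ 4 * bernoulli (p - 5))) ∧
    RatModEq (p ^ 4)
      (∑ k ∈ Finset.Icc 0 ((p - 3) / 2),
        (Nat.choose (2 * k) k : ℚ) / ((-16 : ℚ) ^ k * (2 * (k : ℚ) + 1) ^ 2))
      (harmonicSum (p - 1) 1 / (5 * (p : ℚ)) +
        7 / 200 * (p : ℚ) ^ 3 * bernoulli (p - 5)) := by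
  have : Fact p.Prime := ⟨hp⟩
  obtain ⟨n, hn⟩ : ∃ n, 2 * n + 1 = p := by
    obtain ⟨k, hk⟩ := hp.odd_of_ne_two (by omega)
    exact ⟨k, hk.symm⟩
  have hI : Finset.Icc 0 ((p - 3) / 2) = Finset.range n := by
    ext k
    rw [Finset.mem_Icc, Finset.mem_range]
    omega
  rw [hI, harmonicSum_eq_recipSum, show p - 1 = 2 * n by omega, show 2 * n / 2 = n by omega]
  exact ⟨(central_sum_congr hp5 hn).ratModEq, (alternating_sum_congr hp5 hn).ratModEq⟩
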